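/- **Formal completeness of the Bethe ansatz at $q=0$.** *Cartan data.* Let $X_N^{(r)}$ be one of $A^{(1)}_n\,(n\ge1)$, $B^{(1)}_n\,(n\ge3)$, $C^{(1)}_n\,(n\ge2)$, $D^{(1)}_n\,(n\ge4)$, $E^{(1)}_{6,7,8}$, $F_4^{(1)}$, $G_2^{(1)}$, $A^{(2)}_{2n}\,(n\ge1)$, $A^{(2)}_{2n-1}\,(n\ge2)$, $D^{(2)}_{n+1}\,(n\ge2)$, $E^{(2)}_6$, $D^{(3)}_4$. It corresponds to the simple Lie algebra $\mathfrak g=X_N$ with Cartan matrix $A'$, nodes $I=\{1,\dots,N\}$, and a diagram automorphism $\sigma$ of order $r$. Let $\mathfrak g_0$ be the $\sigma$-invariant subalgebra ($\mathfrak g_0=\mathfrak g$ if $r=1$, and $\mathfrak g_0=B_n,C_n,B_n,F_4,G_2$ for the five twisted types in the order listed), with Cartan matrix $A=(A_{ab})$ indexed by $I_\sigma=I/\sigma=\{1,\dots,n\}$, simple roots $\alpha_a=\sum_bA_{ba}\Lambda_b$ and fundamental weights $\Lambda_a$; we choose representatives so that $I_\sigma\subset I$ and $A_{ab}<0\Leftrightarrow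 A'_{ab}<0$. Let $d_a$ (resp. $d'_i$) be the coprime positive integers making $(d_aA_{ab})$ (resp. $(d'_iA'_{ij})$) symmetric; put $\epsilon_a=2$ if $A'_{a\sigma(a)}<0$ and $\epsilon_a=1$ otherwise. Put $H=\{(a,m): a\in I_\sigma,\ m\in\mathbb Z_{\ge1}\}$ and let $\mathcal N$ be the set of finitely supported families $N=(N^{(a)}_m)_{(a,m)\in H}$ of non-negative integers. *KR modules.* Let $q\in\mathbb C^\times$ not be a root of unity and let $\zeta^{(a)}_m\in\mathbb C^\times$. The KR module $W^{(a)}_m=W^{(a)}_m(\zeta^{(a)}_m)$ is the finite-dimensional irreducible (type 1) $U_q(X_N^{(r)})$-module with Drinfeld polynomials $P_a(u)=\prod_{k=1}^m(1-\zeta^{(a)}_m q^{\epsilon_ad_a(m+2-2k)}u)$ and $P_b(u)=1$ for $b\in I_\sigma$, $b\ne a$. With $y_a=e^{-\alpha_a}$, its normalized $\mathfrak g_0$-character is $\mathcal Q^{(a)}_m(y)=e^{-m\epsilon_a\Lambda_a}\operatorname{ch}W^{(a)}_m$. For $\nu\in\mathcal N$ let $W^\nu=\bigotimes_{(a,m)\in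 H}(W^{(a)}_m)^{\otimes\nu^{(a)}_m}$, let $\lambda^\nu=\sum_{(a,m)} m\,\nu^{(a)}_m\epsilon_a\Lambda_a$, and let $\mathcal Q^\nu(y)=e^{-\lambda^\nu}\operatorname{ch}W^\nu$ be its normalized $\mathfrak g_0$-character. *$Q$-system.* For $(a,m),(b,k)\in H$ let $G_{am,bk}$ be $-\frac1{\epsilon_b}A_{ba}\delta_{m,k}$ if $r>1$; and, if $r=1$, $-A_{ba}(\delta_{m,2k-1}+2\delta_{m,2k}+\delta_{m,2k+1})$ if $d_b/d_a=2$; $-A_{ba}(\delta_{m,3k-2}+2\delta_{m,3k-1}+3\delta_{m,3k}+2\delta_{m,3k+1}+\delta_{m,3k+2})$ if $d_b/d_a=3$; $-A_{ab}\delta_{d_am,d_bk}$ otherwise. The $Q$-system for power series $Q^{(a)}_m(y)\in\mathbb C[[y_1,\dots,y_n]]$ with constant terms $1$ (and $Q^{(a)}_0=1$) is $$(Q^{(a)}_m)^2=Q^{(a)}_{m+1}Q^{(a)}_{m-1}+y_a^m(Q^{(a)}_m)^2\prod_{(b,k)\in H}(Q^{(b)}_k)^{G_{am,bk}}\qquad((a,m)\in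 H).$$ A solution is canonical if $\lim_{m\to\infty}Q^{(a)}_m$ exists in $\mathbb C[[y]]$ (in the adic topology) for every $a$. *The numbers $R(\nu,N)$ and the string center equation.* For $\nu,N\in\mathcal N$ put $\gamma^{(a)}_m=\sum_k\min(m,k)\nu^{(a)}_k$, $$P^{(a)}_m=\gamma^{(a)}_m-\sum_{(b,k)\in H}\frac{A_{ab}}{\epsilon_ad'_b}\min(d'_am,d'_bk)N^{(b)}_k,\qquad \hat P^{(a)}_m=\gamma^{(a)}_m-\sum_{(b,k)\in H}\frac{A'_{ab}}{d'_b}\min(d'_am,d'_bk)N^{(b)}_k,$$ let $H'=\{(a,m)\in H:N^{(a)}_m>0\}$ and $$R(\nu,N)=\det_{(a,m),(b,k)\in H'}\Bigl(\delta_{ab}\delta_{mk}P^{(a)}_m+\tfrac{A_{ba}}{\epsilon_bd'_a}\min(d'_am,d'_bk)N^{(b)}_k\Bigr)\prod_{(a,m)\in H'}\frac1{N^{(a)}_m}\binom{P^{(a)}_m+N^{(a)}_m-1}{N^{(a)}_m-1}$$ with $R(\nu,0)=1$, where $\binom{x}{j}=x(x-1)\cdots(x-j+1)/j!$. Put $R^\nu(y)=\sum_{N\in\mathcal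 N}R(\nu,N)\prod_{a=1}^ny_a^{\sum_m mN^{(a)}_m}$. The string center equation (SCE) of pattern $N$ is the system, for $(a,m)\in H'$ and $1\le\alpha\le N^{(a)}_m$, $$\prod_{(b,k)\in H'}\prod_{\beta=1}^{N^{(b)}_k}(z^{(b)}_{k\beta})^{A_{am\alpha,bk\beta}}=(-1)^{\hat P^{(a)}_m+N^{(a)}_m+1},\quad A_{am\alpha,bk\beta}=\delta_{ab}\delta_{mk}\delta_{\alpha\beta}(P^{(a)}_m+N^{(a)}_m)+\tfrac{A_{ba}}{\epsilon_bd'_a}\min(d'_am,d'_bk)-\delta_{ab}\delta_{mk},$$ in unknowns $z^{(a)}_{m\alpha}\in\mathbb C^\times$. A solution is off-diagonal if $z^{(a)}_{m\alpha}\ne z^{(a)}_{m\beta}$ whenever $\alpha\ne\beta$. Let $S(\nu,N)$ be the number of off-diagonal solutions divided by $\prod_{(a,m)\in H'}N^{(a)}_m!$. **Corollary.** Assume the Kirillov–Reshetikhin conjecture for $X_N^{(r)}$: $\mathcal Q^{(a)}_m(y)$, $(a,m)\in H$, is equal to the canonical solution of the $Q$-system. Then for every $\nu\in\mathcal N$ $$\mathcal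 Q^\nu(y)=\prod_{(a,m)\in H}\bigl(\mathcal Q^{(a)}_m(y)\bigr)^{\nu^{(a)}_m}=R^\nu(y).$$ Moreover, for every $N\in\mathcal N$ with $P^{(a)}_m(\nu,N)\ge0$ for all $(a,m)\in H'$, the number of off-diagonal solutions is finite and $S(\nu,N)=R(\nu,N)$. Hence, if $\mu\in\mathbb Z_{\ge0}^n$ is such that this positivity holds for every $N\in\mathcal N$ with $\sum_m mN^{(a)}_m=\mu_a$ for all $a$, then the multiplicity of the weight $\lambda^\nu-\sum_a\mu_a\alpha_a$ in $W^\nu$ equals $\sum_N S(\nu,N)$, the sum being over those $N$. -/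

import Mathlib

noncomputable section

namespace QAffine

open scoped BigOperators TensorProduct

/-! ## The affine types, their Cartan matrices and diagram automorphisms -/

/-- The affine Lie algebras of type `X_N^{(r)}`. -/
inductive AffineType : Type
  | A1 (n : ℕ) (hn : 1 ≤ n)
  | B1 (n : ℕ) (hn : 3 ≤ n)
  | C1 (n : ℕ) (hn : 2 ≤ n)
  | D1 (n : ℕ) (hn : 4 ≤ n)
  | E61
  | E71
  | E81
  | F41
  | G21
  /-- `A_{2n}^{(2)}` -/
  | A2even (n : ℕ) (hn : 1 ≤ n)
  /-- `A_{2n-1}^{(2)}` -/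
  | A2odd (n : ℕ) (hn : 2 ≤ n)
  /-- `D_{n+1}^{(2)}` -/
  | D2 (n : ℕ) (hn : 2 ≤ n)
  | E62
  | D43

namespace AffineType

/-- The rank `n` of `𝔤₀`, the subalgebra of `𝔤 = X_N` fixed by `σ`. -/
def rank : AffineType → ℕ
  | A1 n _ => n
  | B1 n _ => n
  | C1 n _ => n
  | D1 n _ => n
  | E61 => 6
  | E71 => 7
  | E81 => 8
  | F41 => 4
  | G21 => 2
  | A2even n _ => n
  | A2odd n _ => n
  | D2 n _ => n
  | E62 => 4
  | D43 => 2

/-- The rank `N` of `𝔤 = X_N`. -/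
def bigRank : AffineType → ℕ
  | A1 n _ => n
  | B1 n _ => n
  | C1 n _ => n
  | D1 n _ => n
  | E61 => 6
  | E71 => 7
  | E81 => 8
  | F41 => 4
  | G21 => 2
  | A2even n _ => 2 * n
  | A2odd n _ => 2 * n - 1
  | D2 n _ => n + 1
  | E62 => 6
  | D43 => 4

/-- The order `r` of the diagram automorphism `σ`. -/
def r : AffineType → ℕ
  | A2even _ _ => 2
  | A2odd _ _ => 2
  | D2 _ _ => 2
  | E62 => 2
  | D43 => 3
  | _ => 1

theorem rank_le_bigRank (X : AffineType) : X.rank ≤ X.bigRank := by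
  cases X <;> simp only [rank, bigRank] <;> omega

/-- The section `ι : I_σ → I`, `a ↦ a`, of the projection of the node set `I = {1, …, N}` of `𝔤`
to the set `I_σ = {1, …, n}` of `σ`-orbits. -/
def incl (X : AffineType) : Fin X.rank → Fin X.bigRank :=
  Fin.castLE X.rank_le_bigRank

/-- `E₆` with the enumeration of nodes `1-2-3-5-6`, and `4` attached to `3`. -/
def cartanE6 : Matrix (Fin 6) (Fin 6) ℤ :=
  CartanMatrix.E₆.submatrix ![0, 2, 3, 1, 4, 5] ![0, 2, 3, 1, 4, 5]

/-- The Cartan matrix of `𝔤 = X_N`, with `A_{ij} = ⟨h_i, α_j⟩`, i.e. such that `d_i A_{ij}` is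
symmetric where `d_i` is proportional to `(α_i, α_i)`. For the non-simply-laced types this is the
transpose of the convention of `CartanMatrix`. The nodes are enumerated so that
for `E₇` the node `7` is attached to `3` in the chain `1-2-3-4-5-6`,
and for `E₈` the node `8` is attached to `5` in the chain `1-2-3-4-5-6-7`. -/
def cartanBig : (X : AffineType) → Matrix (Fin X.bigRank) (Fin X.bigRank) ℤ
  | A1 n _ => CartanMatrix.A n
  | B1 n _ => (CartanMatrix.B n).transpose
  | C1 n _ => (CartanMatrix.C n).transpose
  | D1 n _ => CartanMatrix.D n
  | E61 => cartanE6
  | E71 => CartanMatrix.E₇.submatrix ![0, 2, 3, 4, 5, 6, 1] ![0, 2, 3, 4, 5, 6, 1]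
  | E81 => CartanMatrix.E₈.submatrix ![7, 6, 5, 4, 3, 2, 0, 1] ![7, 6, 5, 4, 3, 2, 0, 1]
  | F41 => CartanMatrix.F₄.transpose
  | G21 => CartanMatrix.G₂.transpose
  | A2even n _ => CartanMatrix.A (2 * n)
  | A2odd n _ => CartanMatrix.A (2 * n - 1)
  | D2 n _ => CartanMatrix.D (n + 1)
  | E62 => cartanE6
  | D43 => CartanMatrix.D 4

/-- The Cartan matrix `A` of `𝔤₀`: it is `X_n` if `r = 1`, and
`B_n, C_n, B_n, F_4, G_2` for `A_{2n}^{(2)}, A_{2n-1}^{(2)}, D_{n+1}^{(2)}, E_6^{(2)}, D_4^{(3)}`.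
In the last two cases the short roots come first. -/
def cartan : (X : AffineType) → Matrix (Fin X.rank) (Fin X.rank) ℤ
  | A1 n h => cartanBig (A1 n h)
  | B1 n h => cartanBig (B1 n h)
  | C1 n h => cartanBig (C1 n h)
  | D1 n h => cartanBig (D1 n h)
  | E61 => cartanBig E61
  | E71 => cartanBig E71
  | E81 => cartanBig E81
  | F41 => cartanBig F41
  | G21 => cartanBig G21
  | A2even n _ => (CartanMatrix.B n).transpose
  | A2odd n _ => (CartanMatrix.C n).transpose
  | D2 n _ => (CartanMatrix.B n).transpose
  | E62 => CartanMatrix.F₄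
  | D43 => CartanMatrix.G₂

/-- The diagram automorphism `σ` of `𝔤`. -/
def sigma : (X : AffineType) → Equiv.Perm (Fin X.bigRank)
  | A2even n _ => (Fin.revPerm : Equiv.Perm (Fin (2 * n)))
  | A2odd n _ => (Fin.revPerm : Equiv.Perm (Fin (2 * n - 1)))
  | D2 n _ => (Equiv.swap ⟨n - 1, Nat.lt_succ_of_le (Nat.sub_le n 1)⟩ ⟨n, Nat.lt_succ_self n⟩ :
      Equiv.Perm (Fin (n + 1)))
  | E62 => (Equiv.swap 0 5 * Equiv.swap 1 4 : Equiv.Perm (Fin 6))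
  | D43 => (Equiv.swap 0 2 * Equiv.swap 2 3 : Equiv.Perm (Fin 4))
  | _ => 1

/-- The coprime positive integers `d_a` such that `(d_a A_{ab})` is symmetric. -/
def d : (X : AffineType) → Fin X.rank → ℕ
  | B1 n _, a => if (a : ℕ) + 1 < n then 2 else 1
  | C1 n _, a => if (a : ℕ) + 1 < n then 1 else 2
  | F41, a => if (a : ℕ) < 2 then 2 else 1
  | G21, a => if (a : ℕ) < 1 then 3 else 1
  | A2even n _, a => if (a : ℕ) + 1 < n then 2 else 1
  | A2odd n _, a => if (a : ℕ) + 1 < n then 1 else 2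
  | D2 n _, a => if (a : ℕ) + 1 < n then 2 else 1
  | E62, a => if (a : ℕ) < 2 then 1 else 2
  | D43, a => if (a : ℕ) < 1 then 1 else 3
  | _, _ => 1

theorem d_pos (X : AffineType) (a : Fin X.rank) : 0 < X.d a := by
  cases X <;> simp only [d] <;> first | omega | (split_ifs <;> omega)

/-- The coprime positive integers such that `(dBig i * cartanBig i j)` is symmetric: they are the
numbers `d` if `r = 1`, and `1` if `r > 1`. -/
def dBig (X : AffineType) (i : Fin X.bigRank) : ℕ :=
  if h : (i : ℕ) < X.rank ∧ X.r = 1 then X.d ⟨i, h.1⟩ else 1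

/-- `r` if `σ(i) = i`, and `1` otherwise. -/
def epsBig (X : AffineType) (i : Fin X.bigRank) : ℕ :=
  if X.sigma i = i then X.r else 1

/-- `ε_a`: it is `2` if the nodes `a` and `σ(a)` are joined in the diagram of `𝔤`, and `1`
otherwise. -/
def eps (X : AffineType) (a : Fin X.rank) : ℕ :=
  if X.cartanBig (X.incl a) (X.sigma (X.incl a)) < 0 then 2 else 1

/-- `κ₀`: it is `2` for `A_{2n}^{(2)}` and `1` otherwise. -/
def kappa : AffineType → ℕ
  | A2even _ _ => 2
  | _ => 1

/-- The index set `H` of pairs `(a, m)`, `a ∈ I_σ`, `m ≥ 1`. -/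
abbrev H (X : AffineType) : Type := Fin X.rank × ℕ+

/-- The number `κ₀ ε'_i d'_i` (where `ε'_i` is `epsBig` and `d'_i` is `dBig`); for `i ∈ I_σ` it
equals `ε_i d_i`. -/
def qExp (X : AffineType) (i : Fin X.bigRank) : ℕ :=
  X.kappa * X.epsBig i * X.dBig i

end AffineType

/-! ## The quantum loop algebra -/

section Algebra

variable (X : AffineType) (q : ℂ)

/-- Generators of Drinfeld's realization: `x s i k` is `x^±_{i,k}`, where `s = ±1`, and
`phi 1 i m`, `phi (-1) i m` are `φ^+_{i,m}`, `φ^-_{i,-m}` respectively. -/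
inductive Gen : Type
  | x (s : ℤˣ) (i : Fin X.bigRank) (k : ℤ)
  | phi (s : ℤˣ) (i : Fin X.bigRank) (m : ℕ)

variable {X} in
/-- `x^±_{i,k}` in the free algebra. -/
def fx (s : ℤˣ) (i : Fin X.bigRank) (k : ℤ) : FreeAlgebra ℂ (Gen X) :=
  FreeAlgebra.ι ℂ (Gen.x s i k)

variable {X} in
/-- `φ^±_{i,k}` in the free algebra; `φ^+_{i,k} = 0` for `k < 0` and `φ^-_{i,k} = 0` for `k > 0`. -/
def fphi (s : ℤˣ) (i : Fin X.bigRank) (k : ℤ) : FreeAlgebra ℂ (Gen X) :=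
  if 0 ≤ (s : ℤ) * k then FreeAlgebra.ι ℂ (Gen.phi s i k.natAbs) else 0

/-- `ω = exp(2π√-1/r)`. -/
def omega : ℂ := Complex.exp (2 * Real.pi * Complex.I / X.r)

/-- The exponent `κ₀ d'_i A'_{i σ^t(j)}`. -/
def bExp (i j : Fin X.bigRank) (t : ℕ) : ℤ :=
  X.kappa * X.dBig i * X.cartanBig i ((X.sigma ^ t) j)

/-- `∏_{t=1}^r (1 - ω^t q^{±b_t} u)` with `b_t = bExp i j t`; the coefficient of `u^p` is that of
`z^p w^{r-p}` in `∏_t (w - ω^t q^{±b_t} z)`. -/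
def gLeft (s : ℤˣ) (i j : Fin X.bigRank) : Polynomial ℂ :=
  ∏ t ∈ Finset.Icc 1 X.r,
    (1 - Polynomial.C (omega X ^ t * q ^ ((s : ℤ) * bExp X i j t)) * Polynomial.X)

/-- `∏_{t=1}^r (q^{±b_t} - ω^t u)` with `b_t = bExp i j t`; the coefficient of `u^p` is that of
`z^p w^{r-p}` in `∏_t (q^{±b_t} w - ω^t z)`. -/
def gRight (s : ℤˣ) (i j : Fin X.bigRank) : Polynomial ℂ :=
  ∏ t ∈ Finset.Icc 1 X.r,
    (Polynomial.C (q ^ ((s : ℤ) * bExp X i j t)) - Polynomial.C (omega X ^ t) * Polynomial.X)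

/-- The quantum integer `[n]_p`. -/
def qInt (p : ℂ) (n : ℕ) : ℂ := (p ^ n - p⁻¹ ^ n) / (p - p⁻¹)

/-- The quantum factorial `[n]_p!`. -/
def qFact (p : ℂ) (n : ℕ) : ℂ := ∏ k ∈ Finset.Icc 1 n, qInt p k

/-- The quantum binomial coefficient. -/
def qBinom (p : ℂ) (n k : ℕ) : ℂ := qFact p n / (qFact p k * qFact p (n - k))

/-- The polynomial `P^±_{ij}(z₁, z₂)` in the Serre relations of the twisted algebras, for adjacent
nodes `i`, `j` with `j ≠ σ(i)`, as the list of its coefficients: the entry at place `p` is the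
coefficient of `z₁^p z₂^{ℓ-p}`, where `ℓ + 1` is the length of the list. -/
def serrePoly (s : ℤˣ) (i j : Fin X.bigRank) : List ℂ :=
  if X.sigma i = i then [1]
  else if X.cartanBig i (X.sigma i) < 0 then [1, q ^ (-2 * (s : ℤ))]
  else if X.sigma j = j then (List.range X.r).map fun p => (q ^ (-2 * (s : ℤ))) ^ p
  else [1]

/-- The parameter of the quantum integer `[2]` in the Serre relations of the twisted algebras. -/
def serreParam (i j : Fin X.bigRank) : ℂ :=
  if X.sigma i = i ∨ X.sigma j = j then q ^ X.r else q ^ X.kappa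

/-- The defining relations. With the currents `x^±_i(z) = ∑_k x^±_{i,k} z^k` and
`φ^±_i(z) = ∑_k φ^±_{i,k} z^k`, the relations `phi_x` and `x_x` are
`∏_t (w - ω^t q^{±b_t} z) y(z) x^±_j(w) = ∏_t (q^{±b_t} w - ω^t z) x^±_j(w) y(z)` for
`y = φ^+_i, φ^-_i` and `y = x^±_i` respectively, where `b_t = κ₀ d'_i A'_{i σ^t(j)}`. -/
inductive Rel : FreeAlgebra ℂ (Gen X) → FreeAlgebra ℂ (Gen X) → Prop
  /-- `x^±_{σ(i),k} = ω^k x^±_{i,k}` -/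
  | sigma_x (s : ℤˣ) (i : Fin X.bigRank) (k : ℤ) :
      Rel (fx s (X.sigma i) k) ((omega X ^ k) • fx s i k)
  /-- `φ^±_{σ(i),k} = ω^k φ^±_{i,k}` -/
  | sigma_phi (s : ℤˣ) (i : Fin X.bigRank) (k : ℤ) :
      Rel (fphi s (X.sigma i) k) ((omega X ^ k) • fphi s i k)
  /-- `φ^±_{i,0}` are inverse to each other -/
  | phi_inv (s : ℤˣ) (i : Fin X.bigRank) : Rel (fphi s i 0 * fphi (-s) i 0) 1
  | phi_comm (s t : ℤˣ) (i j : Fin X.bigRank) (k l : ℤ) :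
      Rel (fphi s i k * fphi t j l) (fphi t j l * fphi s i k)
  | phi_x (e s : ℤˣ) (i j : Fin X.bigRank) (k l : ℤ) :
      Rel
        (∑ p ∈ Finset.range (X.r + 1),
          (gLeft X q s i j).coeff p • (fphi e i (k - p) * fx s j (l - (X.r - p))))
        (∑ p ∈ Finset.range (X.r + 1),
          (gRight X q s i j).coeff p • (fx s j (l - (X.r - p)) * fphi e i (k - p)))
  /-- `[x^+_{i,k}, x^-_{j,l}]
  = ∑_{t=1}^r δ_{σ^t(i),j} ω^{tl} (φ^+_{i,k+l} - φ^-_{i,k+l}) / (q_i - q_i⁻¹)`,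
  `q_i = q^{κ₀ ε'_i d'_i}` -/
  | x_plus_minus (i j : Fin X.bigRank) (k l : ℤ) :
      Rel (fx 1 i k * fx (-1) j l - fx (-1) j l * fx 1 i k)
        ((∑ t ∈ Finset.Icc 1 X.r,
            if (X.sigma ^ t) i = j then omega X ^ ((t : ℤ) * l) else 0) •
          ((q ^ X.qExp i - (q ^ X.qExp i)⁻¹)⁻¹ • (fphi 1 i (k + l) - fphi (-1) i (k + l))))
  | x_x (s : ℤˣ) (i j : Fin X.bigRank) (k l : ℤ) :
      Rel
        (∑ p ∈ Finset.range (X.r + 1),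
          (gLeft X q s i j).coeff p • (fx s i (k - p) * fx s j (l - (X.r - p))))
        (∑ p ∈ Finset.range (X.r + 1),
          (gRight X q s i j).coeff p • (fx s j (l - (X.r - p)) * fx s i (k - p)))
  /-- generators attached to nodes in pairwise orthogonal orbits commute -/
  | x_comm (s : ℤˣ) (i j : Fin X.bigRank) (hij : ∀ t : ℕ, X.cartanBig i ((X.sigma ^ t) j) = 0)
      (k l : ℤ) : Rel (fx s i k * fx s j l) (fx s j l * fx s i k)
  /-- Serre relations, `r = 1`, in degree `M = 1 - A_{ij}` -/
  | serre_untwisted (hr : X.r = 1) (s : ℤˣ) (i j : Fin X.bigRank) (hij : i ≠ j) (M : ℕ)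
      (hM : (M : ℤ) = 1 - X.cartanBig i j) (k : Fin M → ℤ) (l : ℤ) :
      Rel
        (∑ π : Equiv.Perm (Fin M), ∑ t ∈ Finset.range (M + 1),
          ((-1 : ℂ) ^ t * qBinom (q ^ X.qExp i) M t) •
            (((List.ofFn fun c => fx s i (k (π c))).take t).prod * fx s j l *
              ((List.ofFn fun c => fx s i (k (π c))).drop t).prod))
        0
  /-- Serre relations, `r > 1`: the symmetrization in `z₁, z₂` of
  `P^±_{ij}(z₁,z₂) (x_i(z₁) x_i(z₂) x_j(w) - [2] x_i(z₁) x_j(w) x_i(z₂) + x_j(w) x_i(z₁) x_i(z₂))`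
  vanishes -/
  | serre_twisted (hr : 1 < X.r) (s : ℤˣ) (i j : Fin X.bigRank) (hij : X.cartanBig i j = -1)
      (hσ : X.sigma i ≠ j) (k : Fin 2 → ℤ) (l : ℤ) :
      Rel
        (∑ π : Equiv.Perm (Fin 2), ∑ p : Fin (serrePoly X q s i j).length,
          (serrePoly X q s i j).get p •
            (fx s i (k (π 0) - p) *
                fx s i (k (π 1) - ((serrePoly X q s i j).length - 1 - p)) * fx s j l
              - qInt (serreParam X q i j) 2 • (fx s i (k (π 0) - p) * fx s j l *
                  fx s i (k (π 1) - ((serrePoly X q s i j).length - 1 - p)))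
              + fx s j l * fx s i (k (π 0) - p) *
                  fx s i (k (π 1) - ((serrePoly X q s i j).length - 1 - p))))
        0
  /-- for `A_{2n}^{(2)}` and adjacent `i`, `σ(i)`: the symmetrization in `z₁, z₂, z₃` of
  `(q^{±3e} z₁^e - (q + q⁻¹) z₂^e + q^{∓3e} z₃^e) x^±_i(z₁) x^±_i(z₂) x^±_i(z₃)`, `e = 1, -1`,
  vanishes -/
  | serre_cubic (s e : ℤˣ) (i : Fin X.bigRank) (hi : X.cartanBig i (X.sigma i) < 0)
      (k : Fin 3 → ℤ) :
      Rel
        (∑ π : Equiv.Perm (Fin 3),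
          (q ^ (3 * (s : ℤ) * e) •
              (fx s i (k (π 0) - e) * fx s i (k (π 1)) * fx s i (k (π 2)))
            - (q + q⁻¹) • (fx s i (k (π 0)) * fx s i (k (π 1) - e) * fx s i (k (π 2)))
            + q ^ (-3 * (s : ℤ) * e) •
              (fx s i (k (π 0)) * fx s i (k (π 1)) * fx s i (k (π 2) - e))))
        0

/-- The quantum affine algebra `U_q(X_N^{(r)})` at trivial central charge, in Drinfeld's
realization. All finite-dimensional representations of type 1 factor through it. -/
abbrev QuantumAffine : Type := RingQuot (Rel X q)

/-- The element `x^±_{i,k}` of the quantum affine algebra. -/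
def xGen (s : ℤˣ) (i : Fin X.bigRank) (k : ℤ) : QuantumAffine X q :=
  RingQuot.mkAlgHom ℂ (Rel X q) (fx s i k)

/-- The element `φ^±_{i,k}` of the quantum affine algebra. -/
def phiGen (s : ℤˣ) (i : Fin X.bigRank) (k : ℤ) : QuantumAffine X q :=
  RingQuot.mkAlgHom ℂ (Rel X q) (fphi s i k)

end Algebra

/-! ## Kirillov–Reshetikhin modules -/

section Modules

variable (X : AffineType) (q : ℂ)

/-- `V` has a highest weight vector `v` with Drinfeld polynomials `P_a(u)`, `a ∈ I_σ`: `x^+_{i,k}`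
kills `v`, and `v` is an eigenvector of all `φ^±_{a,k}`, where `∑_k φ^±_{a,k} u^k` acts by the
expansion at `u = 0` (for `+`) or `u = ∞` (for `-`) of
`q_a^{deg P_a} P_a(q_a^{-2} u^e) / P_a(u^e)`, with `q_a = q^{ε_a d_a}` and
`e = r` if `σ(a) = a`, `e = 1` otherwise. -/
def HasDrinfeldPolynomials (P : Fin X.rank → Polynomial ℂ) (V : Type*) [AddCommGroup V]
    [Module ℂ V] [Module (QuantumAffine X q) V] : Prop :=
  ∃ v : V, v ≠ 0 ∧ (∀ i k, xGen X q 1 i k • v = 0) ∧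
    ∀ a : Fin X.rank, ∃ cp cm : ℕ → ℂ,
      (∀ m : ℕ, phiGen X q 1 (X.incl a) m • v = cp m • v) ∧
      (∀ m : ℕ, phiGen X q (-1) (X.incl a) (-m) • v = cm m • v) ∧
      let qa : ℂ := q ^ (X.eps a * X.d a)
      let num : Polynomial ℂ :=
        Polynomial.C (qa ^ (P a).natDegree) * (P a).comp (Polynomial.C (qa⁻¹ ^ 2) * Polynomial.X)
      let e : ℕ := X.epsBig (X.incl a)
      ((Polynomial.expand ℂ e (P a) : Polynomial ℂ) : PowerSeries ℂ) * PowerSeries.mk cp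
          = ((Polynomial.expand ℂ e num : Polynomial ℂ) : PowerSeries ℂ) ∧
      ((Polynomial.expand ℂ e (P a).reverse : Polynomial ℂ) : PowerSeries ℂ) * PowerSeries.mk cm
          = ((Polynomial.expand ℂ e num.reverse : Polynomial ℂ) : PowerSeries ℂ)

/-- The Drinfeld polynomials of the KR module `W^{(a)}_m(ζ)`:
`P_a(u) = ∏_{k=1}^m (1 - ζ q^{ε_a d_a (m+2-2k)} u)` and `P_b(u) = 1` for `b ≠ a`. -/
def krPolynomial (p : X.H) (ζ : ℂ) (b : Fin X.rank) : Polynomial ℂ :=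
  if b = p.1 then
    ∏ k ∈ Finset.Icc 1 (p.2 : ℕ),
      (1 - Polynomial.C (ζ * q ^ (((X.eps p.1 * X.d p.1 : ℕ) : ℤ) * ((p.2 : ℕ) + 2 - 2 * k)))
        * Polynomial.X)
  else 1

/-- `V` is (isomorphic to) the Kirillov–Reshetikhin module `W^{(a)}_m(ζ)`, `p = (a, m)`: the
finite-dimensional irreducible module with the prescribed Drinfeld polynomials. -/
def IsKRModule (p : X.H) (ζ : ℂ) (V : Type*) [AddCommGroup V] [Module ℂ V]
    [Module (QuantumAffine X q) V] : Prop :=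
  FiniteDimensional ℂ V ∧ IsSimpleModule (QuantumAffine X q) V ∧
    HasDrinfeldPolynomials X q (krPolynomial X q p ζ) V

/-- The action on a module of `K_b = φ^+_{b,0}`, the generator `q^{d_b h_b}` of the Cartan part of
`U_q(𝔤₀)`. -/
def cartanAction (V : Type*) [AddCommGroup V] [Module ℂ V] [Module (QuantumAffine X q) V]
    [IsScalarTower ℂ (QuantumAffine X q) V] (b : Fin X.rank) : Module.End ℂ V :=
  Algebra.lsmul ℂ ℂ V (phiGen X q 1 (X.incl b) 0)

/-- Multiplicity of the weight `∑_b λ_b Λ_b` of `𝔤₀` in a space on which `K_b` acts by `T b`: the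
dimension of the space of vectors `v` with `K_b v = q^{d_b λ_b} v` for all `b`. -/
def weightMultiplicity {V : Type*} [AddCommGroup V] [Module ℂ V]
    (T : Fin X.rank → Module.End ℂ V) (wt : Fin X.rank → ℤ) : ℕ :=
  Module.finrank ℂ (⨅ b, (T b).eigenspace (q ^ ((X.d b : ℤ) * wt b)) : Submodule ℂ V)

/-- The weight `λ - ∑_a μ_a α_a`, in the basis of fundamental weights, where
`α_a = ∑_b A_{ba} Λ_b`. -/
def lowered (top : Fin X.rank → ℤ) (μ : Fin X.rank →₀ ℕ) (b : Fin X.rank) : ℤ :=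
  top b - ∑ a, (μ a : ℤ) * X.cartan b a

/-- The normalized character `e^{-λ} ch V` as a power series in `y_a = e^{-α_a}`: the coefficient
of `∏_a y_a^{μ_a}` is the multiplicity of the weight `λ - ∑_a μ_a α_a`. -/
def normalizedCharacter {V : Type*} [AddCommGroup V] [Module ℂ V]
    (T : Fin X.rank → Module.End ℂ V) (top : Fin X.rank → ℤ) :
    MvPowerSeries (Fin X.rank) ℂ :=
  fun μ => (weightMultiplicity X q T (lowered X top μ) : ℂ)

/-- The weight `∑_{(a,m)} ν^{(a)}_m m ε_a Λ_a`, where `x_a = e^{ε_a Λ_a}`. -/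
def topWeight (ν : X.H →₀ ℕ) (b : Fin X.rank) : ℤ :=
  ν.sum fun p v => if p.1 = b then ((v * (p.2 : ℕ) * X.eps b : ℕ) : ℤ) else 0

/-- The normalized `𝔤₀`-character of a KR module `V = W^{(a)}_m(ζ)`, `p = (a, m)`. -/
def krCharacter (p : X.H) (V : Type*) [AddCommGroup V] [Module ℂ V]
    [Module (QuantumAffine X q) V] [IsScalarTower ℂ (QuantumAffine X q) V] :
    MvPowerSeries (Fin X.rank) ℂ :=
  normalizedCharacter X q (cartanAction X q V) (topWeight X (Finsupp.single p 1))

variable (W : X.H → Type*) [∀ p, AddCommGroup (W p)] [∀ p, Module ℂ (W p)]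
  [∀ p, Module (QuantumAffine X q) (W p)] [∀ p, IsScalarTower ℂ (QuantumAffine X q) (W p)]

/-- The tensor product `W^ν` of `ν^{(a)}_m` copies of each `W^{(a)}_m`. -/
abbrev TensorModule (ν : X.H →₀ ℕ) : Type _ :=
  PiTensorProduct ℂ fun s : (Σ p : ν.support, Fin (ν p)) => W s.1

/-- The action of the group-like elements `K_b` on `W^ν`. -/
def tensorCartanAction (ν : X.H →₀ ℕ) (b : Fin X.rank) :
    Module.End ℂ (TensorModule X W ν) :=
  PiTensorProduct.map fun s : (Σ p : ν.support, Fin (ν p)) => cartanAction X q (W s.1) b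

/-- The normalized `𝔤₀`-character of `W^ν`. -/
def tensorCharacter (ν : X.H →₀ ℕ) : MvPowerSeries (Fin X.rank) ℂ :=
  normalizedCharacter X q (tensorCartanAction X q W ν) (topWeight X ν)

end Modules

/-! ## The `Q`-system and its canonical solutions -/

section QSystem

variable (X : AffineType)

/-- The integers `G_{am,bk}`. -/
def gExp (p s : X.H) : ℤ :=
  let a := p.1
  let b := s.1
  let m : ℕ := p.2
  let k : ℕ := s.2
  if 1 < X.r then (if m = k then -(X.cartan b a / X.eps b) else 0)
  else if X.d b = 2 * X.d a then
    -X.cartan b a * (if m = 2 * k then 2 else if m + 1 = 2 * k ∨ m = 2 * k + 1 then 1 else 0)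
  else if X.d b = 3 * X.d a then
    -X.cartan b a *
      (if m = 3 * k then 3 else if m + 1 = 3 * k ∨ m = 3 * k + 1 then 2
        else if m + 2 = 3 * k ∨ m = 3 * k + 2 then 1 else 0)
  else if X.d a * m = X.d b * k then -X.cartan a b else 0

/-- Only finitely many factors of the product over `(b,k)` in the `Q`-system are nontrivial. -/
theorem gExp_finite (p : X.H) : {s : X.H | gExp X p s ≠ 0}.Finite := by
  have hfin : ∀ B : ℕ, {s : X.H | (s.2 : ℕ) ≤ B}.Finite := fun B => by
    refine ((Set.finite_univ (α := Fin X.rank)).prod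
      (Set.finite_Iic (B.succPNat))).subset ?_
    intro s hs
    refine ⟨Set.mem_univ _, ?_⟩
    rw [Set.mem_Iic, ← PNat.coe_le_coe]
    exact Nat.le_succ_of_le hs
  refine (hfin (X.d p.1 * p.2 + 2 * p.2)).subset ?_
  rintro ⟨b, k⟩ hs
  change gExp X p (b, k) ≠ 0 at hs
  change (k : ℕ) ≤ _
  by_contra hlt
  apply hs
  have hm := p.2.pos
  have hd := AffineType.d_pos X b
  have hk := Nat.le_mul_of_pos_left (k : ℕ) hd
  have hne : X.d p.1 * (p.2 : ℕ) ≠ X.d b * (k : ℕ) := by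
    simp only [not_le] at hlt
    omega
  simp only [not_le] at hlt
  unfold gExp
  dsimp only
  rw [if_neg hne]
  split_ifs <;> first | (exfalso; omega) | rfl | simp

/-- Integer powers of a power series with invertible constant term. -/
def psZPow {σ : Type*} (f : MvPowerSeries σ ℂ) : ℤ → MvPowerSeries σ ℂ
  | Int.ofNat n => f ^ n
  | Int.negSucc n => f⁻¹ ^ (n + 1)

variable {X} in
/-- `Q^{(a)}_m` for `m ≥ 0`, where `Q^{(a)}_0 = 1`. -/
def extend (Q : X.H → MvPowerSeries (Fin X.rank) ℂ) (a : Fin X.rank) (m : ℕ) :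
    MvPowerSeries (Fin X.rank) ℂ :=
  if h : 0 < m then Q (a, ⟨m, h⟩) else 1

/-- Solutions of the `Q`-system: power series with unit constant terms such that
`(Q^{(a)}_m)² = Q^{(a)}_{m+1} Q^{(a)}_{m-1}
+ y_a^m (Q^{(a)}_m)² ∏_{(b,k) ∈ H} (Q^{(b)}_k)^{G_{am,bk}}`. -/
def IsQSystemSolution (Q : X.H → MvPowerSeries (Fin X.rank) ℂ) : Prop :=
  (∀ p, MvPowerSeries.constantCoeff (Q p) = 1) ∧
    ∀ p : X.H,
      Q p ^ 2 = extend Q p.1 ((p.2 : ℕ) + 1) * extend Q p.1 ((p.2 : ℕ) - 1) +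
        MvPowerSeries.X p.1 ^ (p.2 : ℕ) * Q p ^ 2 * ∏ᶠ s : X.H, psZPow (Q s) (gExp X p s)

/-- A solution is canonical if `lim_{m → ∞} Q^{(a)}_m` exists in `ℂ[[y]]` for the adic topology,
i.e. every coefficient is eventually equal to that of the limit. -/
def IsCanonicalSolution (Q : X.H → MvPowerSeries (Fin X.rank) ℂ) : Prop :=
  IsQSystemSolution X Q ∧
    ∀ a, ∃ L : MvPowerSeries (Fin X.rank) ℂ, ∀ μ, ∀ᶠ m : ℕ in Filter.atTop,
      MvPowerSeries.coeff μ (extend Q a m) = MvPowerSeries.coeff μ L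

end QSystem

/-! ## The string center equation and the numbers `R(ν,N)` -/

section SCE

variable (X : AffineType)

/-- `γ^{(a)}_m = ∑_k min(m,k) ν^{(a)}_k`. -/
def gamma (ν : X.H →₀ ℕ) (p : X.H) : ℤ :=
  ν.sum fun s v => if s.1 = p.1 then ((min (p.2 : ℕ) s.2 * v : ℕ) : ℤ) else 0

/-- `min(d'_a m, d'_b k)` for `p = (a,m)`, `s = (b,k)`, where `d'` is `dBig`. -/
def minD (p s : X.H) : ℤ :=
  ((min (X.dBig (X.incl p.1) * p.2) (X.dBig (X.incl s.1) * s.2) : ℕ) : ℤ)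

/-- The integer `A_{ab} min(d'_a m, d'_b k) / (ε_a d'_b)` for `p = (a,m)`, `s = (b,k)`; the
division is exact. -/
def bCoef (p s : X.H) : ℤ :=
  X.cartan p.1 s.1 * minD X p s / ((X.eps p.1 * X.dBig (X.incl s.1) : ℕ) : ℤ)

/-- `P^{(a)}_m(ν,N)
= γ^{(a)}_m - ∑_{(b,k)} A_{ab} / (ε_a d'_b) min(d'_a m, d'_b k) N^{(b)}_k`. -/
def vacancy (ν N : X.H →₀ ℕ) (p : X.H) : ℤ :=
  gamma X ν p - N.sum fun s v => bCoef X p s * v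

/-- The variant of `vacancy` with `A_{ab} / ε_a` replaced by the Cartan matrix of `𝔤`. -/
def vacancyHat (ν N : X.H →₀ ℕ) (p : X.H) : ℤ :=
  gamma X ν p - N.sum fun s v =>
    X.cartanBig (X.incl p.1) (X.incl s.1) * minD X p s / (X.dBig (X.incl s.1) : ℤ) * v

variable {X} in
/-- The indices `(a, m, α)` with `N^{(a)}_m > 0`, `1 ≤ α ≤ N^{(a)}_m`. -/
abbrev StringIndex (N : X.H →₀ ℕ) : Type := Σ p : N.support, Fin (N p)

/-- The integers `A_{amα,bkβ} = δ_{ab} δ_{mk} δ_{αβ} (P^{(a)}_m + N^{(a)}_m)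
+ A_{ba} / (ε_b d'_a) min(d'_a m, d'_b k) - δ_{ab} δ_{mk}`. -/
def sceMatrix (ν N : X.H →₀ ℕ) (i j : StringIndex N) : ℤ :=
  (if i = j then vacancy X ν N i.1 + N i.1 else 0) + bCoef X j.1 i.1 -
    (if i.1 = j.1 then 1 else 0)

/-- The string center equation of pattern `N`:
`∏_{(b,k,β)} (z^{(b)}_{kβ})^{A_{amα,bkβ}} = (-1)^{P̂^{(a)}_m + N^{(a)}_m + 1}`. -/
def IsSCESolution (ν N : X.H →₀ ℕ) (z : StringIndex N → ℂˣ) : Prop :=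
  ∀ i : StringIndex N,
    ∏ j, z j ^ sceMatrix X ν N i j = (-1 : ℂˣ) ^ (vacancyHat X ν N i.1 + N i.1 + 1)

/-- The off-diagonal solutions of the string center equation: those with `z^{(a)}_{mα} ≠ z^{(a)}_{mβ}`
whenever `α ≠ β`. -/
def offDiagonalSolutions (ν N : X.H →₀ ℕ) : Set (StringIndex N → ℂˣ) :=
  {z | IsSCESolution X ν N z ∧ ∀ p, Function.Injective fun α => z ⟨p, α⟩}

/-- The matrix `F_{am,bk} = δ_{ab} δ_{mk} P^{(a)}_m
+ A_{ba} / (ε_b d'_a) min(d'_a m, d'_b k) N^{(b)}_k`, where `(a,m)` and `(b,k)` run over the support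
of `N`. -/
def fMatrix (ν N : X.H →₀ ℕ) : Matrix N.support N.support ℤ :=
  Matrix.of fun p s => (if p = s then vacancy X ν N p else 0) + bCoef X s p * N s

/-- `R(ν,N) = det(F) ∏_{(a,m)} (1 / N^{(a)}_m) binom(P^{(a)}_m + N^{(a)}_m - 1, N^{(a)}_m - 1)`,
where `(a,m)` runs over the support of `N`; in particular `R(ν,0) = 1`. -/
def R (ν N : X.H →₀ ℕ) : ℚ :=
  ((fMatrix X ν N).det : ℚ) * ∏ p ∈ N.support,
    (1 / (N p : ℚ)) * ((Ring.choose (vacancy X ν N p + N p - 1) (N p - 1) : ℤ) : ℚ)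

/-- The patterns `N` with `∑_m m N^{(a)}_m = μ_a` for all `a`. -/
def patterns (μ : Fin X.rank →₀ ℕ) : Set (X.H →₀ ℕ) :=
  {N | (N.sum fun p v => Finsupp.single p.1 ((p.2 : ℕ) * v)) = μ}

theorem patterns_finite (μ : Fin X.rank →₀ ℕ) : (patterns X μ).Finite := by
  classical
  let B : ℕ := ∑ a, μ a
  refine (Finset.finite_toSet (Finset.finsupp
    (Finset.univ ×ˢ Finset.Icc (1 : ℕ+) B.succPNat : Finset X.H)
    (fun p => Finset.range (μ p.1 + 1)))).subset ?_
  intro N hN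
  have key : ∀ p, (p.2 : ℕ) * N p ≤ μ p.1 := fun p => by
    by_cases hp : p ∈ N.support
    · rw [← (show _ = μ from hN), Finsupp.sum, Finsupp.finsetSum_apply]
      refine le_trans ?_ (Finset.single_le_sum (fun _ _ => Nat.zero_le _) hp)
      simp
    · simp [Finsupp.notMem_support_iff.mp hp]
  rw [Finset.mem_coe, Finset.mem_finsupp_iff]
  refine ⟨fun p hp => ?_, fun p _ => ?_⟩
  · rw [Finset.mem_product, Finset.mem_Icc]
    refine ⟨Finset.mem_univ _, one_le, ?_⟩
    rw [← PNat.coe_le_coe]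
    have h1 : 0 < N p := Nat.pos_of_ne_zero (Finsupp.mem_support_iff.mp hp)
    have h2 : μ p.1 ≤ B := Finset.single_le_sum (f := fun a => μ a)
      (fun _ _ => Nat.zero_le _) (Finset.mem_univ p.1)
    have h3 := Nat.le_mul_of_pos_right (p.2 : ℕ) h1
    have h4 := key p
    change (p.2 : ℕ) ≤ B + 1
    omega
  · rw [Finset.mem_range]
    have h3 := Nat.le_mul_of_pos_left (N p) p.2.pos
    have h4 := key p
    omega

/-- `R^ν(y) = ∑_N R(ν,N) ∏_a y_a^{∑_m m N^{(a)}_m}`. -/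
def RSeries (ν : X.H →₀ ℕ) : MvPowerSeries (Fin X.rank) ℂ :=
  fun μ => ((∑ᶠ N ∈ patterns X μ, R X ν N : ℚ) : ℂ)

end SCE

end QAffine

end

namespace QAffine

/-! ### Finite Cartan matrices: a positive vector with positive image -/

namespace AffineType

/-! The proof has three independent strands.

Series. A monomial `∏ Q^ν` with integral exponents is recorded by `γ^{(a)}_m = ∑_k min(m,k)
ν^{(a)}_k`. Since `min` is the Green function of the second difference, multiplying by `(Q_m)² /
(Q_{m-1} Q_{m+1})` adds a unit vector `δ_p` to `γ` (`gammaZ_secondDiff`), and multiplying by `∏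
Q^{G_{p,·}}` subtracts the column `B_{·p}` of the matrix `B` of the integers `bCoef`
(`gammaZ_gFinsupp`). So the nonlinear `Q`-system becomes the linear relation `Q^{γ+δ_p} = Q^γ +
y_a^m Q^{γ+δ_p-B_{·p}}` (`monomialZ_add_secondDiff`). The numbers `R` obey the same relation: once
the binomial factors are absorbed into the columns, the vacancy number at `p` enters column `p`
only, and there Pascal's rule makes the determinant additive (`rNumber_add_single`). For `γ = 0` the
vector `N` is in the left kernel, so only `N = 0` contributes (`rNumber_zero_left`). By induction on
the degree `μ`, the difference of the two coefficients is unchanged by second differences; existence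
of the limits of `Q_m` makes it unchanged by first differences too, hence independent of `ν`, and it
vanishes at `ν = 0` (`coeff_monomialZ`).

Counting. The equations for two unknowns of the same `(a,m)` differ only in which unknown carries
the exponent `P + N`, so ratios inside a group are `(P+N)`-th roots of unity. Distinct ratios are
counted by falling factorials, and the leading unknowns solve a monomial system whose matrix is the
`F` of the definition of `R`, with `|det F|` solutions over `ℂˣ` (`natCard_distinctSolution`,
`natCard_monomial_solutions`). Nonnegative vacancy numbers force `det F > 0`, because up to positive
diagonal factors `F` is a nonnegative diagonal plus a positive definite kernel, the Cartan form
coupled with `min` (`fMatrix_det_pos`).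

Characters. An irreducible highest weight module is spanned by products of `x^-_{a,k}` applied to
the highest weight vector (`loweringSpan_eq_top`), so a KR module has a basis of weight vectors with
weights `mε_aΛ_a - ∑_a μ_a α_a`, `μ_a ≥ 0`. As `q` is not a root of unity and the Cartan matrix is
nonsingular, the normalized character is the sum of the monomials of such a basis, which is
multiplicative on tensor products (`tensorCharacter_eq_prod`). -/

theorem sum_fin_eq_of_near_diagonal {n : ℕ} (F : ℕ → ℤ) (a : ℕ) (ha : a < n)
    (h : ∀ k, k < n → a + 2 < k ∨ k + 2 < a → F k = 0) :
    ∑ b : Fin n, F b = (if 2 ≤ a then F (a - 2) else 0) + (if 1 ≤ a then F (a - 1) else 0) + F a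
      + (if a + 1 < n then F (a + 1) else 0) + (if a + 2 < n then F (a + 2) else 0) := by
  rw [Fin.sum_univ_eq_sum_range F n]
  -- The inner guards `2 ≤ a` and `1 ≤ a` discard the entries where truncated subtraction makes `a -
  -- 2` or `a - 1` coincide with another index.
  have key : ∀ k ∈ Finset.range n, F k = (if k = a - 2 then (if 2 ≤ a then F k else 0) else 0)
      + (if k = a - 1 then (if 1 ≤ a then F k else 0) else 0) + (if k = a then F k else 0)
      + (if k = a + 1 then F k else 0) + (if k = a + 2 then F k else 0) := by
    intro k hk
    have hk := Finset.mem_range.1 hk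
    by_cases hf : a + 2 < k ∨ k + 2 < a
    · rw [h k hk hf]; simp
    · rcases (by omega : k = a ∨ k = a + 1 ∨ k = a + 2 ∨ (1 ≤ a ∧ k = a - 1) ∨
        (2 ≤ a ∧ k = a - 2)) with rfl | rfl | rfl | ⟨h1, rfl⟩ | ⟨h1, rfl⟩ <;>
      · split_ifs <;> omega
  rw [Finset.sum_congr rfl key]
  simp only [Finset.sum_add_distrib, Finset.sum_ite_eq', Finset.mem_range]
  rw [if_pos ha, if_pos (by omega : a - 2 < n), if_pos (by omega : a - 1 < n)]

/-- The witness is a concave quadratic vanishing at the two missing neighbours `-1` and `n`; minus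
its second difference is `2` in every row. -/
theorem cartanMatrix_A_positive (n : ℕ) :
    ∃ u : Fin n → ℤ, (∀ a, 0 < u a) ∧ ∀ a, 0 < ∑ b, CartanMatrix.A n a b * u b := by
  refine ⟨fun b => ((b : ℕ) + 1) * (n - (b : ℕ)), fun a => ?_, fun a => ?_⟩
  · have := a.2
    exact mul_pos (by positivity) (by omega)
  · obtain ⟨a, ha⟩ := a
    simp only [CartanMatrix.A, Matrix.of_apply, Fin.ext_iff]
    rw [sum_fin_eq_of_near_diagonal (fun k => (if a = k then 2
      else if a + 1 = k ∨ k + 1 = a then -1 else 0) * (((k : ℕ) + 1) * (n - (k : ℕ)))) a ha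
      (fun k hk hkT => by rw [if_neg (by omega), if_neg (by omega), zero_mul])]
    -- With `n = a + c + 1`, small values of `a` and `c` are the rows near the two ends, where
    -- neighbours are missing.
    obtain ⟨c, rfl⟩ := Nat.exists_eq_add_of_lt ha
    rcases a with _ | _ | a <;> rcases c with _ | c <;>
      simp [show ∀ x : ℕ, x + 1 - 1 = x from fun _ => rfl] <;> grind

/-- The parabola of type `A_{2n-1}`, folded at its middle node: the entry `-2` of the last row
counts the two equal neighbours, and every row gives `2`. -/
theorem cartanMatrix_C_positive (n : ℕ) :
    ∃ u : Fin n → ℤ, (∀ a, 0 < u a) ∧ ∀ a, 0 < ∑ b, CartanMatrix.C n a b * u b := by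
  refine ⟨fun b => ((b : ℕ) + 1) * (2 * n - 1 - (b : ℕ)), fun a => ?_, fun a => ?_⟩
  · have := a.2
    exact mul_pos (by positivity) (by omega)
  · obtain ⟨a, ha⟩ := a
    simp only [CartanMatrix.C, Matrix.of_apply, Fin.ext_iff]
    rw [sum_fin_eq_of_near_diagonal (fun k => (if a = k then 2
      else if a + 1 = k then -1 else if k + 1 = a then if a = n - 1 then -2 else -1 else 0)
        * (((k : ℕ) + 1) * (2 * n - 1 - (k : ℕ)))) a ha
      (fun k hk hkT => by rw [if_neg (by omega), if_neg (by omega), if_neg (by omega), zero_mul])]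
    obtain ⟨c, rfl⟩ := Nat.exists_eq_add_of_lt ha
    rcases a with _ | _ | a <;> rcases c with _ | c <;>
      simp [show ∀ x : ℕ, x + 1 - 1 = x from fun _ => rfl] <;> grind

/-- The last entry is half the value of the parabola `2(b+1)(2n-1-b)` there, which compensates the
entry `-2`; all rows give `4` except the last, which gives `2`. -/
theorem cartanMatrix_B_positive (n : ℕ) (hn : 2 ≤ n) :
    ∃ u : Fin n → ℤ, (∀ a, 0 < u a) ∧ ∀ a, 0 < ∑ b, CartanMatrix.B n a b * u b := by
  refine ⟨fun b => if (b : ℕ) + 1 < n then 2 * ((b : ℕ) + 1) * (2 * n - 1 - (b : ℕ))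
    else n * n, fun a => ?_, fun a => ?_⟩
  · have := a.2
    dsimp only
    split_ifs
    · exact mul_pos (by positivity) (by omega)
    · positivity
  · obtain ⟨a, ha⟩ := a
    simp only [CartanMatrix.B, Matrix.of_apply, Fin.ext_iff]
    rw [sum_fin_eq_of_near_diagonal (fun k => (if a = k then 2
      else if a + 1 = k then if k = n - 1 then -2 else -1 else if k + 1 = a then -1 else 0)
        * (if k + 1 < n then 2 * ((k : ℤ) + 1) * (2 * n - 1 - k) else n * n : ℤ)) a ha
      (fun k hk hkT => by rw [if_neg (by omega), if_neg (by omega), if_neg (by omega), zero_mul])]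
    obtain ⟨c, rfl⟩ := Nat.exists_eq_add_of_lt ha
    rcases a with _ | _ | a <;> rcases c with _ | _ | c <;>
      simp [show ∀ x : ℕ, x + 1 - 1 = x from fun _ => rfl] <;> grind

/-- The two end nodes of the fork share equally the value of the parabola `2(b+1)(2n-3-b)` at `b =
n-2`; the rows give `4`, and `2` at the two end nodes. -/
theorem cartanMatrix_D_positive (n : ℕ) (hn : 3 ≤ n) :
    ∃ u : Fin n → ℤ, (∀ a, 0 < u a) ∧ ∀ a, 0 < ∑ b, CartanMatrix.D n a b * u b := by
  refine ⟨fun b => if (b : ℕ) + 2 < n then 2 * ((b : ℕ) + 1) * (2 * n - 3 - (b : ℕ))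
    else (n - 1) * (n - 1), fun a => ?_, fun a => ?_⟩
  · have := a.2
    dsimp only
    split_ifs
    · exact mul_pos (by positivity) (by omega)
    · exact mul_pos (by omega) (by omega)
  · obtain ⟨a, ha⟩ := a
    simp only [CartanMatrix.D, Matrix.of_apply, Fin.ext_iff]
    rw [sum_fin_eq_of_near_diagonal (fun k => (if a = k then 2 else if n ≤ 2 then 0
      else if a + 1 = k ∧ k + 2 < n then -1 else if k + 1 = a ∧ a + 2 < n then -1
      else if a + 3 = n ∧ (k + 2 = n ∨ k + 1 = n) then -1
      else if k + 3 = n ∧ (a + 2 = n ∨ a + 1 = n) then -1 else 0)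
        * (if k + 2 < n then 2 * ((k : ℤ) + 1) * (2 * n - 3 - k)
          else (n - 1) * (n - 1) : ℤ)) a ha
      (fun k hk hkT => by rw [if_neg (by omega), if_neg (by omega), if_neg (by omega),
        if_neg (by omega), if_neg (by omega), if_neg (by omega), zero_mul])]
    obtain ⟨c, rfl⟩ := Nat.exists_eq_add_of_lt ha
    rcases a with _ | _ | a <;> rcases c with _ | _ | _ | c <;>
      simp [show ∀ x : ℕ, x + 1 - 1 = x from fun _ => rfl] <;> grind

/-- This is the certificate for positive definiteness used in `quadraticForm_pos_of_mulVec_pos`. In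
the exceptional cases the listed vectors solve `A u = (2,…,2)`. -/
theorem exists_cartan_mulVec_pos (X : AffineType) :
    ∃ u : Fin X.rank → ℤ, (∀ a, 0 < u a) ∧ ∀ a, 0 < ∑ b, X.cartan a b * u b := by
  cases X with
  | A1 n hn => exact cartanMatrix_A_positive n
  | B1 n hn =>
    simp only [cartan, cartanBig, CartanMatrix.B_transpose]
    exact cartanMatrix_C_positive n
  | C1 n hn =>
    simp only [cartan, cartanBig, CartanMatrix.C_transpose]
    exact cartanMatrix_B_positive n hn
  | D1 n hn => exact cartanMatrix_D_positive n (by omega)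
  | E61 => exact ⟨(![16, 30, 42, 22, 30, 16] : Fin 6 → ℤ), (by decide : ∀ a : Fin 6, 0 < (![16, 30, 42, 22, 30, 16] : Fin 6 → ℤ) a), by decide⟩
  | E71 => exact ⟨(![34, 66, 96, 75, 52, 27, 49] : Fin 7 → ℤ), (by decide : ∀ a : Fin 7, 0 < (![34, 66, 96, 75, 52, 27, 49] : Fin 7 → ℤ) a), by decide⟩
  | E81 => exact ⟨(![58, 114, 168, 220, 270, 182, 92, 136] : Fin 8 → ℤ), (by decide : ∀ a : Fin 8, 0 < (![58, 114, 168, 220, 270, 182, 92, 136] : Fin 8 → ℤ) a), by decide⟩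
  | F41 => exact ⟨(![16, 30, 42, 22] : Fin 4 → ℤ), (by decide : ∀ a : Fin 4, 0 < (![16, 30, 42, 22] : Fin 4 → ℤ) a), by decide⟩
  | G21 => exact ⟨(![6, 10] : Fin 2 → ℤ), (by decide : ∀ a : Fin 2, 0 < (![6, 10] : Fin 2 → ℤ) a), by decide⟩
  | A2even n hn =>
    simp only [cartan, CartanMatrix.B_transpose]
    exact cartanMatrix_C_positive n
  | A2odd n hn =>
    simp only [cartan, CartanMatrix.C_transpose]
    exact cartanMatrix_B_positive n hn
  | D2 n hn =>
    simp only [cartan, CartanMatrix.B_transpose]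
    exact cartanMatrix_C_positive n
  | E62 => exact ⟨(![22, 42, 30, 16] : Fin 4 → ℤ), (by decide : ∀ a : Fin 4, 0 < (![22, 42, 30, 16] : Fin 4 → ℤ) a), by decide⟩
  | D43 => exact ⟨(![10, 6] : Fin 2 → ℤ), (by decide : ∀ a : Fin 2, 0 < (![10, 6] : Fin 2 → ℤ) a), by decide⟩

/-! ### Signs, symmetrizers and folding by the diagram automorphism -/

theorem cartan_nonpos (X : AffineType) (a b : Fin X.rank) (h : a ≠ b) : X.cartan a b ≤ 0 := by
  cases X with
  | A1 n hn => exact CartanMatrix.A_apply_le_zero_of_ne n a b h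
  | B1 n hn => exact CartanMatrix.B_off_diag_nonpos n b a h.symm
  | C1 n hn => exact CartanMatrix.C_off_diag_nonpos n b a h.symm
  | D1 n hn => exact CartanMatrix.D_off_diag_nonpos n a b h
  | A2even n hn => exact CartanMatrix.B_off_diag_nonpos n b a h.symm
  | A2odd n hn => exact CartanMatrix.C_off_diag_nonpos n b a h.symm
  | D2 n hn => exact CartanMatrix.B_off_diag_nonpos n b a h.symm
  | _ =>
    refine Int.toNat_eq_zero.1 (Or.resolve_left ?_ h)
    clear h
    revert a b
    decide

theorem d_mul_cartan (X : AffineType) (a b : Fin X.rank) :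
    (X.d a : ℤ) * X.cartan a b = X.d b * X.cartan b a := by
  cases X with
  | A1 n hn =>
    change (1 : ℤ) * CartanMatrix.A n a b = 1 * CartanMatrix.A n b a
    rw [(CartanMatrix.A_isSymm n).apply a b]
  | D1 n hn =>
    change (1 : ℤ) * CartanMatrix.D n a b = 1 * CartanMatrix.D n b a
    rw [(CartanMatrix.D_isSymm n).apply a b]
  | B1 n hn =>
    change Fin n at a b
    simp only [cartan, cartanBig, CartanMatrix.B_transpose, d, CartanMatrix.C, Matrix.of_apply]
    grind
  | C1 n hn =>
    change Fin n at a b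
    simp only [cartan, cartanBig, CartanMatrix.C_transpose, d, CartanMatrix.B, Matrix.of_apply]
    grind
  | A2even n hn =>
    change Fin n at a b
    simp only [cartan, CartanMatrix.B_transpose, d, CartanMatrix.C, Matrix.of_apply]
    grind
  | A2odd n hn =>
    change Fin n at a b
    simp only [cartan, CartanMatrix.C_transpose, d, CartanMatrix.B, Matrix.of_apply]
    grind
  | D2 n hn =>
    change Fin n at a b
    simp only [cartan, CartanMatrix.B_transpose, d, CartanMatrix.C, Matrix.of_apply]
    grind
  | _ => revert a b; decide

theorem eps_pos (X : AffineType) (a : Fin X.rank) : 0 < X.eps a := by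
  unfold eps; split_ifs <;> norm_num

theorem dBig_pos (X : AffineType) (i : Fin X.bigRank) : 0 < X.dBig i := by
  unfold dBig
  split_ifs
  · exact X.d_pos _
  · exact one_pos

theorem dBig_incl_of_untwisted (X : AffineType) (h : X.r = 1) (a : Fin X.rank) :
    X.dBig (X.incl a) = X.d a := by
  have h' : ((X.incl a : Fin X.bigRank) : ℕ) < X.rank ∧ X.r = 1 := ⟨a.2, h⟩
  rw [dBig, dif_pos h']
  rfl

theorem dBig_of_twisted (X : AffineType) (h : X.r ≠ 1) (i : Fin X.bigRank) :
    X.dBig i = 1 := dif_neg fun h' => h h'.2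

theorem d_ratio (X : AffineType) (a b : Fin X.rank) :
    X.d a = X.d b ∨ (X.d a = 1 ∧ (X.d b = 2 ∨ X.d b = 3)) ∨
      (X.d b = 1 ∧ (X.d a = 2 ∨ X.d a = 3)) := by
  cases X <;> simp only [d] <;> grind

theorem cartan_diag (X : AffineType) (a : Fin X.rank) : X.cartan a a = 2 := by
  cases X with
  | A1 n hn => exact congrFun (CartanMatrix.A_diag n) a
  | B1 n hn => exact CartanMatrix.B_diag n a
  | C1 n hn => exact CartanMatrix.C_diag n a
  | D1 n hn => exact CartanMatrix.D_diag n a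
  | A2even n hn => exact CartanMatrix.B_diag n a
  | A2odd n hn => exact CartanMatrix.C_diag n a
  | D2 n hn => exact CartanMatrix.B_diag n a
  | _ => revert a; decide

theorem sigma_of_untwisted (X : AffineType) (h : X.r = 1) : X.sigma = 1 := by
  cases X <;> first | rfl | exact absurd h (by simp [r])

theorem kappa_of_untwisted (X : AffineType) (h : X.r = 1) : X.kappa = 1 := by
  cases X <;> first | rfl | exact absurd h (by simp [r])

theorem cartanBig_incl_of_untwisted (X : AffineType) (h : X.r = 1) (a b : Fin X.rank) :
    X.cartanBig (X.incl a) (X.incl b) = X.cartan a b := by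
  cases X <;> first | rfl | exact absurd h (by simp [r])

theorem eps_of_untwisted (X : AffineType) (h : X.r = 1) (a : Fin X.rank) : X.eps a = 1 := by
  rw [eps, sigma_of_untwisted X h, Equiv.Perm.one_apply, cartanBig_incl_of_untwisted X h,
    cartan_diag]
  rfl

/-- A node adjacent to its `σ`-image occurs only for `A_{2n}^{(2)}`, at the last node; the
corresponding row of the Cartan matrix has only the entries `0`, `-2`, `2`. -/
theorem eps_dvd_cartan (X : AffineType) (a b : Fin X.rank) : (X.eps b : ℤ) ∣ X.cartan b a := by
  by_cases hr : X.r = 1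
  · rw [eps_of_untwisted X hr]
    exact one_dvd _
  cases X with
  | A2even n hn =>
    have h := rank_le_bigRank (A2even n hn)
    clear hr
    change Fin n at a b
    change n ≤ 2 * n at h
    change (((if CartanMatrix.A (2 * n) (Fin.castLE h b) (Fin.rev (Fin.castLE h b)) < 0
      then 2 else 1 : ℕ)) : ℤ) ∣ (CartanMatrix.B n).transpose b a
    split_ifs with h1
    · simp [CartanMatrix.A, Fin.ext_iff] at h1
      simp [CartanMatrix.B, Fin.ext_iff]
      grind
    · exact one_dvd _
  | A2odd n hn =>
    have h := rank_le_bigRank (A2odd n hn)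
    clear hr
    change Fin n at a b
    change n ≤ 2 * n - 1 at h
    change (((if CartanMatrix.A (2 * n - 1) (Fin.castLE h b) (Fin.rev (Fin.castLE h b)) < 0
      then 2 else 1 : ℕ)) : ℤ) ∣ (CartanMatrix.C n).transpose b a
    split_ifs with h1
    · simp [CartanMatrix.A, Fin.ext_iff] at h1
      grind
    · exact one_dvd _
  | D2 n hn =>
    have h := rank_le_bigRank (D2 n hn)
    clear hr
    change Fin n at a b
    change n ≤ n + 1 at h
    have hs : ((Equiv.swap ⟨n - 1, Nat.lt_succ_of_le (Nat.sub_le n 1)⟩ ⟨n, Nat.lt_succ_self n⟩ :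
        Equiv.Perm (Fin (n + 1))) (Fin.castLE h b)).val
        = if (b : ℕ) = n - 1 then n else (b : ℕ) := by
      have := b.2
      simp only [Equiv.swap_apply_def, Fin.ext_iff, Fin.val_castLE]
      split_ifs <;> simp <;> omega
    change (((if CartanMatrix.D (n + 1) (Fin.castLE h b)
      ((Equiv.swap ⟨n - 1, Nat.lt_succ_of_le (Nat.sub_le n 1)⟩ ⟨n, Nat.lt_succ_self n⟩ :
        Equiv.Perm (Fin (n + 1))) (Fin.castLE h b)) < 0 then 2 else 1 : ℕ)) : ℤ)
          ∣ (CartanMatrix.B n).transpose b a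
    generalize (Equiv.swap ⟨n - 1, Nat.lt_succ_of_le (Nat.sub_le n 1)⟩ ⟨n, Nat.lt_succ_self n⟩ :
        Equiv.Perm (Fin (n + 1))) (Fin.castLE h b) = c at hs
    split_ifs with h1
    · simp only [CartanMatrix.D, Fin.ext_iff, Matrix.of_apply, Fin.val_castLE, hs] at h1
      grind
    · exact one_dvd _
  | E62 => clear hr; revert a b; decide
  | D43 => clear hr; revert a b; decide
  | _ => exact absurd rfl hr

/-- The representatives `I_σ ⊆ I` meet all orbits of the diagram automorphism. -/
theorem exists_sigma_pow_incl (X : AffineType) (i : Fin X.bigRank) :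
    ∃ (a : Fin X.rank) (t : ℕ), (X.sigma ^ t) (X.incl a) = i := by
  cases X with
  | A2even n hn =>
    change Fin (2 * n) at i
    by_cases h : (i : ℕ) < n
    · exact ⟨(⟨i, h⟩ : Fin n), 0, rfl⟩
    · refine ⟨(⟨2 * n - 1 - i, by omega⟩ : Fin n), 1, Fin.ext ?_⟩
      change 2 * n - (2 * n - 1 - (i : ℕ) + 1) = i
      omega
  | A2odd n hn =>
    change Fin (2 * n - 1) at i
    by_cases h : (i : ℕ) < n
    · exact ⟨(⟨i, h⟩ : Fin n), 0, rfl⟩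
    · refine ⟨(⟨2 * n - 2 - i, by omega⟩ : Fin n), 1, Fin.ext ?_⟩
      change 2 * n - 1 - (2 * n - 2 - (i : ℕ) + 1) = i
      omega
  | D2 n hn =>
    change Fin (n + 1) at i
    by_cases h : (i : ℕ) < n
    · exact ⟨(⟨i, h⟩ : Fin n), 0, rfl⟩
    · have hi : (⟨n, Nat.lt_succ_self n⟩ : Fin (n + 1)) = i := Fin.ext (by simp; omega)
      have ht : n - 1 < n := by omega
      exact ⟨(⟨n - 1, ht⟩ : Fin n), 1, (Equiv.swap_apply_left _ _).trans hi⟩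
  | E62 =>
    have h : ∀ i : Fin 6, ∃ (a : Fin 4) (t : Fin 2),
        (((sigma E62 : Equiv.Perm (Fin 6)) ^ (t : ℕ)) (incl E62 a)).val = i.val := by decide
    obtain ⟨a, t, h⟩ := h i
    exact ⟨a, t, Fin.ext h⟩
  | D43 =>
    have h : ∀ i : Fin 4, ∃ (a : Fin 2) (t : Fin 3),
        (((sigma D43 : Equiv.Perm (Fin 4)) ^ (t : ℕ)) (incl D43 a)).val = i.val := by decide
    obtain ⟨a, t, h⟩ := h i
    exact ⟨a, t, Fin.ext h⟩
  | _ => exact ⟨i, 0, rfl⟩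

/-- Folding of root data: the exponents attached to a `σ`-orbit of `𝔤` add up to the symmetrized
Cartan matrix of `𝔤₀`. This is what turns the structure functions of the Drinfeld relations into
`𝔤₀`-weights. -/
theorem sum_cartanBig (X : AffineType) (a b : Fin X.rank) :
    (X.kappa : ℤ) * X.dBig (X.incl b) *
      ∑ t ∈ Finset.Icc 1 X.r, X.cartanBig (X.incl b) ((X.sigma ^ t) (X.incl a))
        = X.d b * X.cartan b a := by
  by_cases hr : X.r = 1
  · simp [hr, sigma_of_untwisted X hr, kappa_of_untwisted X hr, cartanBig_incl_of_untwisted X hr,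
      dBig_incl_of_untwisted X hr]
  rw [dBig_of_twisted X hr]
  cases X with
  | A2even n hn =>
    clear hr
    have h := rank_le_bigRank (A2even n hn)
    change Fin n at a b
    change n ≤ 2 * n at h
    change ((2 : ℕ) : ℤ) * ((1 : ℕ) : ℤ) * ∑ t ∈ Finset.Icc 1 2, CartanMatrix.A (2 * n)
        (Fin.castLE h b) (((Fin.revPerm : Equiv.Perm (Fin (2 * n))) ^ t) (Fin.castLE h a))
      = ((if (b : ℕ) + 1 < n then 2 else 1 : ℕ) : ℤ) * (CartanMatrix.B n).transpose b a
    simp [Finset.sum_Icc_succ_top, pow_two, CartanMatrix.A, CartanMatrix.B, Fin.ext_iff]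
    grind
  | A2odd n hn =>
    clear hr
    have h := rank_le_bigRank (A2odd n hn)
    change Fin n at a b
    change n ≤ 2 * n - 1 at h
    change ((1 : ℕ) : ℤ) * ((1 : ℕ) : ℤ) * ∑ t ∈ Finset.Icc 1 2, CartanMatrix.A (2 * n - 1)
        (Fin.castLE h b) (((Fin.revPerm : Equiv.Perm (Fin (2 * n - 1))) ^ t) (Fin.castLE h a))
      = ((if (b : ℕ) + 1 < n then 1 else 2 : ℕ) : ℤ) * (CartanMatrix.C n).transpose b a
    simp [Finset.sum_Icc_succ_top, pow_two, CartanMatrix.A, CartanMatrix.C, Fin.ext_iff]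
    grind
  | D2 n hn =>
    clear hr
    have h := rank_le_bigRank (D2 n hn)
    change Fin n at a b
    change n ≤ n + 1 at h
    change ((1 : ℕ) : ℤ) * ((1 : ℕ) : ℤ) * ∑ t ∈ Finset.Icc 1 2, CartanMatrix.D (n + 1)
        (Fin.castLE h b)
        (((Equiv.swap ⟨n - 1, Nat.lt_succ_of_le (Nat.sub_le n 1)⟩ ⟨n, Nat.lt_succ_self n⟩ :
          Equiv.Perm (Fin (n + 1))) ^ t) (Fin.castLE h a))
      = ((if (b : ℕ) + 1 < n then 2 else 1 : ℕ) : ℤ) * (CartanMatrix.B n).transpose b a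
    have hs : ((Equiv.swap ⟨n - 1, Nat.lt_succ_of_le (Nat.sub_le n 1)⟩ ⟨n, Nat.lt_succ_self n⟩ :
        Equiv.Perm (Fin (n + 1))) (Fin.castLE h a)).val
        = if (a : ℕ) = n - 1 then n else (a : ℕ) := by
      have := a.2
      simp only [Equiv.swap_apply_def, Fin.ext_iff, Fin.val_castLE]
      split_ifs <;> simp <;> omega
    rw [Finset.sum_Icc_succ_top (by norm_num), Finset.Icc_self, Finset.sum_singleton, pow_one,
      pow_two, Equiv.swap_mul_self, Equiv.Perm.one_apply]
    generalize (Equiv.swap ⟨n - 1, Nat.lt_succ_of_le (Nat.sub_le n 1)⟩ ⟨n, Nat.lt_succ_self n⟩ :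
        Equiv.Perm (Fin (n + 1))) (Fin.castLE h a) = c at hs
    simp only [CartanMatrix.D, CartanMatrix.B, Fin.ext_iff, Matrix.of_apply, Fin.val_castLE,
      Matrix.transpose_apply]
    by_cases ha : (a : ℕ) = n - 1
    · rw [if_pos ha] at hs
      simp only [hs]
      grind
    · rw [if_neg ha] at hs
      simp only [hs]
      grind
  | E62 => clear hr; revert a b; decide
  | D43 => clear hr; revert a b; decide
  | _ => exact absurd rfl hr

end AffineType
end QAffine

noncomputable section
namespace QAffine

/-! ## Positive definiteness of the symmetrized Cartan matrix -/

/-- Write `x_a = u_a t_a`. As off-diagonal entries are nonpositive, `t_a t_b ≤ (t_a² + t_b²)/2`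
bounds the form below by `∑_a t_a² u_a (S u)_a`, which is positive. -/
theorem quadraticForm_pos_of_mulVec_pos {ι : Type*} [Fintype ι] (S : ι → ι → ℝ)
    (hS : ∀ a b, S a b = S b a) (hS' : ∀ a b, a ≠ b → S a b ≤ 0) (u : ι → ℝ) (hu : ∀ a, 0 < u a)
    (hSu : ∀ a, 0 < ∑ b, S a b * u b) (x : ι → ℝ) (hx : x ≠ 0) :
    0 < ∑ a, ∑ b, S a b * x a * x b := by
  obtain ⟨a₀, ha₀⟩ := Function.ne_iff.1 hx
  set t : ι → ℝ := fun a => x a / u a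
  have hxt : ∀ a, x a = u a * t a := fun a => (mul_div_cancel₀ _ (hu a).ne').symm
  have h1 : ∀ a b, S a b * u a * u b * ((t a ^ 2 + t b ^ 2) / 2) ≤ S a b * x a * x b := by
    intro a b
    rw [hxt a, hxt b]
    by_cases hab : a = b
    · subst hab
      apply le_of_eq
      ring
    · have := mul_nonpos_of_nonpos_of_nonneg (hS' a b hab) (mul_pos (hu a) (hu b)).le
      nlinarith [mul_nonneg (neg_nonneg.2 this) (sq_nonneg (t a - t b))]
  have h2 : ∑ a, ∑ b, S a b * u a * u b * ((t a ^ 2 + t b ^ 2) / 2)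
      = ∑ a, t a ^ 2 * u a * ∑ b, S a b * u b := by
    have e1 : ∑ a, ∑ b, S a b * u a * u b * (t b ^ 2)
        = ∑ a, ∑ b, S a b * u a * u b * (t a ^ 2) := by
      rw [Finset.sum_comm]
      refine Finset.sum_congr rfl fun a _ => Finset.sum_congr rfl fun b _ => ?_
      rw [hS b a]; ring
    have e2 : ∑ a, ∑ b, S a b * u a * u b * ((t a ^ 2 + t b ^ 2) / 2)
        = (∑ a, ∑ b, S a b * u a * u b * (t a ^ 2)
          + ∑ a, ∑ b, S a b * u a * u b * (t b ^ 2)) / 2 := by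
      simp only [← Finset.sum_add_distrib, Finset.sum_div]
      refine Finset.sum_congr rfl fun a _ => Finset.sum_congr rfl fun b _ => ?_
      ring
    rw [e2, e1, add_self_div_two]
    refine Finset.sum_congr rfl fun a _ => ?_
    rw [Finset.mul_sum]
    exact Finset.sum_congr rfl fun b _ => by ring
  refine lt_of_lt_of_le ?_ (Finset.sum_le_sum fun a _ => Finset.sum_le_sum fun b _ => h1 a b)
  rw [h2]
  refine Finset.sum_pos' (fun a _ => ?_) ⟨a₀, Finset.mem_univ _, ?_⟩
  · exact mul_nonneg (mul_nonneg (sq_nonneg _) (hu a).le) (hSu a).le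
  · have : t a₀ ≠ 0 := div_ne_zero ha₀ (hu a₀).ne'
    exact mul_pos (mul_pos (by positivity) (hu a₀)) (hSu a₀)

variable (X : AffineType)

theorem cartan_quadraticForm_pos (x : Fin X.rank → ℝ) (hx : x ≠ 0) :
    0 < ∑ a, ∑ b, ((X.d a : ℝ) * X.cartan a b) * x a * x b := by
  obtain ⟨u, hu, hAu⟩ := X.exists_cartan_mulVec_pos
  refine quadraticForm_pos_of_mulVec_pos (fun a b => (X.d a : ℝ) * X.cartan a b)
    (fun a b => ?_) (fun a b hab => ?_) (fun a => (u a : ℝ)) (fun a => ?_) (fun a => ?_) x hx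
  · exact_mod_cast X.d_mul_cartan a b
  · have := X.cartan_nonpos a b hab
    exact mul_nonpos_of_nonneg_of_nonpos (by positivity) (by exact_mod_cast this)
  · exact_mod_cast hu a
  · have h1 : (0 : ℝ) < X.d a := by exact_mod_cast X.d_pos a
    have h2 : (0 : ℝ) < ∑ b, (X.cartan a b : ℝ) * u b := by exact_mod_cast hAu a
    simpa only [mul_assoc, ← Finset.mul_sum] using mul_pos h1 h2

/-- Simple roots are linearly independent, so a weight `λ - ∑_a μ_a α_a` determines `μ`. -/
theorem cartan_mulVec_injective {x : Fin X.rank → ℤ} (h : ∀ b, ∑ a, x a * X.cartan b a = 0) :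
    x = 0 := by
  by_contra hx
  have h1 : (fun a => (x a : ℝ)) ≠ 0 := fun h0 => hx <| by
    ext a
    have := congrFun h0 a
    simpa using this
  have h2 := cartan_quadraticForm_pos X _ h1
  refine h2.ne' (Finset.sum_eq_zero fun b _ => ?_)
  have h3 : ∑ a, (x a : ℝ) * X.cartan b a = 0 := by exact_mod_cast h b
  calc ∑ a, ((X.d b : ℝ) * X.cartan b a) * x b * x a
      = X.d b * x b * ∑ a, (x a : ℝ) * X.cartan b a := by
        rw [Finset.mul_sum]
        exact Finset.sum_congr rfl fun a _ => by ring
    _ = 0 := by rw [h3, mul_zero]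

/-! ## The integers `bCoef` -/

/-- The integer division defining `bCoef` is exact. For `r = 1` the denominator `d_b` divides the
minimum if `d_a = d_b`, divides `A_{ab}` if `d_a = 1`, and is `1` otherwise; for `r > 1` all `d'`
are `1` and `ε_a` divides `A_{ab}`. -/
theorem bCoef_mul (p s : X.H) :
    bCoef X p s * ((X.eps p.1 : ℤ) * X.dBig (X.incl s.1)) = X.cartan p.1 s.1 * minD X p s := by
  rw [bCoef, Nat.cast_mul]
  refine Int.ediv_mul_cancel ?_
  by_cases hr : X.r = 1
  · rw [X.eps_of_untwisted hr, minD, X.dBig_incl_of_untwisted hr, X.dBig_incl_of_untwisted hr,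
      Nat.cast_one, one_mul]
    have h := X.d_mul_cartan p.1 s.1
    rcases X.d_ratio p.1 s.1 with h1 | ⟨h1, h2⟩ | ⟨h1, h2⟩
    · rw [h1, Nat.mul_min_mul_left, Nat.cast_mul]
      exact Dvd.dvd.mul_left (dvd_mul_right _ _) _
    · rw [h1, Nat.cast_one, one_mul] at h
      exact Dvd.dvd.mul_right ⟨_, h⟩ _
    · rw [h1, Nat.cast_one]
      exact one_dvd _
  · rw [X.dBig_of_twisted hr, Nat.cast_one, mul_one]
    exact Dvd.dvd.mul_right (X.eps_dvd_cartan _ _) _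

/-! ## The quantities `γ` for integral exponents -/

/-- `γ^{(a)}_m = ∑_k min(m,k) ν^{(a)}_k` for integral `ν`. -/
def gammaZ (ν : X.H →₀ ℤ) (p : X.H) : ℤ :=
  ν.sum fun s v => if s.1 = p.1 then (min (p.2 : ℕ) s.2 : ℕ) * v else 0

theorem gammaZ_zero (p : X.H) : gammaZ X 0 p = 0 := Finsupp.sum_zero_index

theorem gammaZ_add (ν ν' : X.H →₀ ℤ) (p : X.H) :
    gammaZ X (ν + ν') p = gammaZ X ν p + gammaZ X ν' p := by
  refine Finsupp.sum_add_index' (fun s => by simp) (fun s v v' => ?_)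
  split_ifs <;> ring

theorem gammaZ_neg (ν : X.H →₀ ℤ) (p : X.H) : gammaZ X (-ν) p = -gammaZ X ν p := by
  have := gammaZ_add X ν (-ν) p
  rw [add_neg_cancel, gammaZ_zero] at this
  linarith

theorem gammaZ_single (s : X.H) (v : ℤ) (p : X.H) :
    gammaZ X (Finsupp.single s v) p = if s.1 = p.1 then (min (p.2 : ℕ) s.2 : ℕ) * v else 0 :=
  Finsupp.sum_single_index (by simp)

theorem gamma_eq_gammaZ (ν : X.H →₀ ℕ) :
    gamma X ν = gammaZ X (ν.mapRange (fun n : ℕ => (n : ℤ)) Nat.cast_zero) := by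
  ext p
  rw [gamma, gammaZ, Finsupp.sum_mapRange_index (fun s => by simp)]
  refine Finsupp.sum_congr fun s _ => ?_
  push_cast
  rfl

/-- If only two consecutive values `ν^{(b)}_t, ν^{(b)}_{t+1}` can be nonzero, then `γ^{(b)}_j` has
only two terms. -/
theorem gammaZ_eq_of_support (ν : X.H →₀ ℤ) (b : Fin X.rank) (j : ℕ+) (f : ℕ → ℤ) (t : ℕ)
    (hf : ∀ k : ℕ+, ν (b, k) = f k) (ht : ∀ k, k ≠ t → k ≠ t + 1 → f k = 0) :
    gammaZ X ν (b, j) = (min (j : ℕ) t : ℕ) * f t + (min (j : ℕ) (t + 1) : ℕ) * f (t + 1) := by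
  classical
  -- `T` is `{(b,1), …, (b,t+1)}`. If `t = 0`, the value `f 0` corresponds to no index of `H`, but
  -- its coefficient `min(j,0)` vanishes.
  let T : Finset X.H := (Finset.range (t + 1)).image fun k => (b, k.succPNat)
  have h1 : gammaZ X ν (b, j) = ∑ s ∈ ν.support ∪ T,
      if s.1 = b then (min (j : ℕ) s.2 : ℕ) * ν s else 0 :=
    Finsupp.sum_of_support_subset _ Finset.subset_union_left _ (fun s _ => by simp)
  rw [h1, ← Finset.sum_subset (Finset.subset_union_right (s₁ := ν.support) (s₂ := T))]
  · rw [Finset.sum_image (fun k _ k' _ h => Nat.succPNat_injective (Prod.ext_iff.1 h).2)]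
    have h2 : ∀ k ∈ Finset.range (t + 1), (if b = b then
        ((min (j : ℕ) (k.succPNat : ℕ) : ℕ) : ℤ) * ν (b, k.succPNat) else 0)
        = (min (j : ℕ) (k + 1) : ℕ) * f (k + 1) := fun k _ => by
      rw [if_pos rfl, hf]; rfl
    rw [Finset.sum_congr rfl h2, Finset.sum_range_succ]
    congr 1
    cases t with
    | zero => simp
    | succ t =>
      rw [Finset.sum_range_succ, Finset.sum_eq_zero, zero_add]
      intro k hk
      have := Finset.mem_range.1 hk
      rw [ht _ (by omega) (by omega), mul_zero]
  · rintro ⟨c, k⟩ _ hk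
    dsimp only
    split_ifs with hc
    · subst hc
      rw [hf, ht, mul_zero]
      · rintro rfl
        have hk' := Nat.sub_add_cancel k.pos
        exact hk (Finset.mem_image.2 ⟨(k : ℕ) - 1, by simp,
          Prod.ext rfl (PNat.eq (by simpa using hk'))⟩)
      · intro hkt
        refine hk (Finset.mem_image.2 ⟨t, by simp, Prod.ext rfl (PNat.eq ?_)⟩)
        simp [hkt]
    · rfl

/-- The exponents `G_{am,bk}` as a finitely supported function of `(b,k)`. -/
def gFinsupp (p : X.H) : X.H →₀ ℤ := Finsupp.ofSupportFinite (gExp X p) (gExp_finite X p)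

/-- The odd-looking weights in `G` are interpolation weights. If `d_a = 1`, `d_b = d` and `m = dt +
s` with `0 ≤ s < d`, then `min(dj, m) = (d-s) min(j,t) + s min(j,t+1)`, because the only kink of
`min(dj, ·)` is at a multiple of `d`; the coefficients `d-s` and `s` are those of `G` at `k = t` and
`k = t+1`. In the remaining cases `G` is concentrated at a single `k`. -/
theorem gammaZ_gFinsupp (p s : X.H) : gammaZ X (gFinsupp X p) s = -bCoef X s p := by
  obtain ⟨a, m⟩ := p
  obtain ⟨b, j⟩ := s
  have hpos : ((X.eps b : ℤ) * X.dBig (X.incl a)) ≠ 0 := by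
    have := X.eps_pos b
    have := X.dBig_pos (X.incl a)
    positivity
  refine mul_right_cancel₀ hpos ?_
  rw [neg_mul, bCoef_mul X (b, j) (a, m), minD]
  dsimp only
  by_cases hr : 1 < X.r
  · rw [X.dBig_of_twisted hr.ne', X.dBig_of_twisted hr.ne',
      gammaZ_eq_of_support X _ b j (fun k => if (m : ℕ) = k then -(X.cartan b a / X.eps b) else 0) m
        (fun k => by
          change gExp X (a, m) (b, k) = _
          rw [gExp, if_pos hr])
        (fun k hk _ => if_neg hk.symm)]
    obtain ⟨c, hc⟩ := X.eps_dvd_cartan a b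
    have he : (X.eps b : ℤ) ≠ 0 := by exact_mod_cast (X.eps_pos b).ne'
    rw [hc, Int.mul_ediv_cancel_left _ he]
    simp
    ring
  · have hr' : X.r = 1 := by
      have : 0 < X.r := by cases X <;> simp [AffineType.r]
      omega
    rw [X.eps_of_untwisted hr', X.dBig_incl_of_untwisted hr', X.dBig_incl_of_untwisted hr',
      Nat.cast_one, one_mul]
    have hs := X.d_mul_cartan a b
    have hj := j.pos
    have hda := X.d_pos a
    have hdb := X.d_pos b
    by_cases h2 : X.d b = 2 * X.d a
    · have ha : X.d a = 1 := by rcases X.d_ratio a b with h | h | h <;> omega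
      rw [gammaZ_eq_of_support X _ b j (fun k => -X.cartan b a * (if (m : ℕ) = 2 * k then 2 else
        if (m : ℕ) + 1 = 2 * k ∨ (m : ℕ) = 2 * k + 1 then 1 else 0)) (m / 2)
        (fun k => by
          change gExp X (a, m) (b, k) = _
          rw [gExp, if_neg hr, if_pos h2])
        (fun k hk hk' => by rw [if_neg (by omega), if_neg (by omega), mul_zero]), h2, ha]
      obtain ⟨t, ht | ht⟩ := Nat.even_or_odd' m
      · rw [if_pos (by omega), if_neg (by omega), if_neg (by omega),
          show min (2 * 1 * (j : ℕ)) (1 * m) = 2 * min (j : ℕ) (m / 2) by omega]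
        push_cast
        ring
      · rw [if_neg (by omega), if_pos (by omega), if_neg (by omega), if_pos (by omega),
          show min (2 * 1 * (j : ℕ)) (1 * m) = min (j : ℕ) (m / 2) + min (j : ℕ) (m / 2 + 1) by
            omega]
        push_cast
        ring
    by_cases h3 : X.d b = 3 * X.d a
    · have ha : X.d a = 1 := by rcases X.d_ratio a b with h | h | h <;> omega
      rw [gammaZ_eq_of_support X _ b j (fun k => -X.cartan b a * (if (m : ℕ) = 3 * k then 3 else
        if (m : ℕ) + 1 = 3 * k ∨ (m : ℕ) = 3 * k + 1 then 2 else
        if (m : ℕ) + 2 = 3 * k ∨ (m : ℕ) = 3 * k + 2 then 1 else 0)) (m / 3)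
        (fun k => by
          change gExp X (a, m) (b, k) = _
          rw [gExp, if_neg hr, if_neg h2, if_pos h3])
        (fun k hk hk' => by
          rw [if_neg (by omega), if_neg (by omega), if_neg (by omega), mul_zero]), h3, ha]
      rcases (by omega : (m : ℕ) % 3 = 0 ∨ (m : ℕ) % 3 = 1 ∨ (m : ℕ) % 3 = 2) with ht | ht | ht
      · rw [if_pos (by omega), if_neg (by omega), if_neg (by omega), if_neg (by omega),
          show min (3 * 1 * (j : ℕ)) (1 * m) = 3 * min (j : ℕ) (m / 3) by omega]
        push_cast
        ring
      · rw [if_neg (by omega), if_pos (by omega), if_neg (by omega), if_neg (by omega),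
          if_pos (by omega), show min (3 * 1 * (j : ℕ)) (1 * m)
            = 2 * min (j : ℕ) (m / 3) + min (j : ℕ) (m / 3 + 1) by omega]
        push_cast
        ring
      · rw [if_neg (by omega), if_neg (by omega), if_pos (by omega), if_neg (by omega),
          if_pos (by omega), show min (3 * 1 * (j : ℕ)) (1 * m)
            = min (j : ℕ) (m / 3) + 2 * min (j : ℕ) (m / 3 + 1) by omega]
        push_cast
        ring
    · rw [gammaZ_eq_of_support X _ b j (fun k => if X.d a * m = X.d b * k then -X.cartan a b else 0)
        (X.d a * m / X.d b)
        (fun k => by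
          change gExp X (a, m) (b, k) = _
          rw [gExp, if_neg hr, if_neg h2, if_neg h3])
        (fun k hk hk' => if_neg fun h => hk (by rw [h, Nat.mul_div_cancel_left _ hdb]))]
      have hdvd : X.d b ∣ X.d a * m := by
        rcases X.d_ratio a b with h | ⟨h, h' | h'⟩ | ⟨h, h'⟩
        · rw [h]; exact dvd_mul_right _ _
        · omega
        · omega
        · rw [h]; exact one_dvd _
      obtain ⟨t, ht⟩ := hdvd
      rw [ht, Nat.mul_div_cancel_left _ hdb, if_pos rfl, if_neg, Nat.mul_min_mul_left]
      · push_cast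
        linear_combination (-(min (j : ℤ) t)) * hs
      · intro h
        have := Nat.eq_of_mul_eq_mul_left hdb h
        omega

/-- The second difference operator `D` at `(a,m)`: `∏ Q^D = (Q_m)² / (Q_{m-1} Q_{m+1})`. -/
def secondDiff (p : X.H) : X.H →₀ ℤ :=
  Finsupp.single p 2 - Finsupp.single (p.1, p.2 + 1) 1
    - if h : 1 < (p.2 : ℕ) then Finsupp.single (p.1, ⟨p.2 - 1, Nat.sub_pos_of_lt h⟩) 1 else 0

/-- For fixed `k`, the function `min(k, ·)` is linear except for a kink of size one at `k`, and
vanishes at `0`; the missing index `m = 0` therefore does no harm. -/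
theorem gammaZ_secondDiff (p s : X.H) :
    gammaZ X (secondDiff X p) s = if s = p then 1 else 0 := by
  obtain ⟨a, m⟩ := p
  obtain ⟨b, k⟩ := s
  have hk := k.pos
  have hm := m.pos
  simp only [secondDiff, sub_eq_add_neg, gammaZ_add, gammaZ_neg, gammaZ_single]
  by_cases hab : a = b
  · subst hab
    simp only [if_true, Prod.mk.injEq, true_and, ← PNat.coe_inj, PNat.add_coe, PNat.one_coe]
    split_ifs with h1 h2 h2
    · rw [gammaZ_single, if_pos rfl]
      simp only [PNat.mk_coe]
      omega
    · rw [gammaZ_single, if_pos rfl]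
      simp only [PNat.mk_coe]
      omega
    · rw [gammaZ_zero]; omega
    · rw [gammaZ_zero]; omega
  · rw [if_neg hab, if_neg hab, if_neg (fun h => hab (Prod.ext_iff.1 h).1.symm)]
    split_ifs
    · rw [gammaZ_single, if_neg hab]; rfl
    · rw [gammaZ_zero]; rfl

end QAffine
end

noncomputable section
namespace QAffine

/-! ## The numbers `R` for an arbitrary integral `γ` -/

theorem succ_mul_multichoose (P : ℤ) (k : ℕ) :
    ((k : ℤ) + 1) * Ring.multichoose P (k + 1) = P * Ring.multichoose (P + 1) k := by
  have h1 := Ring.factorial_nsmul_multichoose_eq_ascPochhammer P (k + 1)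
  have h2 := Ring.factorial_nsmul_multichoose_eq_ascPochhammer (P + 1) k
  rw [Polynomial.ascPochhammer_smeval_eq_eval, nsmul_eq_mul] at h1 h2
  rw [ascPochhammer_succ_left, Polynomial.eval_mul, Polynomial.eval_X, Polynomial.eval_comp,
    Polynomial.eval_add, Polynomial.eval_X, Polynomial.eval_one, ← h2, Nat.factorial_succ] at h1
  push_cast at h1
  have h3 : (k.factorial : ℤ) ≠ 0 := by exact_mod_cast k.factorial_ne_zero
  apply mul_left_cancel₀ h3
  linear_combination h1

/-- The coefficient of `x^(N-1)` in `(1-x)^(-P-1)`. -/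
def shiftedMultichoose (P : ℤ) : ℕ → ℤ
  | 0 => 0
  | k + 1 => Ring.multichoose (P + 1) k

/-- The derivative of `(1-x)^{-P}` is `P (1-x)^{-P-1}`. The identity removes the denominators `1/N`
from `R` and, unlike division, makes sense for `N = 0`. -/
theorem mul_multichoose (P : ℤ) (N : ℕ) :
    (N : ℤ) * Ring.multichoose P N = P * shiftedMultichoose P N := by
  cases N with
  | zero => simp [shiftedMultichoose]
  | succ k => exact_mod_cast succ_mul_multichoose P k

theorem shiftedMultichoose_add_one (P : ℤ) (k : ℕ) :
    shiftedMultichoose (P + 1) (k + 1)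
      = shiftedMultichoose P (k + 1) + shiftedMultichoose (P + 1) k := by
  cases k with
  | zero => simp [shiftedMultichoose]
  | succ k => exact Ring.multichoose_succ_succ _ _

variable (X : AffineType)

/-- The vacancy numbers for an arbitrary `γ`. -/
def vacancyZ (γ : X.H → ℤ) (N : X.H →₀ ℕ) (p : X.H) : ℤ :=
  γ p - N.sum fun s v => bCoef X p s * v

/-- A fraction-free form of the matrix whose determinant is `R(ν,N)`, on a finite index set `T`. -/
def rMatrix (T : Finset X.H) (γ : X.H → ℤ) (N : X.H →₀ ℕ) : Matrix T T ℤ :=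
  Matrix.of fun p s =>
    (if p = s then Ring.multichoose (vacancyZ X γ N s) (N s) else 0)
      + bCoef X s p * shiftedMultichoose (vacancyZ X γ N s) (N s)

/-- The number `R(ν,N)` for an arbitrary `γ`. -/
def rNumber (γ : X.H → ℤ) (N : X.H →₀ ℕ) : ℤ := (rMatrix X N.support γ N).det

/-- A column with `N = 0` is a unit vector, since `multichoose P 0 = 1` and the shifted value is
`0`; enlarging the index set leaves the determinant unchanged. This permits comparing patterns with
different supports. -/
theorem det_rMatrix (T : Finset X.H) (γ : X.H → ℤ) (N : X.H →₀ ℕ) (hT : N.support ⊆ T) :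
    (rMatrix X T γ N).det = rNumber X γ N := by
  classical
  have hcol : ∀ i j : T, N j = 0 → rMatrix X T γ N i j = if i = j then 1 else 0 := by
    intro i j hj
    simp [rMatrix, hj, shiftedMultichoose]
  rw [Matrix.twoBlockTriangular_det _ (fun i : T => N i = 0)]
  · have h1 : (rMatrix X T γ N).toSquareBlockProp (fun i : T => N i = 0) = 1 := by
      ext i j
      rw [Matrix.toSquareBlockProp_def, Matrix.of_apply, hcol _ _ j.2, Matrix.one_apply]
      simp only [Subtype.ext_iff]
    rw [h1, Matrix.det_one, one_mul, rNumber]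
    let e : {i : T // ¬N i = 0} ≃ N.support :=
      { toFun := fun i => ⟨i.1, Finsupp.mem_support_iff.2 i.2⟩
        invFun := fun i => ⟨⟨i.1, hT i.2⟩, Finsupp.mem_support_iff.1 i.2⟩
        left_inv := fun _ => rfl
        right_inv := fun _ => rfl }
    rw [← Matrix.det_submatrix_equiv_self e]
    congr 1
    ext i j
    have hij : ((e i : X.H) = e j) ↔ ((i : T) : X.H) = (j : T) := Iff.rfl
    simp only [Matrix.submatrix_apply, rMatrix, Matrix.of_apply, Matrix.toSquareBlockProp_def]
    congr 1
    exact if_congr (by simp only [Subtype.ext_iff]; exact hij) rfl rfl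
  · intro i hi j hj
    rw [hcol i j hj, if_neg]
    rintro rfl
    exact hi hj

theorem rNumber_zero_right (γ : X.H → ℤ) : rNumber X γ 0 = 1 := by
  rw [← det_rMatrix X ∅ γ 0 (by simp)]
  exact Matrix.det_isEmpty

theorem rNumber_congr {γ γ' : X.H → ℤ} {N : X.H →₀ ℕ} (h : ∀ p ∈ N.support, γ p = γ' p) :
    rNumber X γ N = rNumber X γ' N := by
  have : rMatrix X N.support γ N = rMatrix X N.support γ' N := by
    ext p s
    simp only [rMatrix, Matrix.of_apply, vacancyZ, h s s.2]
  rw [rNumber, rNumber, this]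

/-- The row vector `N` is in the left kernel: column `s` pairs with it to `N_s · multichoose(P_s,
N_s) + (∑_p N_p B_{sp}) · shifted`, where the sum is `-P_s` as `γ = 0`, and `mul_multichoose`
cancels the two terms. -/
theorem rNumber_zero_left {N : X.H →₀ ℕ} (hN : N ≠ 0) : rNumber X 0 N = 0 := by
  classical
  rw [rNumber, ← Matrix.exists_vecMul_eq_zero_iff]
  refine ⟨fun p => (N p : ℤ), fun h => ?_, ?_⟩
  · obtain ⟨p, hp⟩ := Finsupp.support_nonempty_iff.2 hN
    have := congrFun h ⟨p, hp⟩
    simp only [Pi.zero_apply, Nat.cast_eq_zero] at this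
    exact Finsupp.mem_support_iff.1 hp this
  · ext s
    have h1 : vacancyZ X 0 N s = -∑ p : N.support, (N p : ℤ) * bCoef X s p := by
      rw [vacancyZ, Pi.zero_apply, zero_sub, Finsupp.sum, ← Finset.sum_coe_sort]
      congr 1
      exact Finset.sum_congr rfl fun p _ => mul_comm _ _
    have h2 := mul_multichoose (vacancyZ X 0 N s) (N s)
    simp only [Matrix.vecMul, dotProduct, rMatrix, Matrix.of_apply, mul_add, mul_ite, mul_zero,
      Finset.sum_add_distrib, Finset.sum_ite_eq', Finset.mem_univ, if_true, ← mul_assoc,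
      ← Finset.sum_mul, h2, Pi.zero_apply]
    rw [← add_mul, h1]
    simp

theorem vacancyZ_add (γ γ' : X.H → ℤ) (N : X.H →₀ ℕ) (p : X.H) :
    vacancyZ X (γ + γ') N p = vacancyZ X γ N p + γ' p := by
  simp only [vacancyZ, Pi.add_apply]
  ring

/-- Adding one string at `p` has the effect on vacancy numbers of subtracting the column of `B` at
`p` from `γ`. -/
theorem vacancyZ_sub_bCoef (γ : X.H → ℤ) (N : X.H →₀ ℕ) (p s : X.H) :
    vacancyZ X (γ - fun s => bCoef X s p) N s = vacancyZ X γ (N + Finsupp.single p 1) s := by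
  have : (N + Finsupp.single p 1).sum (fun i v => bCoef X s i * v)
      = N.sum (fun i v => bCoef X s i * v) + bCoef X s p := by
    rw [Finsupp.sum_add_index' (by simp) (by intros; push_cast; ring),
      Finsupp.sum_single_index (by simp)]
    simp
  simp only [vacancyZ, Pi.sub_apply, this]
  ring

theorem rNumber_add_single_of_eq_zero (γ : X.H → ℤ) {N : X.H →₀ ℕ} {p : X.H} (hp : N p = 0) :
    rNumber X (γ + Pi.single p 1) N = rNumber X γ N := by
  refine rNumber_congr X fun s hs => ?_
  have : s ≠ p := by
    rintro rfl
    exact Finsupp.mem_support_iff.1 hs hp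
  simp [this]

/-- The recursion that characterizes the numbers `R`. -/
theorem rNumber_add_single (γ : X.H → ℤ) (N : X.H →₀ ℕ) (p : X.H) :
    rNumber X (γ + Pi.single p 1) (N + Finsupp.single p 1)
      = rNumber X γ (N + Finsupp.single p 1)
        + rNumber X (γ + Pi.single p 1 - fun s => bCoef X s p) N := by
  classical
  set N' := N + Finsupp.single p 1
  have hp : p ∈ N'.support := by simp [N']
  have hsub : N.support ⊆ N'.support := by
    intro s hs
    simp only [N', Finsupp.mem_support_iff, Finsupp.add_apply] at hs ⊢
    omega
  rw [← det_rMatrix X N'.support _ N hsub, rNumber, rNumber]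
  let p' : N'.support := ⟨p, hp⟩
  set M := rMatrix X N'.support (γ + Pi.single p 1) N'
  set M1 := rMatrix X N'.support γ N'
  set M2 := rMatrix X N'.support (γ + Pi.single p 1 - fun s => bCoef X s p) N
  have hP : ∀ s, vacancyZ X (γ + Pi.single p 1) N' s
      = vacancyZ X γ N' s + if s = p then 1 else 0 := by
    intro s
    rw [vacancyZ_add, Pi.single_apply]
  have hN' : N' p = N p + 1 := by simp [N']
  -- Column `s` depends only on the vacancy number and the multiplicity at `s`, so the three
  -- matrices agree off column `p`. In column `p`, Pascal's rule splits the entries of `M` as the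
  -- sum of those of `M1` and `M2`, and the determinant is additive in that column.
  have hM1 : M1 = M.updateCol p' fun i => M1 i p' := by
    ext i s
    by_cases hs : s = p'
    · subst hs; rw [Matrix.updateCol_self]
    · rw [Matrix.updateCol_ne hs]
      have hs' : (s : X.H) ≠ p := fun h => hs (Subtype.ext h)
      simp only [M, M1, rMatrix, Matrix.of_apply, hP, if_neg hs', add_zero]
  have hM2 : M2 = M.updateCol p' fun i => M2 i p' := by
    ext i s
    by_cases hs : s = p'
    · subst hs; rw [Matrix.updateCol_self]
    · rw [Matrix.updateCol_ne hs]
      have hs' : (s : X.H) ≠ p := fun h => hs (Subtype.ext h)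
      have : N' s = N s := by simp [N', hs']
      simp only [M, M2, rMatrix, Matrix.of_apply, vacancyZ_sub_bCoef, this, N']
  have hM : M = M.updateCol p' ((fun i => M1 i p') + fun i => M2 i p') := by
    ext i s
    by_cases hs : s = p'
    · subst hs
      rw [Matrix.updateCol_self]
      have e1 := Ring.multichoose_succ_succ (vacancyZ X γ N' p) (N p)
      have e2 := shiftedMultichoose_add_one (vacancyZ X γ N' p) (N p)
      have hp' : ((p' : N'.support) : X.H) = p := rfl
      simp only [M, M1, M2, rMatrix, Matrix.of_apply, vacancyZ_sub_bCoef, hP, Pi.add_apply, N',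
        hp', if_true] at e1 e2 ⊢
      have hN'' : (N + Finsupp.single p 1 : X.H →₀ ℕ) p = N p + 1 := hN'
      rw [hN'', e1, e2]
      split_ifs <;> ring
    · rw [Matrix.updateCol_ne hs]
  rw [hM, Matrix.det_updateCol_add, ← hM1, ← hM2]

theorem R_eq_rNumber (ν N : X.H →₀ ℕ) : R X ν N = rNumber X (gamma X ν) N := by
  classical
  have hN : ∀ s : N.support, (N s : ℚ) ≠ 0 := fun s => by
    exact_mod_cast Finsupp.mem_support_iff.1 s.2
  let c : N.support → ℚ := fun s =>
    (1 / (N s : ℚ)) * ((Ring.choose (vacancy X ν N s + N s - 1) (N s - 1) : ℤ) : ℚ)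
  -- The factor of `R` at `s` is absorbed into column `s` of `F`; on the diagonal `mul_multichoose`
  -- clears the denominator.
  have h : (rMatrix X N.support (gamma X ν) N).map (Int.castRingHom ℚ)
      = (fMatrix X ν N).map (Int.castRingHom ℚ) * Matrix.diagonal c := by
    ext p s
    rw [Matrix.mul_diagonal, Matrix.map_apply, Matrix.map_apply]
    have hs := hN s
    obtain ⟨k, hk⟩ := Nat.exists_eq_succ_of_ne_zero (Finsupp.mem_support_iff.1 s.2)
    have hv : vacancyZ X (gamma X ν) N s = vacancy X ν N s := rfl
    have hch : Ring.choose (vacancy X ν N s + N s - 1) (N s - 1)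
        = shiftedMultichoose (vacancy X ν N s) (N s) := by
      rw [hk, shiftedMultichoose, Ring.multichoose_eq]
      congr 1
      push_cast
      ring
    have e : (N s : ℚ) * (Ring.multichoose (vacancy X ν N s) (N s) : ℤ)
        = vacancy X ν N s * (shiftedMultichoose (vacancy X ν N s) (N s) : ℤ) := by
      exact_mod_cast mul_multichoose (vacancy X ν N s) (N s)
    simp only [rMatrix, fMatrix, Matrix.of_apply, c, hch, hv, eq_intCast]
    push_cast
    by_cases hps : p = s
    · subst hps
      simp only [if_true]
      field_simp
      linear_combination e
    · simp only [if_neg hps]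
      field_simp
      ring
  have h2 := congrArg Matrix.det h
  rw [Matrix.det_mul, Matrix.det_diagonal, ← RingHom.mapMatrix_apply,
    ← RingHom.mapMatrix_apply, ← RingHom.map_det, ← RingHom.map_det] at h2
  rw [R, rNumber, ← Finset.prod_coe_sort]
  exact h2.symm

end QAffine
end

noncomputable section
namespace QAffine

/-! ## The power series with coefficients `R` -/

variable (X : AffineType)

/-- `∑_N R(ν,N)` over the patterns `N` of weight `μ`, for an arbitrary `γ`. -/
def rSum (γ : X.H → ℤ) (μ : Fin X.rank →₀ ℕ) : ℤ :=
  ∑ N ∈ (patterns_finite X μ).toFinset, rNumber X γ N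

theorem mem_patterns {μ : Fin X.rank →₀ ℕ} {N : X.H →₀ ℕ} :
    N ∈ patterns X μ ↔ (N.sum fun p v => Finsupp.single p.1 ((p.2 : ℕ) * v)) = μ := Iff.rfl

theorem mul_le_of_mem_patterns {μ : Fin X.rank →₀ ℕ} {N : X.H →₀ ℕ} (hN : N ∈ patterns X μ)
    (p : X.H) : (p.2 : ℕ) * N p ≤ μ p.1 := by
  by_cases hp : p ∈ N.support
  · rw [← (mem_patterns X).1 hN, Finsupp.sum, Finsupp.finsetSum_apply]
    refine le_trans ?_ (Finset.single_le_sum (fun _ _ => Nat.zero_le _) hp)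
    simp
  · simp [Finsupp.notMem_support_iff.mp hp]

theorem le_of_mem_patterns {μ : Fin X.rank →₀ ℕ} {N : X.H →₀ ℕ} (hN : N ∈ patterns X μ)
    {p : X.H} (hp : N p ≠ 0) : (p.2 : ℕ) ≤ μ p.1 :=
  (Nat.le_mul_of_pos_right _ (Nat.pos_of_ne_zero hp)).trans (mul_le_of_mem_patterns X hN p)

theorem add_single_mem_patterns {μ : Fin X.rank →₀ ℕ} {N : X.H →₀ ℕ} (p : X.H) :
    N + Finsupp.single p 1 ∈ patterns X (μ + Finsupp.single p.1 (p.2 : ℕ)) ↔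
      N ∈ patterns X μ := by
  rw [mem_patterns, mem_patterns, Finsupp.sum_add_index' (by simp)
    (by intros; rw [mul_add, Finsupp.single_add]), Finsupp.sum_single_index (by simp), mul_one,
    add_left_inj]

theorem zero_mem_patterns {μ : Fin X.rank →₀ ℕ} : 0 ∈ patterns X μ ↔ μ = 0 := by
  rw [mem_patterns, Finsupp.sum_zero_index, eq_comm]

/-- In degree `μ` only strings of length at most `μ_a` occur, so changes of `γ` at longer lengths
are invisible; this is the analogue for `R` of adic convergence. -/
theorem rSum_congr {γ γ' : X.H → ℤ} {μ : Fin X.rank →₀ ℕ}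
    (h : ∀ p : X.H, (p.2 : ℕ) ≤ μ p.1 → γ p = γ' p) : rSum X γ μ = rSum X γ' μ := by
  refine Finset.sum_congr rfl fun N hN => rNumber_congr X fun p hp => h p ?_
  exact le_of_mem_patterns X ((Set.Finite.mem_toFinset _).1 hN) (Finsupp.mem_support_iff.1 hp)

theorem rSum_zero (μ : Fin X.rank →₀ ℕ) : rSum X 0 μ = if μ = 0 then 1 else 0 := by
  classical
  have h : ∀ N ∈ (patterns_finite X μ).toFinset, rNumber X 0 N = if N = 0 then 1 else 0 := by
    intro N _
    split_ifs with hN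
    · rw [hN, rNumber_zero_right]
    · exact rNumber_zero_left X hN
  rw [rSum, Finset.sum_congr rfl h, Finset.sum_ite_eq']
  exact if_congr ((Set.Finite.mem_toFinset _).trans (zero_mem_patterns X)) rfl rfl

theorem rSum_add_single (γ : X.H → ℤ) (p : X.H) (μ : Fin X.rank →₀ ℕ) :
    rSum X (γ + Pi.single p 1) μ = rSum X γ μ +
      if Finsupp.single p.1 (p.2 : ℕ) ≤ μ then
        rSum X (γ + Pi.single p 1 - fun s => bCoef X s p) (μ - Finsupp.single p.1 (p.2 : ℕ))
      else 0 := by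
  classical
  have h : ∀ N : X.H →₀ ℕ, rNumber X (γ + Pi.single p 1) N = rNumber X γ N + if N p ≠ 0 then
      rNumber X (γ + Pi.single p 1 - fun s => bCoef X s p) (N - Finsupp.single p 1) else 0 := by
    intro N
    split_ifs with hp
    · have hle : Finsupp.single p 1 ≤ N := Finsupp.single_le_iff.2 (Nat.one_le_iff_ne_zero.2 hp)
      have := rNumber_add_single X γ (N - Finsupp.single p 1) p
      rwa [tsub_add_cancel_of_le hle] at this
    · rw [not_not] at hp
      rw [rNumber_add_single_of_eq_zero X γ hp, add_zero]
  rw [rSum, rSum, Finset.sum_congr rfl fun N _ => h N, Finset.sum_add_distrib, add_right_inj,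
    ← Finset.sum_filter]
  split_ifs with hle
  · refine Finset.sum_nbij' (fun N => N - Finsupp.single p 1) (fun N => N + Finsupp.single p 1)
      ?_ ?_ ?_ ?_ ?_
    · intro N hN
      rw [Finset.mem_filter, Set.Finite.mem_toFinset] at hN
      rw [Set.Finite.mem_toFinset, ← add_single_mem_patterns X p, tsub_add_cancel_of_le hle,
        tsub_add_cancel_of_le (Finsupp.single_le_iff.2 (Nat.one_le_iff_ne_zero.2 hN.2))]
      exact hN.1
    · intro N hN
      rw [Set.Finite.mem_toFinset, ← add_single_mem_patterns X p, tsub_add_cancel_of_le hle] at hN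
      rw [Finset.mem_filter, Set.Finite.mem_toFinset]
      exact ⟨hN, by simp⟩
    · intro N hN
      rw [Finset.mem_filter] at hN
      exact tsub_add_cancel_of_le (Finsupp.single_le_iff.2 (Nat.one_le_iff_ne_zero.2 hN.2))
    · intro N _
      exact add_tsub_cancel_right _ _
    · intro N _
      rfl
  · refine Finset.sum_eq_zero fun N hN => absurd ?_ hle
    rw [Finset.mem_filter, Set.Finite.mem_toFinset] at hN
    exact Finsupp.single_le_iff.2 (le_of_mem_patterns X hN.1 hN.2)

/-! ## Canonical solutions of the `Q`-system -/

theorem MvPowerSeries_coeff_mul_congr {σ : Type*} {A f g : MvPowerSeries σ ℂ} {μ : σ →₀ ℕ}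
    (h : ∀ μ' ≤ μ, MvPowerSeries.coeff μ' f = MvPowerSeries.coeff μ' g) :
    MvPowerSeries.coeff μ (A * f) = MvPowerSeries.coeff μ (A * g) := by
  classical
  rw [MvPowerSeries.coeff_mul, MvPowerSeries.coeff_mul]
  refine Finset.sum_congr rfl fun x hx => ?_
  rw [h x.2 (Finset.HasAntidiagonal.mem_antidiagonal.1 hx ▸ le_add_self)]

/-- `∏ Q^ν` for integral exponents `ν`. -/
def monomialZ (u : X.H → (MvPowerSeries (Fin X.rank) ℂ)ˣ) (ν : X.H →₀ ℤ) :
    (MvPowerSeries (Fin X.rank) ℂ)ˣ := ν.prod fun p e => u p ^ e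

theorem monomialZ_add (u : X.H → (MvPowerSeries (Fin X.rank) ℂ)ˣ) (ν ν' : X.H →₀ ℤ) :
    monomialZ X u (ν + ν') = monomialZ X u ν * monomialZ X u ν' :=
  Finsupp.prod_add_index' (fun _ => zpow_zero _) fun _ _ _ => zpow_add _ _ _

theorem monomialZ_zero (u : X.H → (MvPowerSeries (Fin X.rank) ℂ)ˣ) : monomialZ X u 0 = 1 :=
  Finsupp.prod_zero_index

theorem monomialZ_single (u : X.H → (MvPowerSeries (Fin X.rank) ℂ)ˣ) (p : X.H) (e : ℤ) :
    monomialZ X u (Finsupp.single p e) = u p ^ e :=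
  Finsupp.prod_single_index (zpow_zero _)

theorem psZPow_val {σ : Type*} (u : (MvPowerSeries σ ℂ)ˣ) (e : ℤ) :
    psZPow (u : MvPowerSeries σ ℂ) e = ((u ^ e : (MvPowerSeries σ ℂ)ˣ) : MvPowerSeries σ ℂ) := by
  have hinv : (u : MvPowerSeries σ ℂ)⁻¹ = ((u⁻¹ : (MvPowerSeries σ ℂ)ˣ) : MvPowerSeries σ ℂ) := by
    have h0 : MvPowerSeries.constantCoeff (u : MvPowerSeries σ ℂ) ≠ 0 :=
      (u.isUnit.map MvPowerSeries.constantCoeff).ne_zero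
    rw [MvPowerSeries.inv_eq_iff_mul_eq_one h0, Units.inv_mul]
  cases e with
  | ofNat n => simp [psZPow]
  | negSucc n => simp [psZPow, hinv, zpow_negSucc]

/-- The unit vector at `(a,m)`, or `0` if `m = 0`. -/
def singleOrZero (a : Fin X.rank) (m : ℕ) : X.H →₀ ℤ :=
  if h : 0 < m then Finsupp.single (a, ⟨m, h⟩) 1 else 0

theorem monomialZ_singleOrZero {Q : X.H → MvPowerSeries (Fin X.rank) ℂ}
    (u : X.H → (MvPowerSeries (Fin X.rank) ℂ)ˣ) (hu : ∀ p, (u p : MvPowerSeries (Fin X.rank) ℂ) = Q p)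
    (a : Fin X.rank) (m : ℕ) :
    (monomialZ X u (singleOrZero X a m) : MvPowerSeries (Fin X.rank) ℂ) = extend Q a m := by
  unfold singleOrZero extend
  split_ifs
  · rw [monomialZ_single, zpow_one, hu]
  · rw [monomialZ_zero, Units.val_one]

theorem secondDiff_eq (a : Fin X.rank) (m : ℕ) (hm : 0 < m) :
    secondDiff X (a, ⟨m, hm⟩) = singleOrZero X a m + singleOrZero X a m
      - singleOrZero X a (m + 1) - singleOrZero X a (m - 1) := by
  unfold secondDiff singleOrZero
  rw [dif_pos hm, dif_pos (Nat.succ_pos m), ← Finsupp.single_add]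
  congr 1
  by_cases h : 1 < m
  · rw [dif_pos (by exact h), dif_pos (by omega)]
    rfl
  · rw [dif_neg (by exact h), dif_neg (by omega)]

/-- The `Q`-system as a recursion for the monomials `∏ Q^ν`. -/
theorem monomialZ_add_secondDiff {Q : X.H → MvPowerSeries (Fin X.rank) ℂ}
    (hQ : IsQSystemSolution X Q)
    (u : X.H → (MvPowerSeries (Fin X.rank) ℂ)ˣ) (hu : ∀ p, (u p : MvPowerSeries (Fin X.rank) ℂ) = Q p)
    (ν : X.H →₀ ℤ) (p : X.H) :
    (monomialZ X u (ν + secondDiff X p)).val = (monomialZ X u ν).val +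
      MvPowerSeries.X p.1 ^ (p.2 : ℕ) *
        (monomialZ X u (ν + secondDiff X p + gFinsupp X p)).val := by
  have hprod : ∏ᶠ s : X.H, psZPow (Q s) (gExp X p s)
      = (monomialZ X u (gFinsupp X p) : MvPowerSeries (Fin X.rank) ℂ) := by
    have h1 : ∀ s, psZPow (Q s) (gExp X p s)
        = ((u s ^ gFinsupp X p s : (MvPowerSeries (Fin X.rank) ℂ)ˣ) : MvPowerSeries (Fin X.rank) ℂ) := by
      intro s
      rw [← hu, psZPow_val]
      rfl
    rw [finprod_congr h1, finprod_eq_prod_of_mulSupport_subset (s := (gFinsupp X p).support),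
      monomialZ, Finsupp.prod, Units.coe_prod]
    intro s hs
    rw [Finset.mem_coe, Finsupp.mem_support_iff]
    intro h0
    exact hs (by simp [h0])
  have h := hQ.2 p
  obtain ⟨a, m, hm⟩ := p
  rw [hprod, ← monomialZ_singleOrZero X u hu, ← monomialZ_singleOrZero X u hu, ← hu] at h
  set G := gFinsupp X (a, ⟨m, hm⟩)
  have hself : u (a, ⟨m, hm⟩) = monomialZ X u (singleOrZero X a m) := by
    rw [singleOrZero, dif_pos hm, monomialZ_single, zpow_one]
  rw [hself] at h
  dsimp only [PNat.mk_coe] at h ⊢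
  -- The `Q`-system is multiplied by `∏ Q^ν / (Q_{m+1} Q_{m-1})`, which is legitimate since all
  -- `Q`'s are units.
  have h' := congrArg (fun f => (monomialZ X u (ν - singleOrZero X a (m + 1)
    - singleOrZero X a (m - 1)) : MvPowerSeries (Fin X.rank) ℂ) * f) h
  have e1 : ν + secondDiff X (a, ⟨m, hm⟩) = ν - singleOrZero X a (m + 1) - singleOrZero X a (m - 1)
      + (singleOrZero X a m + singleOrZero X a m) := by
    rw [secondDiff_eq]; abel
  have e2 : ν = ν - singleOrZero X a (m + 1) - singleOrZero X a (m - 1)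
      + (singleOrZero X a (m + 1) + singleOrZero X a (m - 1)) := by abel
  rw [e1]
  conv_rhs => enter [1]; rw [e2]
  simp only [monomialZ_add, Units.val_mul] at h' ⊢
  linear_combination h'

/-- Both sides satisfy the same recursion, which relates `γ + δ_p` to `γ` up to a term of strictly
smaller degree. Such a recursion only controls second differences in `m`; the canonicity of the
solution supplies the boundary condition at infinity. -/
theorem coeff_monomialZ {Q : X.H → MvPowerSeries (Fin X.rank) ℂ} (hQ : IsCanonicalSolution X Q)
    (u : X.H → (MvPowerSeries (Fin X.rank) ℂ)ˣ) (hu : ∀ p, (u p : MvPowerSeries (Fin X.rank) ℂ) = Q p)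
    (μ : Fin X.rank →₀ ℕ) (ν : X.H →₀ ℤ) :
    MvPowerSeries.coeff μ (monomialZ X u ν : MvPowerSeries (Fin X.rank) ℂ) = (rSum X (gammaZ X ν) μ : ℂ) := by
  classical
  induction μ using WellFoundedLT.induction generalizing ν with
  | ind μ ih =>
  -- `c` is the defect in degree `μ`. It is shown to be constant in `ν`, hence equal to its value at
  -- `ν = 0`.
  set c : (X.H →₀ ℤ) → ℂ := fun ν =>
    MvPowerSeries.coeff μ (monomialZ X u ν : MvPowerSeries (Fin X.rank) ℂ) - (rSum X (gammaZ X ν) μ : ℂ) with hc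
  have hD : ∀ ν p, c (ν + secondDiff X p) = c ν := by
    intro ν p
    have hg1 : gammaZ X (ν + secondDiff X p) = gammaZ X ν + Pi.single p 1 := by
      ext s
      rw [gammaZ_add, gammaZ_secondDiff, Pi.add_apply, Pi.single_apply]
    have hg2 : gammaZ X (ν + secondDiff X p + gFinsupp X p)
        = gammaZ X ν + Pi.single p 1 - fun s => bCoef X s p := by
      ext s
      rw [gammaZ_add, gammaZ_gFinsupp, hg1, Pi.sub_apply, sub_eq_add_neg]
    simp only [hc]
    rw [monomialZ_add_secondDiff X hQ.1 u hu, hg1, rSum_add_single, map_add,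
      MvPowerSeries.X_pow_eq, MvPowerSeries.coeff_monomial_mul]
    split_ifs with hle
    · rw [one_mul, ih (μ - Finsupp.single p.1 (p.2 : ℕ)) ?_, hg2]
      · push_cast
        ring
      · refine lt_of_le_of_ne tsub_le_self fun h => ?_
        have h1 := DFunLike.congr_fun h p.1
        have h2 := Finsupp.single_le_iff.1 hle
        have h3 := p.2.pos
        simp only [Finsupp.tsub_apply, Finsupp.single_eq_same] at h1
        omega
    · push_cast
      ring
  -- Invariance under second differences gives the ratio `Q_{m+1}/Q_m` the same effect on `c` for
  -- all `m`, including `m = 0`, where the ratio is `Q_1`.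
  have htel : ∀ ν a m, c (ν + singleOrZero X a (m + 1) - singleOrZero X a m)
      = c (ν + singleOrZero X a 1) := by
    intro ν a m
    induction m with
    | zero => simp [singleOrZero]
    | succ m ihm =>
      rw [← ihm, ← hD _ (a, ⟨m + 1, Nat.succ_pos m⟩), secondDiff_eq, Nat.add_sub_cancel]
      congr 1
      abel
  have hlim : ∀ ν a, c (ν + singleOrZero X a 1) = c ν := by
    intro ν a
    obtain ⟨L, hL⟩ := hQ.2 a
    have h1 : ∀ᶠ m : ℕ in Filter.atTop, ∀ μ' ∈ Set.Iic μ,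
        MvPowerSeries.coeff μ' (extend Q a m) = MvPowerSeries.coeff μ' L :=
      (Filter.eventually_all_finite (Set.finite_Iic μ)).2 fun μ' _ => hL μ'
    obtain ⟨M, hM⟩ := Filter.eventually_atTop.1 h1
    -- Beyond `M` the coefficients of `Q_m` of degree at most `μ` are stationary; beyond `μ a` the
    -- truncation `min(k,m) = k` holds for every string length `k` seen in degree `μ`. So
    -- multiplying by `Q_{m+1}/Q_m` changes neither term of `c`.
    set m := max M (μ a)
    rw [← htel ν a m]
    simp only [hc]
    congr 1
    · have e1 : ν + singleOrZero X a (m + 1) - singleOrZero X a m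
          = (ν - singleOrZero X a m) + singleOrZero X a (m + 1) := by abel
      have e2 : ν = (ν - singleOrZero X a m) + singleOrZero X a m := by abel
      conv_rhs => rw [e2]
      rw [e1, monomialZ_add, monomialZ_add, Units.val_mul, Units.val_mul,
        monomialZ_singleOrZero X u hu, monomialZ_singleOrZero X u hu]
      refine MvPowerSeries_coeff_mul_congr fun μ' hμ' => ?_
      rw [hM (m + 1) ((le_max_left _ _).trans (Nat.le_succ _)) μ' hμ',
        hM m (le_max_left _ _) μ' hμ']
    · congr 1
      refine rSum_congr X fun p hp => ?_
      have hsing : ∀ k, (p.2 : ℕ) ≤ μ p.1 → gammaZ X (singleOrZero X a k) p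
          = if a = p.1 then ((min (p.2 : ℕ) k : ℕ) : ℤ) else 0 := by
        intro k _
        unfold singleOrZero
        split_ifs with h2 h3 h3
        · rw [gammaZ_single, if_pos h3, mul_one]; rfl
        · rw [gammaZ_single, if_neg h3]
        · rw [gammaZ_zero]
          have : k = 0 := by omega
          subst this
          simp
        · exact gammaZ_zero X p
      rw [sub_eq_add_neg, gammaZ_add, gammaZ_add, gammaZ_neg, hsing _ hp, hsing _ hp]
      split_ifs with h2
      · have h3 : (p.2 : ℕ) ≤ m := (h2 ▸ hp).trans (le_max_right _ _)
        rw [min_eq_left h3, min_eq_left (h3.trans (Nat.le_succ _))]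
        ring
      · ring
  have hsing : ∀ ν a m, c (ν + singleOrZero X a m) = c ν := by
    intro ν a m
    induction m with
    | zero => simp [singleOrZero]
    | succ m ihm =>
      rw [← ihm, ← hlim (ν + singleOrZero X a m), ← htel _ a m]
      congr 1
      abel
  have hone : ∀ ν p, c (ν + Finsupp.single p 1) = c ν := by
    rintro ν ⟨a, m, hm⟩
    have := hsing ν a m
    rwa [singleOrZero, dif_pos hm] at this
  have hall : ∀ ν, c ν = c 0 := by
    intro ν
    induction ν using Finsupp.induction with
    | zero => rfl
    | single_add p e f _ he ihf =>
      rw [← ihf, add_comm]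
      clear ihf he
      induction e using Int.induction_on with
      | zero => simp
      | succ e ihe => rw [Finsupp.single_add, ← add_assoc, hone, ihe]
      | pred e ihe => rw [← hone, add_assoc, ← Finsupp.single_add, sub_add_cancel, ihe]
  have h0 : c 0 = 0 := by
    have hg : gammaZ X 0 = 0 := funext fun p => gammaZ_zero X p
    simp only [hc, monomialZ_zero, Units.val_one, MvPowerSeries.coeff_one, hg, rSum_zero]
    split_ifs <;> simp
  exact sub_eq_zero.1 ((hall ν).trans h0)

/-- Monomials in a canonical solution of the `Q`-system are the series `R^ν`. -/
theorem prod_eq_RSeries {Q : X.H → MvPowerSeries (Fin X.rank) ℂ} (hQ : IsCanonicalSolution X Q)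
    (ν : X.H →₀ ℕ) : (ν.prod fun p e => Q p ^ e) = RSeries X ν := by
  have hunit : ∀ p, IsUnit (Q p) := fun p => by
    rw [MvPowerSeries.isUnit_iff_constantCoeff, hQ.1.1 p]
    exact isUnit_one
  choose u hu using hunit
  ext μ
  have h1 : (ν.prod fun p e => Q p ^ e)
      = (monomialZ X u (ν.mapRange (fun n : ℕ => (n : ℤ)) Nat.cast_zero) : MvPowerSeries (Fin X.rank) ℂ) := by
    rw [monomialZ, Finsupp.prod_mapRange_index (fun _ => zpow_zero _), Finsupp.prod, Finsupp.prod,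
      Units.coe_prod]
    refine Finset.prod_congr rfl fun p _ => ?_
    rw [zpow_natCast, Units.val_pow_eq_pow_val, hu]
  rw [h1, coeff_monomialZ X hQ u hu, ← gamma_eq_gammaZ]
  have h2 : MvPowerSeries.coeff μ (RSeries X ν)
      = ((∑ᶠ N ∈ patterns X μ, R X ν N : ℚ) : ℂ) := rfl
  rw [h2, finsum_mem_eq_finite_toFinset_sum _ (patterns_finite X μ), rSum]
  push_cast
  refine Finset.sum_congr rfl fun N _ => ?_
  rw [R_eq_rNumber, Rat.cast_intCast]

end QAffine
end

noncomputable section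
namespace QAffine

/-! ## Monomial systems of equations over `ℂˣ` -/

section Monomial

variable {ι : Type*} [Fintype ι] [DecidableEq ι]

theorem exists_units_pow_eq (w : ℂˣ) {n : ℕ} (hn : n ≠ 0) : ∃ t : ℂˣ, t ^ n = w := by
  obtain ⟨t, ht⟩ := IsAlgClosed.exists_pow_nat_eq (w : ℂ) (Nat.pos_of_ne_zero hn)
  have ht0 : t ≠ 0 := by
    rintro rfl
    rw [zero_pow hn] at ht
    exact w.ne_zero ht.symm
  exact ⟨Units.mk0 t ht0, Units.ext ht⟩

theorem exists_units_zpow_eq (w : ℂˣ) {n : ℤ} (hn : n ≠ 0) : ∃ t : ℂˣ, t ^ n = w := by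
  obtain ⟨t, ht⟩ := exists_units_pow_eq w (Int.natAbs_ne_zero.2 hn)
  rcases Int.natAbs_eq n with h | h
  · exact ⟨t, by rw [h, zpow_natCast, ht]⟩
  · exact ⟨t⁻¹, by rw [h, zpow_neg, inv_zpow, inv_inv, zpow_natCast, ht]⟩

/-- A monomial system with nonsingular exponent matrix has a solution. -/
theorem exists_monomial_solution (A : Matrix ι ι ℤ) (hA : A.det ≠ 0) (c : ι → ℂˣ) :
    ∃ z : ι → ℂˣ, ∀ i, ∏ j, z j ^ A i j = c i := by
  -- With `t_i` a `det A`-th root of `c_i`, the adjugate gives the solution `z_j = ∏_k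
  -- t_k^{adj(A)_{jk}}`, because `A · adj(A) = det A`.
  choose t ht using fun i => exists_units_zpow_eq (c i) hA
  refine ⟨fun j => ∏ k, t k ^ A.adjugate j k, fun i => ?_⟩
  have h1 : ∀ j, (∏ k, t k ^ A.adjugate j k) ^ A i j = ∏ k, t k ^ (A i j * A.adjugate j k) := by
    intro j
    rw [← Finset.prod_zpow]
    exact Finset.prod_congr rfl fun k _ => by rw [← zpow_mul, mul_comm]
  have h2 : ∀ k, ∏ j, t k ^ (A i j * A.adjugate j k) = if i = k then c i else 1 := by
    intro k
    have h3 : ∏ j, t k ^ (A i j * A.adjugate j k) = t k ^ (A * A.adjugate) i k := by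
      rw [Matrix.mul_apply]
      exact (map_sum (zpowersHom ℂˣ (t k)).toAdditiveRight _ _).symm
    rw [h3, Matrix.mul_adjugate, Matrix.smul_apply, Matrix.one_apply]
    split_ifs with hik
    · rw [smul_eq_mul, mul_one, ← hik, ht]
    · rw [smul_zero, zpow_zero]
  rw [Finset.prod_congr rfl fun j _ => h1 j, Finset.prod_comm, Finset.prod_congr rfl fun k _ => h2 k]
  simp

/-- Linear maps out of a quotient. -/
def quotientHomEquiv {M A : Type*} [AddCommGroup M] [AddCommGroup A] (L : Submodule ℤ M) :
    {f : M →ₗ[ℤ] A // L ≤ LinearMap.ker f} ≃ (M ⧸ L →ₗ[ℤ] A) where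
  toFun f := L.liftQ f.1 f.2
  invFun g := ⟨g.comp L.mkQ, fun x hx => by
    simp [(Submodule.Quotient.mk_eq_zero L).2 hx]⟩
  left_inv f := by ext x; simp
  right_inv g := by ext x; simp

theorem natCard_quotient_range_toLin' (A : Matrix ι ι ℤ) (hA : A.det ≠ 0) :
    Nat.card ((ι → ℤ) ⧸ LinearMap.range A.toLin') = A.det.natAbs := by
  have hinj : Function.Injective A.toLin' := by
    rw [← LinearMap.ker_eq_bot]
    exact Matrix.ker_toLin'_eq_bot_iff.2 fun v hv => by
      by_contra hv0
      exact hA (Matrix.exists_mulVec_eq_zero_iff.1 ⟨v, hv0, hv⟩)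
  rw [← Submodule.natAbs_det_equiv _ (LinearEquiv.ofInjective A.toLin' hinj)]
  congr 1
  rw [← LinearMap.det_toLin']
  congr 1

/-- Solutions are homomorphisms from `ℤ^ι` to `ℂˣ` killing the rows of `A`, that is, characters of
the finite abelian group `ℤ^ι / Aᵀℤ^ι`. That group has order `|det A|`, and `ℂˣ` has enough roots of
unity for it to have equally many characters. -/
theorem natCard_monomial_kernel (A : Matrix ι ι ℤ) (hA : A.det ≠ 0) :
    Nat.card {z : ι → ℂˣ // ∀ i, ∏ j, z j ^ A i j = 1} = A.det.natAbs := by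
  set L := LinearMap.range A.transpose.toLin'
  have hdet : A.transpose.det ≠ 0 := by rwa [Matrix.det_transpose]
  have hcard : Nat.card ((ι → ℤ) ⧸ L) = A.det.natAbs := by
    rw [natCard_quotient_range_toLin' _ hdet, Matrix.det_transpose]
  let b := Pi.basisFun ℤ ι
  let e1 : (ι → Additive ℂˣ) ≃ ((ι → ℤ) →ₗ[ℤ] Additive ℂˣ) := (b.constr ℤ).toEquiv
  have he1 : ∀ (z : ι → ℂˣ), (∀ i, ∏ j, z j ^ A i j = 1) ↔
      L ≤ LinearMap.ker (e1 fun j => Additive.ofMul (z j)) := by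
    intro z
    have hrow : ∀ i, e1 (fun j => Additive.ofMul (z j)) (A.transpose.toLin' (Pi.single i 1))
        = Additive.ofMul (∏ j, z j ^ A i j) := by
      intro i
      change b.constr ℤ (fun j => Additive.ofMul (z j)) _ = _
      rw [Module.Basis.constr_apply_fintype, ofMul_prod]
      refine Finset.sum_congr rfl fun j _ => ?_
      simp [b]
    constructor
    · intro h
      rw [LinearMap.range_le_ker_iff]
      refine (Pi.basisFun ℤ ι).ext fun i => ?_
      rw [LinearMap.comp_apply, Pi.basisFun_apply, hrow, h i]
      rfl
    · intro h i
      have := h (LinearMap.mem_range_self A.transpose.toLin' (Pi.single i 1))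
      rw [LinearMap.mem_ker, hrow] at this
      exact this
  let e2 : {z : ι → ℂˣ // ∀ i, ∏ j, z j ^ A i j = 1} ≃
      {f : (ι → ℤ) →ₗ[ℤ] Additive ℂˣ // L ≤ LinearMap.ker f} :=
    e1.subtypeEquiv he1
  let e3 : ((ι → ℤ) ⧸ L →ₗ[ℤ] Additive ℂˣ) ≃ (Multiplicative ((ι → ℤ) ⧸ L) →* ℂˣ) :=
    (addMonoidHomLequivInt ℤ).symm.toEquiv.trans AddMonoidHom.toMultiplicativeLeft
  have hne : Nat.card ((ι → ℤ) ⧸ L) ≠ 0 := by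
    rw [hcard]
    exact Int.natAbs_ne_zero.2 hA
  have hfin : Finite (Multiplicative ((ι → ℤ) ⧸ L)) := (Nat.finite_of_card_ne_zero hne : _)
  have : NeZero (Monoid.exponent (Multiplicative ((ι → ℤ) ⧸ L))) :=
    ⟨Monoid.exponent_ne_zero_of_finite⟩
  rw [Nat.card_congr ((e2.trans (quotientHomEquiv L)).trans e3),
    CommGroup.card_monoidHom_of_hasEnoughRootsOfUnity, ← hcard]
  rfl

/-- The number of solutions of a monomial system over `ℂˣ`. -/
theorem natCard_monomial_solutions (A : Matrix ι ι ℤ) (hA : A.det ≠ 0) (c : ι → ℂˣ) :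
    Nat.card {z : ι → ℂˣ // ∀ i, ∏ j, z j ^ A i j = c i} = A.det.natAbs := by
  obtain ⟨z₀, hz₀⟩ := exists_monomial_solution A hA c
  rw [← natCard_monomial_kernel A hA]
  refine Nat.card_congr ((Equiv.mulRight z₀⁻¹).subtypeEquiv fun z => forall_congr' fun i => ?_)
  simp only [Equiv.coe_mulRight, Pi.mul_apply, Pi.inv_apply, mul_zpow, Finset.prod_mul_distrib,
    inv_zpow, Finset.prod_inv_distrib, hz₀, mul_inv_eq_one]

end Monomial

/-! ## Tuples of distinct roots of unity -/

/-- Translation by `G` acts freely on injective tuples, and each orbit has exactly one member with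
`f i₀ = 1`. -/
theorem natCard_injective_apply_zero {G : Type*} [Group G] [Finite G] (k : ℕ) (i₀ : Fin (k + 1)) :
    Nat.card {f : Fin (k + 1) → G // Function.Injective f ∧ f i₀ = 1}
      = (Nat.card G - 1).descFactorial k := by
  classical
  have := Fintype.ofFinite G
  let e : (Fin (k + 1) ↪ G) ≃ G × {f : Fin (k + 1) → G // Function.Injective f ∧ f i₀ = 1} :=
    { toFun := fun f => (f i₀, ⟨fun i => (f i₀)⁻¹ * f i,
        fun i j h => f.injective (mul_left_cancel h), inv_mul_cancel _⟩)
      invFun := fun x => ⟨fun i => x.1 * x.2.1 i, fun i j h => x.2.2.1 (mul_left_cancel h)⟩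
      left_inv := fun f => by ext i; simp
      right_inv := fun x => by
        obtain ⟨g, f, hf, h0⟩ := x
        change (g * f i₀, (⟨fun i => (g * f i₀)⁻¹ * (g * f i), _⟩ :
          {f : Fin (k + 1) → G // Function.Injective f ∧ f i₀ = 1})) = _
        simp [h0] }
  have h1 := Nat.card_congr e
  rw [Nat.card_prod, Nat.card_eq_fintype_card (α := Fin (k + 1) ↪ G), Fintype.card_embedding_eq,
    Fintype.card_fin, ← Nat.card_eq_fintype_card] at h1
  have hpos : 0 < Nat.card G := Nat.card_pos
  obtain ⟨g, hg⟩ := Nat.exists_eq_succ_of_ne_zero hpos.ne'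
  rw [hg, Nat.succ_descFactorial_succ] at h1
  rw [hg, Nat.succ_sub_one]
  exact (Nat.eq_of_mul_eq_mul_left (Nat.succ_pos g) h1).symm

theorem natCard_distinct_roots (x n : ℕ) (hx : 0 < x) (hn : 0 < n) :
    Nat.card {f : Fin n → ℂˣ // (∀ α, f α ^ x = 1) ∧ Function.Injective f ∧ f ⟨0, hn⟩ = 1}
      = (x - 1).descFactorial (n - 1) := by
  obtain ⟨k, rfl⟩ := Nat.exists_eq_succ_of_ne_zero hn.ne'
  have : NeZero x := ⟨hx.ne'⟩
  let e : {f : Fin (k + 1) → ℂˣ // (∀ α, f α ^ x = 1) ∧ Function.Injective f ∧ f ⟨0, hn⟩ = 1} ≃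
      {f : Fin (k + 1) → rootsOfUnity x ℂ // Function.Injective f ∧ f ⟨0, hn⟩ = 1} :=
    { toFun := fun f => ⟨fun α => ⟨f.1 α, f.2.1 α⟩,
        fun i j h => f.2.2.1 (Subtype.ext_iff.1 h), Subtype.ext f.2.2.2⟩
      invFun := fun f => ⟨fun α => f.1 α, fun α => (f.1 α).2,
        fun i j h => f.2.1 (Subtype.ext h), congrArg Subtype.val f.2.2⟩
      left_inv := fun f => rfl
      right_inv := fun f => rfl }
  rw [Nat.card_congr e, natCard_injective_apply_zero,
    HasEnoughRootsOfUnity.natCard_rootsOfUnity, Nat.succ_sub_one]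

/-! ## Off-diagonal solutions of systems with repeated rows -/

section OffDiagonal

variable {T : Type*} [Fintype T] [DecidableEq T] (n x : T → ℕ) (M : T → T → ℤ) (c : T → ℂˣ)

/-- The exponent matrix of the system for the leading unknowns. -/
def reducedMatrix : Matrix T T ℤ :=
  Matrix.of fun p q => (if p = q then (x p : ℤ) else 0) + M p q * n q

/-- Separation of variables: with `z = u ξ`, where the given `ξ p α` is an `x_p`-th root of unity,
the ratios enter the equation only through a known constant, and the `n q` equal exponents of group
`q` collect into one exponent of `u q`. -/
theorem prod_zpow_reducedMatrix (u : T → ℂˣ) (ξ : ∀ p, Fin (n p) → ℂˣ) {p : T} {α : Fin (n p)}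
    (hξ : ξ p α ^ x p = 1) :
    (u p * ξ p α) ^ x p * ∏ j : (Σ p, Fin (n p)), (u j.1 * ξ j.1 j.2) ^ M p j.1
      = (∏ q, u q ^ reducedMatrix n x M p q) * ∏ q, (∏ β, ξ q β) ^ M p q := by
  have h1 : ∏ j : (Σ p, Fin (n p)), (u j.1 * ξ j.1 j.2) ^ M p j.1
      = ∏ q, (u q ^ (M p q * n q) * (∏ β, ξ q β) ^ M p q) := by
    rw [Fintype.prod_sigma]
    refine Finset.prod_congr rfl fun q _ => ?_
    dsimp only
    rw [Finset.prod_zpow, Finset.prod_mul_distrib, Finset.prod_const, Finset.card_univ,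
      Fintype.card_fin, mul_zpow, ← zpow_natCast, ← zpow_mul, mul_comm (n q : ℤ)]
  have h2 : ∏ q, u q ^ reducedMatrix n x M p q = u p ^ x p * ∏ q, u q ^ (M p q * n q) := by
    have : ∀ q, u q ^ reducedMatrix n x M p q
        = (if p = q then u q ^ x q else 1) * u q ^ (M p q * n q) := by
      intro q
      rw [reducedMatrix, Matrix.of_apply, zpow_add]
      split_ifs with h
      · rw [h, zpow_natCast]
      · rw [zpow_zero]
    rw [Finset.prod_congr rfl fun q _ => this q, Finset.prod_mul_distrib, Finset.prod_ite_eq]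
    simp
  rw [h1, h2, Finset.prod_mul_distrib, mul_pow, hξ, mul_one, mul_assoc]

/-- Solutions of the system whose unknowns in each group are distinct. -/
def DistinctSolution : Type _ :=
  {z : (Σ p, Fin (n p)) → ℂˣ //
    (∀ i, z i ^ x i.1 * ∏ j, z j ^ M i.1 j.1 = c i.1) ∧
      ∀ p, Function.Injective fun α => z ⟨p, α⟩}

/-- The data of the ratios of the unknowns in each group, and of the leading unknowns. -/
def LeadingData (hn : ∀ p, 0 < n p) : Type _ :=
  Σ ξ : (∀ p, {f : Fin (n p) → ℂˣ //
      (∀ α, f α ^ x p = 1) ∧ Function.Injective f ∧ f ⟨0, hn p⟩ = 1}),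
    {u : T → ℂˣ // ∀ p, ∏ q, u q ^ reducedMatrix n x M p q
      = c p * (∏ q, (∏ β, (ξ q).1 β) ^ M p q)⁻¹}

/-- The solution with the given leading unknowns and ratios. -/
def LeadingData.toSolution (hn : ∀ p, 0 < n p) (w : LeadingData n x M c hn) :
    DistinctSolution n x M c :=
  ⟨fun i => w.2.1 i.1 * (w.1 i.1).1 i.2, fun i => by
      rw [prod_zpow_reducedMatrix n x M w.2.1 (fun p => (w.1 p).1) ((w.1 i.1).2.1 i.2), w.2.2,
        inv_mul_cancel_right],
    fun p _ _ h => (w.1 p).2.2.1 (mul_left_cancel h)⟩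

/-- Two equations of the same group share the factor `∏_j z_j^{M}` and the right-hand side, so
`z_{pα}^{x_p}` does not depend on `α`; dividing by the first unknown of each group yields the
inverse map. -/
theorem LeadingData.toSolution_bijective (hn : ∀ p, 0 < n p) :
    Function.Bijective (LeadingData.toSolution n x M c hn) := by
  constructor
  · rintro ⟨ξ, u, hu⟩ ⟨ξ', u', hu'⟩ h
    have hz : ∀ p α, u p * (ξ p).1 α = u' p * (ξ' p).1 α := fun p α =>
      congrFun (Subtype.ext_iff.1 h) ⟨p, α⟩
    have huu : u = u' := by
      ext p
      have := hz p ⟨0, hn p⟩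
      rw [(ξ p).2.2.2, (ξ' p).2.2.2, mul_one, mul_one] at this
      rw [this]
    subst huu
    have hξ : ξ = ξ' := by
      funext p
      exact Subtype.ext (funext fun α => mul_left_cancel (hz p α))
    subst hξ
    rfl
  · intro z
    have hroot : ∀ p (α : Fin (n p)), (z.1 ⟨p, α⟩ * (z.1 ⟨p, ⟨0, hn p⟩⟩)⁻¹) ^ x p = 1 := by
      intro p α
      have h1 := z.2.1 ⟨p, α⟩
      have h2 := z.2.1 ⟨p, ⟨0, hn p⟩⟩
      dsimp only at h1 h2
      rw [mul_pow, inv_pow, mul_inv_eq_one]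
      exact mul_right_cancel (h1.trans h2.symm)
    have hz : ∀ p α, z.1 ⟨p, ⟨0, hn p⟩⟩ * (z.1 ⟨p, α⟩ * (z.1 ⟨p, ⟨0, hn p⟩⟩)⁻¹) = z.1 ⟨p, α⟩ :=
      fun p α => by rw [mul_comm, inv_mul_cancel_right]
    refine ⟨⟨fun p => ⟨fun α => z.1 ⟨p, α⟩ * (z.1 ⟨p, ⟨0, hn p⟩⟩)⁻¹, hroot p,
      fun α β h => z.2.2 p (mul_right_cancel h), mul_inv_cancel _⟩,
      ⟨fun p => z.1 ⟨p, ⟨0, hn p⟩⟩, fun p => ?_⟩⟩, Subtype.ext (funext fun i => hz i.1 i.2)⟩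
    rw [eq_mul_inv_iff_mul_eq, ← prod_zpow_reducedMatrix n x M (fun p => z.1 ⟨p, ⟨0, hn p⟩⟩)
      (fun p α => z.1 ⟨p, α⟩ * (z.1 ⟨p, ⟨0, hn p⟩⟩)⁻¹) (hroot p ⟨0, hn p⟩)]
    simp only [hz]
    exact z.2.1 ⟨p, ⟨0, hn p⟩⟩

/-- The choice of ratios affects only the right-hand side of the system for the leading unknowns, so
every choice contributes the same number `|det|`. -/
theorem natCard_distinctSolution (hn : ∀ p, 0 < n p) (hx : ∀ p, 0 < x p)
    (hdet : (reducedMatrix n x M).det ≠ 0) :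
    Finite (DistinctSolution n x M c) ∧ Nat.card (DistinctSolution n x M c)
      = (∏ p, (x p - 1).descFactorial (n p - 1)) * (reducedMatrix n x M).det.natAbs := by
  have hfin1 : ∀ p, Finite {f : Fin (n p) → ℂˣ //
      (∀ α, f α ^ x p = 1) ∧ Function.Injective f ∧ f ⟨0, hn p⟩ = 1} := by
    intro p
    have : NeZero (x p) := ⟨(hx p).ne'⟩
    refine Finite.of_injective (β := Fin (n p) → rootsOfUnity (x p) ℂ)
      (fun f α => ⟨f.1 α, f.2.1 α⟩) fun f g h => Subtype.ext (funext fun α => ?_)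
    exact congrArg Subtype.val (congrFun h α)
  have hfin2 : ∀ c' : T → ℂˣ,
      Finite {u : T → ℂˣ // ∀ p, ∏ q, u q ^ reducedMatrix n x M p q = c' p} := by
    intro c'
    refine Nat.finite_of_card_ne_zero ?_
    rw [natCard_monomial_solutions _ hdet]
    exact Int.natAbs_ne_zero.2 hdet
  have hfin : Finite (LeadingData n x M c hn) := by
    unfold LeadingData
    infer_instance
  have e := Equiv.ofBijective _ (LeadingData.toSolution_bijective n x M c hn)
  refine ⟨Finite.of_equiv _ e, ?_⟩
  have := Fintype.ofFinite (∀ p, {f : Fin (n p) → ℂˣ //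
    (∀ α, f α ^ x p = 1) ∧ Function.Injective f ∧ f ⟨0, hn p⟩ = 1})
  rw [← Nat.card_congr e, LeadingData, Nat.card_sigma,
    Finset.sum_congr rfl fun ξ _ => natCard_monomial_solutions _ hdet _, Finset.sum_const,
    Finset.card_univ, smul_eq_mul, ← Nat.card_eq_fintype_card, Nat.card_pi]
  congr 1
  exact Finset.prod_congr rfl fun p _ => natCard_distinct_roots _ _ (hx p) (hn p)

end OffDiagonal

/-! ## Positivity of the determinant -/

variable (X : AffineType)

theorem minD_comm (p s : X.H) : minD X p s = minD X s p := by
  rw [minD, minD, min_comm]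

/-- Since `min(s,t) = ∑_{j≥1} [j ≤ s][j ≤ t]`, the form is a sum over levels `j` of the symmetrized
Cartan form evaluated at the vector `Y j` of partial sums of `y` over strings reaching level `j`. -/
theorem minD_kernel_pos (T : Finset X.H) (y : T → ℝ) (hy : y ≠ 0) :
    0 < ∑ p : T, ∑ s : T, ((X.d (p : X.H).1 : ℝ) * X.cartan (p : X.H).1 (s : X.H).1 * minD X p s)
      * y p * y s := by
  classical
  let t : X.H → ℕ := fun p => X.dBig (X.incl p.1) * p.2
  let J : ℕ := T.sup t
  let Y : ℕ → Fin X.rank → ℝ := fun j a => ∑ p : T, if (p : X.H).1 = a ∧ j ≤ t p then y p else 0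
  have hmin : ∀ p s : T, (minD X p s : ℝ)
      = ∑ j ∈ Finset.Icc 1 J, (if j ≤ t p then 1 else 0) * (if j ≤ t s then 1 else 0) := by
    intro p s
    have hp : t p ≤ J := Finset.le_sup p.2
    have h1 : ∀ j, ((if j ≤ t p then 1 else 0) * (if j ≤ t s then 1 else 0) : ℝ)
        = if j ≤ min (t p) (t s) then 1 else 0 := by
      intro j
      simp only [le_min_iff]
      split_ifs <;> simp_all
    have h2 : (Finset.Icc 1 J).filter (fun j => j ≤ min (t p) (t s))
        = Finset.Icc 1 (min (t p) (t s)) := by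
      ext j
      simp only [Finset.mem_filter, Finset.mem_Icc]
      omega
    rw [Finset.sum_congr rfl fun j _ => h1 j, ← Finset.sum_filter, h2]
    simp [minD, t]
  have hform : ∑ p : T, ∑ s : T,
      ((X.d (p : X.H).1 : ℝ) * X.cartan (p : X.H).1 (s : X.H).1 * minD X p s) * y p * y s
      = ∑ j ∈ Finset.Icc 1 J, ∑ a, ∑ b, ((X.d a : ℝ) * X.cartan a b) * Y j a * Y j b := by
    have hY : ∀ j, ∑ a, ∑ b, ((X.d a : ℝ) * X.cartan a b) * Y j a * Y j b
        = ∑ p : T, ∑ s : T, ((X.d (p : X.H).1 : ℝ) * X.cartan (p : X.H).1 (s : X.H).1)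
          * (if j ≤ t p then y p else 0) * (if j ≤ t s then y s else 0) := by
      intro j
      have e1 : ∀ (f : Fin X.rank → ℝ), ∑ a, f a * Y j a
          = ∑ p : T, f (p : X.H).1 * (if j ≤ t p then y p else 0) := by
        intro f
        simp only [Y, Finset.mul_sum]
        rw [Finset.sum_comm]
        refine Finset.sum_congr rfl fun p _ => ?_
        rw [Finset.sum_eq_single (p : X.H).1 (fun a _ ha => by simp [ha.symm]) (by simp)]
        simp
      calc ∑ a, ∑ b, ((X.d a : ℝ) * X.cartan a b) * Y j a * Y j b
          = ∑ a, (∑ b, ((X.d a : ℝ) * X.cartan a b) * Y j b) * Y j a := by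
            refine Finset.sum_congr rfl fun a _ => ?_
            rw [Finset.sum_mul]
            exact Finset.sum_congr rfl fun b _ => by ring
        _ = _ := by
            rw [e1]
            refine Finset.sum_congr rfl fun p _ => ?_
            rw [e1, Finset.sum_mul]
            exact Finset.sum_congr rfl fun s _ => by ring
    simp only [hY]
    rw [Finset.sum_comm (s := Finset.Icc 1 J)]
    refine Finset.sum_congr rfl fun p _ => ?_
    rw [Finset.sum_comm (s := Finset.Icc 1 J)]
    refine Finset.sum_congr rfl fun s _ => ?_
    rw [hmin, Finset.mul_sum, Finset.sum_mul, Finset.sum_mul]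
    refine Finset.sum_congr rfl fun j _ => ?_
    split_ifs <;> simp
  obtain ⟨p₁, hp₁⟩ := Function.ne_iff.1 hy
  -- At the level of the longest string of one colour with `y ≠ 0`, only that string contributes to
  -- its colour, so `Y` is nonzero there. Strings of equal colour and level coincide because `d'_a >
  -- 0`.
  obtain ⟨p₀, hp₀, hmax⟩ := Finset.exists_max_image
    (Finset.univ.filter fun p : T => y p ≠ 0 ∧ (p : X.H).1 = (p₁ : X.H).1) (fun p => t p)
    ⟨p₁, by simpa using hp₁⟩
  rw [Finset.mem_filter] at hp₀
  have ht₀ : t p₀ ∈ Finset.Icc 1 J :=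
    Finset.mem_Icc.2 ⟨Nat.mul_pos (X.dBig_pos _) (p₀ : X.H).2.pos, Finset.le_sup p₀.2⟩
  have hY₀ : Y (t p₀) ≠ 0 := by
    refine Function.ne_iff.2 ⟨(p₁ : X.H).1, ?_⟩
    have : Y (t p₀) (p₁ : X.H).1 = y p₀ := by
      simp only [Y]
      rw [Finset.sum_eq_single p₀, if_pos ⟨hp₀.2.2, le_rfl⟩]
      · intro s _ hs
        split_ifs with hc
        · by_contra hys
          have h1 : t s ≤ t p₀ := hmax s (Finset.mem_filter.2 ⟨Finset.mem_univ _, hys, hc.1⟩)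
          have h2 : t s = t p₀ := le_antisymm h1 hc.2
          have ha : (s : X.H).1 = (p₀ : X.H).1 := hc.1.trans hp₀.2.2.symm
          refine hs (Subtype.ext (Prod.ext ha (PNat.eq ?_)))
          simp only [t, ha] at h2
          exact Nat.eq_of_mul_eq_mul_left (X.dBig_pos _) h2
        · rfl
      · simp
    rw [this]
    exact hp₀.2.1
  have hnonneg : ∀ z : Fin X.rank → ℝ,
      0 ≤ ∑ a, ∑ b, ((X.d a : ℝ) * X.cartan a b) * z a * z b := by
    intro z
    by_cases hz : z = 0
    · simp [hz]
    · exact (cartan_quadraticForm_pos X z hz).le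
  rw [hform]
  exact Finset.sum_pos' (fun j _ => hnonneg _) ⟨t p₀, ht₀, cartan_quadraticForm_pos X _ hY₀⟩

/-- `F = diag(h) (diag(D) + K) diag(g)` with `h = 1/d'_a`, `g = N/(ε_b d_b)` and `K` the positive
definite kernel of `minD_kernel_pos`; nonnegative vacancy numbers make `D ≥ 0`. -/
theorem fMatrix_det_pos (ν N : X.H →₀ ℕ) (hP : ∀ p ∈ N.support, 0 ≤ vacancy X ν N p) :
    0 < (fMatrix X ν N).det := by
  classical
  let h : N.support → ℝ := fun p => 1 / (X.dBig (X.incl (p : X.H).1) : ℝ)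
  let g : N.support → ℝ := fun s =>
    (N s : ℝ) / ((X.eps (s : X.H).1 : ℝ) * X.d (s : X.H).1)
  have hh : ∀ p, 0 < h p := fun p => by
    have : (0 : ℝ) < X.dBig (X.incl (p : X.H).1) := by exact_mod_cast X.dBig_pos _
    positivity
  have hg : ∀ p, 0 < g p := fun p => by
    have h1 : (0 : ℝ) < X.eps (p : X.H).1 := by exact_mod_cast X.eps_pos _
    have h2 : (0 : ℝ) < X.d (p : X.H).1 := by exact_mod_cast X.d_pos _
    have h3 : (0 : ℝ) < N p := by
      exact_mod_cast Nat.pos_of_ne_zero (Finsupp.mem_support_iff.1 p.2)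
    positivity
  let K : Matrix N.support N.support ℝ := Matrix.of fun p s =>
    (X.d (p : X.H).1 : ℝ) * X.cartan (p : X.H).1 (s : X.H).1 * minD X p s
  let D : N.support → ℝ := fun p => vacancy X ν N p / (h p * g p)
  have hD : ∀ p, 0 ≤ D p := fun p => by
    have : (0 : ℝ) ≤ vacancy X ν N p := by exact_mod_cast hP p p.2
    exact div_nonneg this (mul_pos (hh p) (hg p)).le
  have hsymm : ∀ p s, K p s = K s p := by
    intro p s
    have : (X.d (p : X.H).1 : ℝ) * X.cartan (p : X.H).1 (s : X.H).1
        = X.d (s : X.H).1 * X.cartan (s : X.H).1 (p : X.H).1 := by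
      exact_mod_cast X.d_mul_cartan _ _
    simp only [K, Matrix.of_apply, this, minD_comm X p s]
  have hK : K.PosDef := by
    refine Matrix.PosDef.of_dotProduct_mulVec_pos ?_ fun y hy => ?_
    · ext p s
      simp [Matrix.conjTranspose_apply, hsymm s p]
    · have := minD_kernel_pos X N.support y hy
      simp only [star_trivial, dotProduct, Matrix.mulVec, Finset.mul_sum]
      refine this.trans_eq (Finset.sum_congr rfl fun p _ => Finset.sum_congr rfl fun s _ => ?_)
      simp only [K, Matrix.of_apply]
      ring
  have hpos : (Matrix.diagonal D + K).PosDef :=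
    Matrix.PosDef.posSemidef_add (Matrix.posSemidef_diagonal_iff.2 hD) hK
  have hF : (fMatrix X ν N).map (Int.castRingHom ℝ)
      = Matrix.diagonal h * (Matrix.diagonal D + K) * Matrix.diagonal g := by
    ext p s
    rw [Matrix.mul_diagonal, Matrix.diagonal_mul, Matrix.map_apply, Matrix.add_apply,
      Matrix.diagonal_apply, fMatrix, Matrix.of_apply]
    have hb : (bCoef X s p : ℝ) * ((X.eps (s : X.H).1 : ℝ) * X.dBig (X.incl (p : X.H).1))
        = X.cartan (s : X.H).1 (p : X.H).1 * minD X s p := by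
      exact_mod_cast bCoef_mul X s p
    have h1 : (X.eps (s : X.H).1 : ℝ) ≠ 0 := by exact_mod_cast (X.eps_pos _).ne'
    have h2 : (X.d (s : X.H).1 : ℝ) ≠ 0 := by exact_mod_cast (X.d_pos _).ne'
    have h3 : (X.dBig (X.incl (p : X.H).1) : ℝ) ≠ 0 := by exact_mod_cast (X.dBig_pos _).ne'
    have hKps : h p * K p s * g s = bCoef X s p * N s := by
      rw [hsymm p s]
      simp only [K, h, g, Matrix.of_apply]
      field_simp
      linear_combination (-(N s : ℝ)) * hb
    rw [mul_add, add_mul, hKps, eq_intCast]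
    push_cast
    congr 1
    split_ifs with hps
    · subst hps
      have h4 := (hh p).ne'
      have h5 := (hg p).ne'
      simp only [D]
      field_simp
    · simp
  have hdet := congrArg Matrix.det hF
  rw [Matrix.det_mul, Matrix.det_mul, Matrix.det_diagonal, Matrix.det_diagonal,
    ← RingHom.mapMatrix_apply, ← RingHom.map_det] at hdet
  have : (0 : ℝ) < ((fMatrix X ν N).det : ℝ) := by
    rw [← eq_intCast (Int.castRingHom ℝ), hdet]
    exact mul_pos (mul_pos (Finset.prod_pos fun p _ => hh p) hpos.det_pos)
      (Finset.prod_pos fun p _ => hg p)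
  exact_mod_cast this

/-! ## The string center equation -/

/-- `R(ν,N)` is the number of off-diagonal solutions of the string center equation up to
permutations. -/
theorem offDiagonalSolutions_card (ν N : X.H →₀ ℕ)
    (hP : ∀ p ∈ N.support, 0 ≤ vacancy X ν N p) :
    (offDiagonalSolutions X ν N).Finite ∧
      ((offDiagonalSolutions X ν N).ncard : ℚ) / ∏ p ∈ N.support, ((N p).factorial : ℚ)
        = R X ν N := by
  classical
  have hN : ∀ p : N.support, 0 < N p := fun p =>
    Nat.pos_of_ne_zero (Finsupp.mem_support_iff.1 p.2)
  let n : N.support → ℕ := fun p => N p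
  let x : N.support → ℕ := fun p => (vacancy X ν N p).toNat + N p
  have hxv : ∀ p : N.support, (x p : ℤ) = vacancy X ν N p + N p := fun p => by
    have := hP p p.2
    simp only [x]
    omega
  let M : N.support → N.support → ℤ := fun p q => bCoef X q p - if p = q then 1 else 0
  let c : N.support → ℂˣ := fun p => (-1 : ℂˣ) ^ (vacancyHat X ν N p + N p + 1)
  -- The `-1` inside a block of the exponent matrix, counted `N` times, cancels the `+N` in `x = P +
  -- N`.
  have hF : reducedMatrix n x M = fMatrix X ν N := by
    ext p q
    simp only [reducedMatrix, fMatrix, Matrix.of_apply, M, n]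
    split_ifs with hpq
    · rw [hxv, hpq]; ring
    · ring
  have hdet := fMatrix_det_pos X ν N hP
  have hset : ∀ z : StringIndex N → ℂˣ, z ∈ offDiagonalSolutions X ν N ↔
      (∀ i, z i ^ x i.1 * ∏ j, z j ^ M i.1 j.1 = c i.1) ∧
        ∀ p, Function.Injective fun α => z ⟨p, α⟩ := by
    intro z
    refine and_congr (forall_congr' fun i => ?_) Iff.rfl
    have h1 : ∏ j, z j ^ sceMatrix X ν N i j = z i ^ x i.1 * ∏ j, z j ^ M i.1 j.1 := by
      have h2 : ∀ j, z j ^ sceMatrix X ν N i j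
          = (if i = j then z j ^ x j.1 else 1) * z j ^ M i.1 j.1 := by
        intro j
        rw [sceMatrix, add_sub_assoc, zpow_add]
        congr 1
        split_ifs with hij
        · rw [← hxv, hij, zpow_natCast]
        · rw [zpow_zero]
      rw [Finset.prod_congr rfl fun j _ => h2 j, Finset.prod_mul_distrib, Finset.prod_ite_eq]
      simp
    rw [h1]
  have hcount := natCard_distinctSolution n x M c hN (fun p => by
    have := hN p
    simp only [x]
    omega) (by rw [hF]; exact hdet.ne')
  let e : offDiagonalSolutions X ν N ≃ DistinctSolution n x M c :=
    (Equiv.refl _).subtypeEquiv hset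
  refine ⟨?_, ?_⟩
  · have := hcount.1
    exact Finite.of_equiv _ e.symm
  · have hcard : (offDiagonalSolutions X ν N).ncard
        = (∏ p, (x p - 1).descFactorial (n p - 1)) * (reducedMatrix n x M).det.natAbs := by
      rw [← hcount.2, ← Nat.card_congr e]
      rfl
    have habs : (((fMatrix X ν N).det.natAbs : ℕ) : ℚ) = ((fMatrix X ν N).det : ℚ) := by
      have : (((fMatrix X ν N).det.natAbs : ℕ) : ℤ) = (fMatrix X ν N).det :=
        Int.natAbs_of_nonneg hdet.le
      rw [← Int.cast_natCast, this]
    rw [hcard, hF, Nat.cast_mul, habs, R, ← Finset.prod_coe_sort N.support fun p => ((N p).factorial : ℚ),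
      ← Finset.prod_coe_sort N.support fun p => (1 / (N p : ℚ)) *
        ((Ring.choose (vacancy X ν N p + N p - 1) (N p - 1) : ℤ) : ℚ),
      Nat.cast_prod, mul_comm, mul_div_assoc, ← Finset.prod_div_distrib]
    congr 1
    refine Finset.prod_congr rfl fun p _ => ?_
    have hx1 : vacancy X ν N p + N p - 1 = ((x p - 1 : ℕ) : ℤ) := by
      have := hxv p
      have := hN p
      have : 0 < x p := by simp only [x]; omega
      omega
    -- The falling factorial is `(N-1)!` times a binomial coefficient, and dividing by `N!` leaves
    -- the factor `1/N` of `R`.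
    rw [hx1, Ring.choose_natCast, Nat.descFactorial_eq_factorial_mul_choose,
      ← Nat.mul_factorial_pred (hN p).ne']
    have h1 : ((N p : ℕ) : ℚ) ≠ 0 := by exact_mod_cast (hN p).ne'
    have h2 : (((N p - 1).factorial : ℕ) : ℚ) ≠ 0 := by exact_mod_cast Nat.factorial_ne_zero _
    simp only [n]
    push_cast
    field_simp

end QAffine
end

noncomputable section
namespace QAffine

open scoped TensorProduct

/-! ## Characters from bases of weight vectors -/

section WeightBasis

variable (X : AffineType) (q : ℂ)

/-- The members of the basis `e` are weight vectors, of weights `top - ∑_a μ_a α_a`. -/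
def IsWeightBasis {ι V : Type*} [AddCommGroup V] [Module ℂ V] (e : Module.Basis ι ℂ V)
    (T : Fin X.rank → Module.End ℂ V) (top : Fin X.rank → ℤ) (μ : ι → Fin X.rank →₀ ℕ) : Prop :=
  ∀ i b, T b (e i) = q ^ ((X.d b : ℤ) * lowered X top (μ i) b) • e i

theorem zpow_injective_of_pow_ne_one {q : ℂ} (hq0 : q ≠ 0) (hq : ∀ k : ℕ, 0 < k → q ^ k ≠ 1) :
    Function.Injective fun n : ℤ => q ^ n := by
  have key : ∀ n : ℤ, 0 < n → q ^ n ≠ 1 := by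
    intro n hn
    lift n to ℕ using hn.le
    rw [zpow_natCast]
    exact hq n (by exact_mod_cast hn)
  intro m n (hmn : q ^ m = q ^ n)
  by_contra hne
  rcases lt_or_gt_of_ne hne with h | h
  · refine key (n - m) (by omega) ?_
    rw [zpow_sub₀ hq0, hmn, div_self (zpow_ne_zero _ hq0)]
  · refine key (m - n) (by omega) ?_
    rw [zpow_sub₀ hq0, hmn, div_self (zpow_ne_zero _ hq0)]

/-- Powers of `q` determine their exponents as `q` is not a root of unity, and the exponents
determine `μ` as the Cartan matrix is nonsingular. -/
theorem eq_of_weight_eq {q : ℂ} (hq0 : q ≠ 0) (hq : ∀ k : ℕ, 0 < k → q ^ k ≠ 1)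
    {top : Fin X.rank → ℤ} {μ μ' : Fin X.rank →₀ ℕ}
    (h : ∀ b, q ^ ((X.d b : ℤ) * lowered X top μ b) = q ^ ((X.d b : ℤ) * lowered X top μ' b)) :
    μ = μ' := by
  have h1 : (fun a => (μ a : ℤ) - μ' a) = 0 := by
    refine cartan_mulVec_injective X fun b => ?_
    have h2 := zpow_injective_of_pow_ne_one hq0 hq (h b)
    have h3 := mul_left_cancel₀ (by exact_mod_cast (X.d_pos b).ne') h2
    simp only [lowered] at h3
    simp only [sub_mul, Finset.sum_sub_distrib]
    omega
  ext a
  have := congrFun h1 a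
  simp only [Pi.zero_apply] at this
  omega

theorem weightMultiplicity_eq_card {q : ℂ} (hq0 : q ≠ 0) (hq : ∀ k : ℕ, 0 < k → q ^ k ≠ 1)
    {ι V : Type*} [Fintype ι] [AddCommGroup V] [Module ℂ V] {e : Module.Basis ι ℂ V}
    {T : Fin X.rank → Module.End ℂ V} {top : Fin X.rank → ℤ} {μ : ι → Fin X.rank →₀ ℕ}
    (he : IsWeightBasis X q e T top μ) (μ₀ : Fin X.rank →₀ ℕ) :
    weightMultiplicity X q T (lowered X top μ₀) = Fintype.card {i // μ i = μ₀} := by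
  have hspan : (⨅ b, (T b).eigenspace (q ^ ((X.d b : ℤ) * lowered X top μ₀ b)) : Submodule ℂ V)
      = Submodule.span ℂ (Set.range fun i : {i // μ i = μ₀} => e i) := by
    apply le_antisymm
    · intro v hv
      rw [Submodule.mem_iInf] at hv
      have hcoord : ∀ i, μ i ≠ μ₀ → e.repr v i = 0 := by
        intro i hi
        by_contra hne
        refine hi (eq_of_weight_eq X hq0 hq (top := top) fun b => ?_)
        have h1 := Module.End.mem_eigenspace_iff.1 (hv b)
        have h2 : T b v = ∑ j, e.repr v j •
            (q ^ ((X.d b : ℤ) * lowered X top (μ j) b) • e j) := by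
          conv_lhs => rw [← e.sum_repr v]
          rw [map_sum]
          exact Finset.sum_congr rfl fun j _ => by rw [map_smul, he j b]
        -- Comparing coordinates at `i` in the eigenvector equation: a nonzero coordinate forces the
        -- eigenvalue of `e i` to be the prescribed one.
        have h3 := congrArg (fun w => e.repr w i) (h2.symm.trans h1)
        simp only [map_sum, map_smul, Module.Basis.repr_self, Finsupp.smul_apply, smul_eq_mul,
          Finsupp.finsetSum_apply] at h3
        rw [Finset.sum_eq_single i (fun j _ hj => by simp [Finsupp.single_eq_of_ne hj.symm])
          (by simp), Finsupp.single_eq_same, mul_one, mul_comm] at h3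
        exact mul_right_cancel₀ hne h3
      rw [← e.sum_repr v]
      refine Submodule.sum_mem _ fun i _ => ?_
      by_cases hi : μ i = μ₀
      · exact Submodule.smul_mem _ _ (Submodule.subset_span ⟨⟨i, hi⟩, rfl⟩)
      · rw [hcoord i hi, zero_smul]
        exact Submodule.zero_mem _
    · rw [Submodule.span_le]
      rintro _ ⟨⟨i, rfl⟩, rfl⟩
      rw [SetLike.mem_coe, Submodule.mem_iInf]
      exact fun b => Module.End.mem_eigenspace_iff.2 (he i b)
  rw [weightMultiplicity, hspan]
  exact finrank_span_eq_card (e.linearIndependent.comp _ Subtype.val_injective)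

/-- In this form multiplicativity on tensor products is just the expansion of a product of sums. It
needs every weight to lie below `top`, since `normalizedCharacter` sees no others. -/
theorem normalizedCharacter_eq_sum {q : ℂ} (hq0 : q ≠ 0) (hq : ∀ k : ℕ, 0 < k → q ^ k ≠ 1)
    {ι V : Type*} [Fintype ι] [AddCommGroup V] [Module ℂ V] {e : Module.Basis ι ℂ V}
    {T : Fin X.rank → Module.End ℂ V} {top : Fin X.rank → ℤ} {μ : ι → Fin X.rank →₀ ℕ}
    (he : IsWeightBasis X q e T top μ) :
    normalizedCharacter X q T top = ∑ i, MvPowerSeries.monomial (μ i) (1 : ℂ) := by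
  classical
  ext μ₀
  rw [map_sum]
  change ((weightMultiplicity X q T (lowered X top μ₀) : ℕ) : ℂ) = _
  rw [weightMultiplicity_eq_card X hq0 hq he, Fintype.card_subtype, Finset.card_filter]
  push_cast
  exact Finset.sum_congr rfl fun i _ => by
    rw [MvPowerSeries.coeff_monomial]
    exact if_congr eq_comm rfl rfl

theorem exists_isWeightBasis {V : Type*} [AddCommGroup V] [Module ℂ V] [FiniteDimensional ℂ V]
    {T : Fin X.rank → Module.End ℂ V} {top : Fin X.rank → ℤ}
    (h : Submodule.span ℂ {w : V | ∃ μ : Fin X.rank →₀ ℕ,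
      ∀ b, T b w = q ^ ((X.d b : ℤ) * lowered X top μ b) • w} = ⊤) :
    ∃ (n : ℕ) (e : Module.Basis (Fin n) ℂ V) (μ : Fin n → Fin X.rank →₀ ℕ),
      IsWeightBasis X q e T top μ := by
  let e₀ := Module.Basis.ofSpan h.ge
  have : Finite _ := Module.Finite.finite_basis e₀
  let e := e₀.reindex (Finite.equivFin _)
  have he : ∀ i, ∃ μ : Fin X.rank →₀ ℕ,
      ∀ b, T b (e i) = q ^ ((X.d b : ℤ) * lowered X top μ b) • e i := by
    intro i
    exact Module.Basis.ofSpan_subset h.ge ⟨(Finite.equivFin _).symm i, (e₀.reindex_apply _ i).symm⟩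
  choose μ hμ using he
  exact ⟨_, e, μ, hμ⟩

theorem monomial_sum_one {σ S : Type*} (s : Finset S) (f : S → σ →₀ ℕ) :
    MvPowerSeries.monomial (∑ i ∈ s, f i) (1 : ℂ)
      = ∏ i ∈ s, MvPowerSeries.monomial (f i) (1 : ℂ) := by
  classical
  induction s using Finset.induction_on with
  | empty => simp [MvPowerSeries.monomial_zero_one]
  | insert i s hi ih =>
    rw [Finset.sum_insert hi, Finset.prod_insert hi, ← ih, MvPowerSeries.monomial_mul_monomial,
      one_mul]

theorem lowered_sum {S : Type*} [Fintype S] (top : S → Fin X.rank → ℤ)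
    (μ : S → Fin X.rank →₀ ℕ) (b : Fin X.rank) :
    lowered X (fun b => ∑ s, top s b) (∑ s, μ s) b = ∑ s, lowered X (top s) (μ s) b := by
  simp only [lowered, Finsupp.finsetSum_apply, Finset.sum_sub_distrib]
  rw [Finset.sum_comm]
  push_cast
  simp only [Finset.sum_mul]

theorem IsWeightBasis.piTensorProduct {q : ℂ} (hq0 : q ≠ 0) {S : Type*} [Fintype S]
    {ι : S → Type*} [∀ s, Finite (ι s)] {V : S → Type*} [∀ s, AddCommGroup (V s)]
    [∀ s, Module ℂ (V s)] {e : ∀ s, Module.Basis (ι s) ℂ (V s)}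
    {T : ∀ s, Fin X.rank → Module.End ℂ (V s)} {top : S → Fin X.rank → ℤ}
    {μ : ∀ s, ι s → Fin X.rank →₀ ℕ} (he : ∀ s, IsWeightBasis X q (e s) (T s) (top s) (μ s)) :
    IsWeightBasis X q (Basis.piTensorProduct e) (fun b => PiTensorProduct.map fun s => T s b)
      (fun b => ∑ s, top s b) (fun f => ∑ s, μ s (f s)) := by
  intro f b
  rw [Basis.piTensorProduct_apply, PiTensorProduct.map_tprod, lowered_sum, Finset.mul_sum]
  simp only [he _ _ b]
  rw [MultilinearMap.map_smul_univ]
  congr 1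
  induction (Finset.univ : Finset S) using Finset.cons_induction with
  | empty => simp
  | cons s t hs ih => rw [Finset.prod_cons, Finset.sum_cons, zpow_add₀ hq0, ih]

theorem normalizedCharacter_piTensorProduct {q : ℂ} (hq0 : q ≠ 0)
    (hq : ∀ k : ℕ, 0 < k → q ^ k ≠ 1) {S : Type*} [Fintype S]
    {n : S → ℕ} {V : S → Type*} [∀ s, AddCommGroup (V s)]
    [∀ s, Module ℂ (V s)] {e : ∀ s, Module.Basis (Fin (n s)) ℂ (V s)}
    {T : ∀ s, Fin X.rank → Module.End ℂ (V s)} {top : S → Fin X.rank → ℤ}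
    {μ : ∀ s, Fin (n s) → Fin X.rank →₀ ℕ}
    (he : ∀ s, IsWeightBasis X q (e s) (T s) (top s) (μ s)) :
    normalizedCharacter X q (fun b => PiTensorProduct.map fun s => T s b)
      (fun b => ∑ s, top s b) = ∏ s, normalizedCharacter X q (T s) (top s) := by
  classical
  rw [normalizedCharacter_eq_sum X hq0 hq (IsWeightBasis.piTensorProduct X hq0 he)]
  simp only [monomial_sum_one, normalizedCharacter_eq_sum X hq0 hq (he _)]
  rw [Finset.prod_univ_sum, Fintype.piFinset_univ]

end WeightBasis

end QAffine
end

noncomputable section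
namespace QAffine

/-! ## Highest weight modules are spanned by weight vectors -/

section HighestWeight

variable (X : AffineType) (q : ℂ)

theorem AffineType.r_pos : 0 < X.r := by
  cases X <;> simp [AffineType.r]

theorem omega_ne_zero : omega X ≠ 0 := Complex.exp_ne_zero _

theorem gLeft_coeff_zero (s : ℤˣ) (i j : Fin X.bigRank) : (gLeft X q s i j).coeff 0 = 1 := by
  simp [gLeft, Polynomial.coeff_zero_prod]

/-- The top coefficient is the product of the linear coefficients `-ω^t q^{±b_t}`. It is what allows
the commutation relation with `φ^-` to be solved from the other end. -/
theorem gLeft_coeff_r_ne_zero {q : ℂ} (hq0 : q ≠ 0) (s : ℤˣ) (i j : Fin X.bigRank) :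
    (gLeft X q s i j).coeff X.r ≠ 0 := by
  have h := Polynomial.coeff_prod_of_natDegree_le (Finset.Icc 1 X.r) (fun t =>
    (1 - Polynomial.C (omega X ^ t * q ^ ((s : ℤ) * bExp X i j t)) * Polynomial.X)) 1
    (fun t _ => by compute_degree)
  rw [Nat.card_Icc, Nat.add_sub_cancel, mul_one] at h
  rw [gLeft, h, Finset.prod_ne_zero_iff]
  intro t _
  rw [Polynomial.coeff_sub, Polynomial.coeff_C_mul, Polynomial.coeff_X_one, mul_one,
    Polynomial.coeff_one, if_neg one_ne_zero, zero_sub]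
  exact neg_ne_zero.2 (mul_ne_zero (pow_ne_zero _ (omega_ne_zero X)) (zpow_ne_zero _ hq0))

theorem gRight_coeff_zero {q : ℂ} (hq0 : q ≠ 0) (a b : Fin X.rank) :
    (gRight X q (-1) (X.incl b) (X.incl a)).coeff 0 = q ^ (-((X.d b : ℤ) * X.cartan b a)) := by
  have h : ∀ s : Finset ℕ, ∀ f : ℕ → ℤ, ∏ t ∈ s, q ^ f t = q ^ ∑ t ∈ s, f t := by
    intro s f
    induction s using Finset.cons_induction with
    | empty => simp
    | cons t s hs ih => rw [Finset.prod_cons, Finset.sum_cons, zpow_add₀ hq0, ih]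
  rw [← X.sum_cartanBig a b, gRight, Polynomial.coeff_zero_prod]
  simp only [Polynomial.coeff_sub, Polynomial.coeff_C_zero, Polynomial.mul_coeff_zero,
    Polynomial.coeff_X_zero, mul_zero, sub_zero]
  rw [h]
  congr 1
  simp only [bExp, Finset.mul_sum, ← Finset.sum_neg_distrib, Units.val_neg, Units.val_one,
    neg_one_mul]

theorem xGen_sigma (s : ℤˣ) (i : Fin X.bigRank) (k : ℤ) :
    xGen X q s (X.sigma i) k = (omega X ^ k) • xGen X q s i k := by
  have := RingQuot.mkAlgHom_rel ℂ (Rel.sigma_x (X := X) (q := q) s i k)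
  rwa [map_smul] at this

theorem phiGen_sigma (s : ℤˣ) (i : Fin X.bigRank) (k : ℤ) :
    phiGen X q s (X.sigma i) k = (omega X ^ k) • phiGen X q s i k := by
  have := RingQuot.mkAlgHom_rel ℂ (Rel.sigma_phi (X := X) (q := q) s i k)
  rwa [map_smul] at this

theorem xGen_sigma_pow (s : ℤˣ) (i : Fin X.bigRank) (k : ℤ) (t : ℕ) :
    xGen X q s ((X.sigma ^ t) i) k = ((omega X ^ k) ^ t) • xGen X q s i k := by
  induction t with
  | zero => simp
  | succ t ih => rw [pow_succ', Equiv.Perm.mul_apply, xGen_sigma, ih, smul_smul, ← pow_succ']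

theorem phiGen_sigma_pow (s : ℤˣ) (i : Fin X.bigRank) (k : ℤ) (t : ℕ) :
    phiGen X q s ((X.sigma ^ t) i) k = ((omega X ^ k) ^ t) • phiGen X q s i k := by
  induction t with
  | zero => simp
  | succ t ih => rw [pow_succ', Equiv.Perm.mul_apply, phiGen_sigma, ih, smul_smul, ← pow_succ']

theorem phiGen_eq_zero {s : ℤˣ} {k : ℤ} (h : (s : ℤ) * k < 0) (i : Fin X.bigRank) :
    phiGen X q s i k = 0 := by
  rw [phiGen, fphi, if_neg h.not_ge, map_zero]

theorem phi_x_relation (e s : ℤˣ) (i j : Fin X.bigRank) (k l : ℤ) :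
    ∑ p ∈ Finset.range (X.r + 1),
        (gLeft X q s i j).coeff p • (phiGen X q e i (k - p) * xGen X q s j (l - (X.r - p)))
      = ∑ p ∈ Finset.range (X.r + 1),
        (gRight X q s i j).coeff p • (xGen X q s j (l - (X.r - p)) * phiGen X q e i (k - p)) := by
  have := RingQuot.mkAlgHom_rel ℂ (Rel.phi_x (X := X) (q := q) e s i j k l)
  simp only [map_sum, map_smul, map_mul] at this
  exact this

theorem x_plus_minus_relation (i j : Fin X.bigRank) (k l : ℤ) : ∃ c : ℂ,
    xGen X q 1 i k * xGen X q (-1) j l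
      = xGen X q (-1) j l * xGen X q 1 i k
        + c • (phiGen X q 1 i (k + l) - phiGen X q (-1) i (k + l)) := by
  have := RingQuot.mkAlgHom_rel ℂ (Rel.x_plus_minus (X := X) (q := q) i j k l)
  simp only [map_sub, map_smul, map_mul, smul_smul] at this
  exact ⟨_, sub_eq_iff_eq_add'.1 this⟩

/-- In degree zero only the term `p = 0` of the commutation relation survives, since `φ^+_{b,k} = 0`
for `k < 0`. Hence `x^-_{a,l}` lowers the weight by `α_a`. -/
theorem phi_zero_mul_x {q : ℂ} (hq0 : q ≠ 0) (a b : Fin X.rank) (l : ℤ) :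
    phiGen X q 1 (X.incl b) 0 * xGen X q (-1) (X.incl a) l
      = q ^ (-((X.d b : ℤ) * X.cartan b a)) •
        (xGen X q (-1) (X.incl a) l * phiGen X q 1 (X.incl b) 0) := by
  have h := phi_x_relation X q 1 (-1) (X.incl b) (X.incl a) 0 (l + X.r)
  have hz : ∀ p ∈ Finset.range (X.r + 1), p ≠ 0 → phiGen X q 1 (X.incl b) (0 - (p : ℤ)) = 0 := by
    intro p _ hp
    refine phiGen_eq_zero X q ?_ _
    simp only [Units.val_one, one_mul]
    omega
  rw [Finset.sum_eq_single 0 (fun p hp hp0 => by rw [hz p hp hp0, zero_mul, smul_zero]) (by simp),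
    Finset.sum_eq_single 0 (fun p hp hp0 => by rw [hz p hp hp0, mul_zero, smul_zero]) (by simp),
    gLeft_coeff_zero, gRight_coeff_zero X hq0, one_smul] at h
  simpa using h

variable {V : Type*} [AddCommGroup V] [Module ℂ V] [Module (QuantumAffine X q) V]

/-- Vectors obtained from `v` by applying operators `x^-_{a,k}`, where `μ` counts those for each
`a`. -/
inductive IsLoweringOf (v : V) : (Fin X.rank →₀ ℕ) → V → Prop
  | refl : IsLoweringOf v 0 v
  | step (a : Fin X.rank) (k : ℤ) (μ : Fin X.rank →₀ ℕ) (w : V) (h : IsLoweringOf v μ w) :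
      IsLoweringOf v (μ + Finsupp.single a 1) (xGen X q (-1) (X.incl a) k • w)

/-- The span of all vectors obtained from `v` by applying operators `x^-_{a,k}`. -/
def loweringSpan (v : V) : Submodule ℂ V :=
  Submodule.span ℂ {w | ∃ μ, IsLoweringOf X q v μ w}

variable {X q}

/-- The relation at `(k, l+r)` expresses `f k l` through values of `f` at smaller first index;
induction starts from the negative indices. It serves `φ^+`, and the reflected version below serves
`φ^-`. -/
theorem mem_of_forward_recursion {M : Submodule ℂ V} {f : ℤ → ℤ → V} {c : ℕ → ℂ} {r : ℕ}
    (hneg : ∀ k < 0, ∀ l, f k l ∈ M) (hc : c 0 ≠ 0)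
    (h : ∀ k l, ∑ p ∈ Finset.range (r + 1), c p • f (k - p) (l - (r - p)) ∈ M) (k l : ℤ) :
    f k l ∈ M := by
  have key : ∀ n : ℕ, ∀ k : ℤ, k < n → ∀ l, f k l ∈ M := by
    intro n
    induction n with
    | zero => simpa using hneg
    | succ n ih =>
      intro k hk l
      have h1 := h k (l + r)
      rw [Finset.sum_range_succ'] at h1
      have h2 : ∑ p ∈ Finset.range r,
          c (p + 1) • f (k - (p + 1 : ℕ)) (l + r - (r - (p + 1 : ℕ))) ∈ M :=
        Submodule.sum_mem _ fun p _ => Submodule.smul_mem _ _ (ih _ (by push_cast at *; omega) _)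
      have h3 := (Submodule.add_mem_iff_right _ h2).1 h1
      rw [Submodule.smul_mem_iff _ hc] at h3
      simpa using h3
  exact key (k.toNat + 1) k (by push_cast; omega) l

theorem mem_of_backward_recursion {M : Submodule ℂ V} {f : ℤ → ℤ → V} {c : ℕ → ℂ} {r : ℕ}
    (hpos : ∀ k > 0, ∀ l, f k l ∈ M) (hc : c r ≠ 0)
    (h : ∀ k l, ∑ p ∈ Finset.range (r + 1), c p • f (k - p) (l - (r - p)) ∈ M) (k l : ℤ) :
    f k l ∈ M := by
  -- Reflection `(k,l) ↦ (-k,-l)` together with `p ↦ r - p` interchanges the two ends of the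
  -- recursion.
  have h1 := mem_of_forward_recursion (M := M) (f := fun k l => f (-k) (-l))
    (c := fun p => c (r - p)) (r := r) (fun k hk l => hpos _ (by omega) _) (by simpa using hc)
    (fun k l => by
      have h2 := h (r - k) (r - l)
      rw [← Finset.sum_flip] at h2
      convert h2 using 1
      refine Finset.sum_congr rfl fun p hp => ?_
      have hp' : p ≤ r := Nat.lt_succ_iff.1 (Finset.mem_range.1 hp)
      rw [Nat.cast_sub hp']
      congr 2 <;> ring) (-k) (-l)
  simpa using h1

theorem IsLoweringOf.mem_span {v w : V} {μ : Fin X.rank →₀ ℕ} (h : IsLoweringOf X q v μ w) :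
    w ∈ loweringSpan X q v :=
  Submodule.subset_span ⟨μ, h⟩

variable [IsScalarTower ℂ (QuantumAffine X q) V]

theorem smul_mem_loweringSpan_of_forall {v : V} {u : QuantumAffine X q}
    (h : ∀ μ w, IsLoweringOf X q v μ w → u • w ∈ loweringSpan X q v) {w : V}
    (hw : w ∈ loweringSpan X q v) : u • w ∈ loweringSpan X q v := by
  have h1 : loweringSpan X q v ≤ (loweringSpan X q v).comap (Algebra.lsmul ℂ ℂ V u) := by
    refine Submodule.span_le.2 ?_
    rintro w ⟨μ, hw⟩
    exact h μ w hw
  exact h1 hw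

theorem x_minus_smul_mem_loweringSpan {v : V} (i : Fin X.bigRank) (k : ℤ) {w : V}
    (hw : w ∈ loweringSpan X q v) : xGen X q (-1) i k • w ∈ loweringSpan X q v := by
  obtain ⟨a, t, rfl⟩ := X.exists_sigma_pow_incl i
  rw [xGen_sigma_pow, smul_assoc]
  exact Submodule.smul_mem _ _ (smul_mem_loweringSpan_of_forall
    (fun μ w h => (IsLoweringOf.step a k μ w h).mem_span) hw)

/-- The relation between `φ` and `x^-` involves several terms on each side. Those with `x^-` on the
left lie in the span by induction on the word, and the recursions then isolate each single `φ_{i,k}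
x^-_{a,l} w`. -/
theorem phi_smul_mem_loweringSpan (hq0 : q ≠ 0) {v : V}
    (hv : ∀ (e : ℤˣ) i k, phiGen X q e i k • v ∈ loweringSpan X q v)
    {μ : Fin X.rank →₀ ℕ} {w : V} (hw : IsLoweringOf X q v μ w) :
    ∀ (e : ℤˣ) i k, phiGen X q e i k • w ∈ loweringSpan X q v := by
  induction hw with
  | refl => exact hv
  | step a l μ w hw ih =>
    intro e i k
    have hrel : ∀ k l : ℤ, ∑ p ∈ Finset.range (X.r + 1), (gLeft X q (-1) i (X.incl a)).coeff p •
        phiGen X q e i (k - p) • xGen X q (-1) (X.incl a) (l - (X.r - p)) • w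
          ∈ loweringSpan X q v := by
      intro k l
      have h1 := congrArg (fun u => u • w) (phi_x_relation X q e (-1) i (X.incl a) k l)
      simp only [Finset.sum_smul, smul_assoc, mul_smul] at h1
      rw [h1]
      exact Submodule.sum_mem _ fun p _ => Submodule.smul_mem _ _
        (x_minus_smul_mem_loweringSpan _ _ (ih _ _ _))
    rcases Int.units_eq_one_or e with rfl | rfl
    · refine mem_of_forward_recursion
        (f := fun k l => phiGen X q 1 i k • xGen X q (-1) (X.incl a) l • w) (fun k hk l => ?_)
        (by rw [gLeft_coeff_zero]; exact one_ne_zero) hrel k l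
      rw [phiGen_eq_zero X q (by simpa using hk), zero_smul]
      exact Submodule.zero_mem _
    · refine mem_of_backward_recursion
        (f := fun k l => phiGen X q (-1) i k • xGen X q (-1) (X.incl a) l • w) (fun k hk l => ?_)
        (gLeft_coeff_r_ne_zero X hq0 _ _ _) hrel k l
      rw [phiGen_eq_zero X q (by simpa using hk), zero_smul]
      exact Submodule.zero_mem _

/-- Moving `x^+` past `x^-` costs only `φ` terms, so induction on the word reduces to the highest
weight vector, which `x^+` kills. -/
theorem x_plus_smul_mem_loweringSpan (hq0 : q ≠ 0) {v : V}
    (hφ : ∀ (e : ℤˣ) i k, phiGen X q e i k • v ∈ loweringSpan X q v)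
    (hx : ∀ i k, xGen X q 1 i k • v = 0)
    {μ : Fin X.rank →₀ ℕ} {w : V} (hw : IsLoweringOf X q v μ w) :
    ∀ i k, xGen X q 1 i k • w ∈ loweringSpan X q v := by
  induction hw with
  | refl =>
    intro i k
    rw [hx]
    exact Submodule.zero_mem _
  | step a l μ w hw ih =>
    intro i k
    obtain ⟨c, hc⟩ := x_plus_minus_relation X q i (X.incl a) k l
    rw [← mul_smul, hc, add_smul, mul_smul, smul_assoc, sub_smul]
    have := phi_smul_mem_loweringSpan hq0 hφ hw
    exact Submodule.add_mem _ (x_minus_smul_mem_loweringSpan _ _ (ih _ _))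
      (Submodule.smul_mem _ _ (Submodule.sub_mem _ (this _ _ _) (this _ _ _)))

theorem smul_mem_loweringSpan (hq0 : q ≠ 0) {v : V}
    (hφ : ∀ (e : ℤˣ) i k, phiGen X q e i k • v ∈ loweringSpan X q v)
    (hx : ∀ i k, xGen X q 1 i k • v = 0) (u : QuantumAffine X q) {w : V}
    (hw : w ∈ loweringSpan X q v) : u • w ∈ loweringSpan X q v := by
  obtain ⟨f, rfl⟩ := RingQuot.mkAlgHom_surjective ℂ (Rel X q) u
  induction f using FreeAlgebra.induction generalizing w with
  | grade0 c =>
    rw [AlgHom.commutes, algebraMap_smul]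
    exact Submodule.smul_mem _ _ hw
  | grade1 g =>
    refine smul_mem_loweringSpan_of_forall (fun μ w' h => ?_) hw
    cases g with
    | x s i k =>
      rcases Int.units_eq_one_or s with rfl | rfl
      · exact x_plus_smul_mem_loweringSpan hq0 hφ hx h i k
      · exact x_minus_smul_mem_loweringSpan i k h.mem_span
    | phi s i m =>
      -- The free generator with sign `s` and index `m` is `φ^s_{i,sm}`.
      have h1 := phi_smul_mem_loweringSpan hq0 hφ h s i (s * m)
      have h2 : fphi s i ((s : ℤ) * m) = FreeAlgebra.ι ℂ (Gen.phi s i m) := by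
        rcases Int.units_eq_one_or s with rfl | rfl <;> simp [fphi]
      rwa [phiGen, h2] at h1
  | mul f g hf hg =>
    rw [map_mul, mul_smul]
    exact hf (hg hw)
  | add f g hf hg =>
    rw [map_add, add_smul]
    exact Submodule.add_mem _ (hf hw) (hg hw)

/-- The complex span is stable under all generators, so it is a submodule of a simple module, and it
contains `v ≠ 0`. -/
theorem loweringSpan_eq_top [IsSimpleModule (QuantumAffine X q) V] (hq0 : q ≠ 0) {v : V}
    (hv : v ≠ 0) (hφ : ∀ (e : ℤˣ) i k, phiGen X q e i k • v ∈ loweringSpan X q v)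
    (hx : ∀ i k, xGen X q 1 i k • v = 0) : loweringSpan X q v = ⊤ := by
  let M : Submodule (QuantumAffine X q) V :=
    { carrier := loweringSpan X q v
      add_mem' := Submodule.add_mem _
      zero_mem' := Submodule.zero_mem _
      smul_mem' := fun u _ hw => smul_mem_loweringSpan hq0 hφ hx u hw }
  have hvM : v ∈ M := (IsLoweringOf.refl : IsLoweringOf X q v 0 v).mem_span
  have hM : M = ⊤ := (eq_bot_or_eq_top M).resolve_left fun h => hv (by simpa [h] using hvM)
  exact eq_top_iff.2 fun w _ => (hM ▸ Submodule.mem_top : w ∈ M)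

theorem lowered_add_single (top : Fin X.rank → ℤ) (μ : Fin X.rank →₀ ℕ) (a b : Fin X.rank) :
    lowered X top (μ + Finsupp.single a 1) b = lowered X top μ b - X.cartan b a := by
  simp only [lowered, Finsupp.add_apply, Nat.cast_add, add_mul, Finset.sum_add_distrib]
  rw [Finset.sum_eq_single a (f := fun x => ((Finsupp.single a 1 x : ℕ) : ℤ) * X.cartan b x)
    (fun c _ hc => by simp [Finsupp.single_eq_of_ne hc]) (by simp)]
  simp
  ring

theorem IsLoweringOf.weight (hq0 : q ≠ 0) {top : Fin X.rank → ℤ} {v w : V}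
    {μ : Fin X.rank →₀ ℕ} (h : IsLoweringOf X q v μ w)
    (hv : ∀ b, phiGen X q 1 (X.incl b) 0 • v = q ^ ((X.d b : ℤ) * top b) • v) (b : Fin X.rank) :
    phiGen X q 1 (X.incl b) 0 • w = q ^ ((X.d b : ℤ) * lowered X top μ b) • w := by
  induction h with
  | refl => simpa [lowered] using hv b
  | step a k μ w h ih =>
    rw [← mul_smul, phi_zero_mul_x X hq0, smul_assoc, mul_smul, ih,
      smul_comm (xGen X q (-1) (X.incl a) k), smul_smul, ← zpow_add₀ hq0, lowered_add_single]
    congr 2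
    ring

/-- Comparison of constant terms at `u = 0`: the eigenvalue of `K_a` on the highest weight vector
depends only on the degree of the Drinfeld polynomial. -/
theorem phiGen_smul_eq_of_hasDrinfeldPolynomials {P : Polynomial ℂ} (hP : P.coeff 0 = 1)
    {a : Fin X.rank} {cp : ℕ → ℂ} {qa : ℂ}
    (h : ((Polynomial.expand ℂ (X.epsBig (X.incl a)) P : Polynomial ℂ) : PowerSeries ℂ)
        * PowerSeries.mk cp
      = ((Polynomial.expand ℂ (X.epsBig (X.incl a)) (Polynomial.C (qa ^ P.natDegree) *
          P.comp (Polynomial.C (qa⁻¹ ^ 2) * Polynomial.X)) : Polynomial ℂ) : PowerSeries ℂ)) :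
    cp 0 = qa ^ P.natDegree := by
  have he : 0 < X.epsBig (X.incl a) := by
    unfold AffineType.epsBig
    split_ifs
    exacts [X.r_pos, one_pos]
  have hcoeff : ∀ f : Polynomial ℂ,
      (Polynomial.expand ℂ (X.epsBig (X.incl a)) f).coeff 0 = f.coeff 0 := by
    intro f
    rw [Polynomial.coeff_expand he]
    simp
  have h1 := congrArg (PowerSeries.coeff 0) h
  rw [PowerSeries.coeff_zero_eq_constantCoeff_apply, map_mul,
    ← PowerSeries.coeff_zero_eq_constantCoeff_apply, ← PowerSeries.coeff_zero_eq_constantCoeff_apply,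
    Polynomial.coeff_coe, Polynomial.coeff_coe, hcoeff, hcoeff, hP,
    PowerSeries.coeff_mk, one_mul] at h1
  rw [h1, Polynomial.mul_coeff_zero, Polynomial.coeff_C_zero, Polynomial.coeff_zero_eq_eval_zero,
    Polynomial.eval_comp]
  simp [← Polynomial.coeff_zero_eq_eval_zero, hP]

theorem krPolynomial_coeff_zero (p : X.H) (ζ : ℂ) (b : Fin X.rank) :
    (krPolynomial X q p ζ b).coeff 0 = 1 := by
  unfold krPolynomial
  split_ifs
  · simp [Polynomial.coeff_zero_prod]
  · simp

theorem krPolynomial_natDegree (hq0 : q ≠ 0) (p : X.H) {ζ : ℂ} (hζ : ζ ≠ 0) (b : Fin X.rank) :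
    (krPolynomial X q p ζ b).natDegree = if b = p.1 then (p.2 : ℕ) else 0 := by
  unfold krPolynomial
  split_ifs
  · have h : ∀ c : ℂ, c ≠ 0 → (1 - Polynomial.C c * Polynomial.X).natDegree = 1 := by
      intro c hc
      rw [← Polynomial.C_1, sub_eq_neg_add, ← neg_mul, ← Polynomial.C_neg]
      exact Polynomial.natDegree_linear (neg_ne_zero.2 hc)
    have hc : ∀ n : ℤ, ζ * q ^ n ≠ 0 := fun n => mul_ne_zero hζ (zpow_ne_zero _ hq0)
    rw [Polynomial.natDegree_prod]
    · rw [Finset.sum_congr rfl fun k _ => h _ (hc _)]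
      simp
    · intro k _ h0
      have := h _ (hc (((X.eps p.1 * X.d p.1 : ℕ) : ℤ) * ((p.2 : ℕ) + 2 - 2 * k)))
      rw [h0] at this
      simp at this
  · simp

/-- The Drinfeld polynomial of degree `m` at node `a` gives highest weight `m ε_a Λ_a`; every word
in the `x^-` is a weight vector below it, and these words span. -/
theorem IsKRModule.exists_isWeightBasis (hq0 : q ≠ 0) {p : X.H} {ζ : ℂ} (hζ : ζ ≠ 0)
    (h : IsKRModule X q p ζ V) :
    ∃ (n : ℕ) (e : Module.Basis (Fin n) ℂ V) (μ : Fin n → Fin X.rank →₀ ℕ),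
      IsWeightBasis X q e (cartanAction X q V) (topWeight X (Finsupp.single p 1)) μ := by
  obtain ⟨hfin, hsimple, v, hv0, hx, hφ⟩ := h
  refine QAffine.exists_isWeightBasis X q ?_
  have hφv : ∀ (e : ℤˣ) i k, phiGen X q e i k • v ∈ loweringSpan X q v := by
    have hv : v ∈ loweringSpan X q v := (IsLoweringOf.refl : IsLoweringOf X q v 0 v).mem_span
    intro e i k
    obtain ⟨a, t, rfl⟩ := X.exists_sigma_pow_incl i
    rw [phiGen_sigma_pow, smul_assoc]
    refine Submodule.smul_mem _ _ ?_
    rcases lt_or_ge ((e : ℤ) * k) 0 with hneg | hpos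
    · rw [phiGen_eq_zero X q hneg, zero_smul]
      exact Submodule.zero_mem _
    · obtain ⟨cp, cm, hcp, hcm, -⟩ := hφ a
      rcases Int.units_eq_one_or e with rfl | rfl
      · obtain ⟨m, rfl⟩ : ∃ m : ℕ, k = m := ⟨k.toNat, by simp at hpos; omega⟩
        rw [hcp]
        exact Submodule.smul_mem _ _ hv
      · obtain ⟨m, rfl⟩ : ∃ m : ℕ, k = -m := ⟨(-k).toNat, by simp at hpos; omega⟩
        rw [hcm]
        exact Submodule.smul_mem _ _ hv
  have htop : ∀ b, phiGen X q 1 (X.incl b) 0 • v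
      = q ^ ((X.d b : ℤ) * topWeight X (Finsupp.single p 1) b) • v := by
    intro b
    obtain ⟨cp, cm, hcp, hcm, hP, -⟩ := hφ b
    have h0 := hcp 0
    rw [phiGen_smul_eq_of_hasDrinfeldPolynomials (krPolynomial_coeff_zero p ζ b) hP,
      krPolynomial_natDegree hq0 p hζ] at h0
    rw [Nat.cast_zero] at h0
    rw [h0, topWeight, Finsupp.sum_single_index (by simp), ← pow_mul, ← zpow_natCast]
    congr 2
    by_cases hb : b = p.1
    · rw [if_pos hb, if_pos hb.symm]
      push_cast
      ring
    · rw [if_neg hb, if_neg (Ne.symm hb)]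
      simp
  rw [eq_top_iff, ← loweringSpan_eq_top hq0 hv0 hφv hx]
  refine Submodule.span_mono ?_
  rintro w ⟨μ, hw⟩
  exact ⟨μ, hw.weight hq0 htop⟩

end HighestWeight

/-! ## The character of a tensor product of Kirillov–Reshetikhin modules -/

theorem topWeight_eq_sum (X : AffineType) (ν : X.H →₀ ℕ) :
    topWeight X ν = fun b => ∑ s : (Σ p : ν.support, Fin (ν p)),
      topWeight X (Finsupp.single (s.1 : X.H) 1) b := by
  funext b
  rw [Fintype.sum_sigma, topWeight, Finsupp.sum, ← Finset.sum_coe_sort]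
  refine Finset.sum_congr rfl fun p _ => ?_
  change _ = ∑ _y : Fin (ν p), topWeight X (Finsupp.single (p : X.H) 1) b
  rw [Finset.sum_const, Finset.card_univ, Fintype.card_fin, topWeight,
    Finsupp.sum_single_index (by simp)]
  split_ifs <;> simp [mul_assoc]

theorem tensorCharacter_eq_prod (X : AffineType) {q : ℂ} (hq0 : q ≠ 0)
    (hq : ∀ k : ℕ, 0 < k → q ^ k ≠ 1) {ζ : X.H → ℂ} (hζ : ∀ p, ζ p ≠ 0)
    (W : X.H → Type*) [∀ p, AddCommGroup (W p)] [∀ p, Module ℂ (W p)]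
    [∀ p, Module (QuantumAffine X q) (W p)] [∀ p, IsScalarTower ℂ (QuantumAffine X q) (W p)]
    (hW : ∀ p, IsKRModule X q p (ζ p) (W p)) (ν : X.H →₀ ℕ) :
    tensorCharacter X q W ν = ν.prod fun p e => krCharacter X q p (W p) ^ e := by
  choose n e μ he using fun p => (hW p).exists_isWeightBasis hq0 (hζ p)
  rw [tensorCharacter, topWeight_eq_sum]
  refine (normalizedCharacter_piTensorProduct X hq0 hq
    (S := Σ p : ν.support, Fin (ν p)) (V := fun s => W s.1) (fun s => he s.1)).trans ?_
  rw [Fintype.prod_sigma, Finsupp.prod,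
    ← Finset.prod_coe_sort ν.support fun p => krCharacter X q p (W p) ^ ν p]
  refine Fintype.prod_congr _ _ fun p => ?_
  change ∏ _y : Fin (ν p), krCharacter X q p (W p) = _
  rw [Finset.prod_const, Finset.card_univ, Fintype.card_fin]

end QAffine
end

/-! ### The corollary -/

theorem mainTheorem3 (X : QAffine.AffineType) (q : ℂ) (hq0 : q ≠ 0)
    (hq : ∀ k : ℕ, 0 < k → q ^ k ≠ 1)
    (ζ : X.H → ℂ) (hζ : ∀ p, ζ p ≠ 0)
    (W : X.H → Type*) [∀ p, AddCommGroup (W p)] [∀ p, Module ℂ (W p)]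
    [∀ p, Module (QAffine.QuantumAffine X q) (W p)]
    [∀ p, IsScalarTower ℂ (QAffine.QuantumAffine X q) (W p)]
    (hW : ∀ p, QAffine.IsKRModule X q p (ζ p) (W p))
    (Q : X.H → MvPowerSeries (Fin X.rank) ℂ) (hQ : QAffine.IsCanonicalSolution X Q)
    (hKR : ∀ p, QAffine.krCharacter X q p (W p) = Q p)
    (ν : X.H →₀ ℕ) :
    -- the normalized character of `W^ν` is the product of those of its factors,
    QAffine.tensorCharacter X q W ν
        = (ν.prod fun p e => QAffine.krCharacter X q p (W p) ^ e) ∧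
    -- and it equals `R^ν(y)`
    QAffine.tensorCharacter X q W ν = QAffine.RSeries X ν ∧
    -- `R(ν,N)` counts off-diagonal solutions of the string center equation up to permutations
    (∀ N : X.H →₀ ℕ, (∀ p ∈ N.support, 0 ≤ QAffine.vacancy X ν N p) →
      (QAffine.offDiagonalSolutions X ν N).Finite ∧
        ((QAffine.offDiagonalSolutions X ν N).ncard : ℚ) / ∏ p ∈ N.support, ((N p).factorial : ℚ)
          = QAffine.R X ν N) ∧
    -- hence weight multiplicities of `W^ν` are numbers of off-diagonal solutions
    (∀ μ : Fin X.rank →₀ ℕ,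
      (∀ N ∈ QAffine.patterns X μ, ∀ p ∈ N.support, 0 ≤ QAffine.vacancy X ν N p) →
      (QAffine.weightMultiplicity X q (QAffine.tensorCartanAction X q W ν)
          (QAffine.lowered X (QAffine.topWeight X ν) μ) : ℚ)
        = ∑ᶠ N ∈ QAffine.patterns X μ,
            ((QAffine.offDiagonalSolutions X ν N).ncard : ℚ)
              / ∏ p ∈ N.support, ((N p).factorial : ℚ)) := by
  have h1 := QAffine.tensorCharacter_eq_prod X hq0 hq hζ W hW ν
  have h2 : QAffine.tensorCharacter X q W ν = QAffine.RSeries X ν := by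
    rw [h1, ← QAffine.prod_eq_RSeries X hQ ν]
    simp only [hKR]
  refine ⟨h1, h2, QAffine.offDiagonalSolutions_card X ν, fun μ hμ => ?_⟩
  -- A power series is by definition the function of its coefficients, so evaluating the identity of
  -- series at `μ` is the identity of coefficients; it descends from `ℂ` to `ℚ` because both sides
  -- are rational.
  have h3 : (QAffine.weightMultiplicity X q (QAffine.tensorCartanAction X q W ν)
      (QAffine.lowered X (QAffine.topWeight X ν) μ) : ℂ)
        = ((∑ᶠ N ∈ QAffine.patterns X μ, QAffine.R X ν N : ℚ) : ℂ) := congrFun h2 μ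
  rw [← Rat.cast_natCast, Rat.cast_inj] at h3
  rw [h3]
  exact finsum_mem_congr rfl fun N hN =>
    (QAffine.offDiagonalSolutions_card X ν N (hμ N hN)).2.symm
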